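/- Let $X\subseteq\{1,2,3\}^{\mathbb N}$ be an irreducible one-sided shift of finite type given by a $3\times3$ transition matrix of zeros and ones, with shift map $\sigma_X$, and let $Y\subseteq\{1,2\}^{\mathbb N}$, with shift map $\sigma_Y$, be either the full shift or the shift of finite type with transition matrix $\begin{pmatrix}0&1\\1&1\end{pmatrix}$. (Irreducible means: for all words $u,v$ in the language of $X$ there is a word $w$ in the language such that $uwv$ is in the language.) Let $\pi:X\to Y$ be a factor map (continuous, surjective, $\pi\circ\sigma_X=\sigma_Y\circ\pi$) that is the one-block code given by $1\mapsto1$, $2\mapsto2$, $3\mapsto2$. Write $M(X,\sigma_X)$ and $M(Y,\sigma_Y)$ for the sets of shift-invariant Borel probability measures, and let $\mu\in M(X,\sigma_X)$ be the measure of maximal entropy, i.e. $h_\mu(\sigma_X)=\sup\{h_\nu(\sigma_X):\nu\in M(X,\sigma_X)\}$. Let $\pi\mu(B)=\mu(\pi^{-1}B)$. Let $\Phi=\{\log\phi_n\}_{n\ge1}$ be the sequence on $Y$ associated to the relative pressure function $P(\sigma_X,\pi,0)$: for $f\in C(X)$ the sequence $\{\log g_n\}_{n\ge 1}$ associated to $P(\sigma_X,\pi,f)$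 is given by $g_n(y)=\sup_{E_n(y)}\sum_{x\in E_n(y)}e^{(S_nf)(x)}$, where $S_nf=\sum_{i=0}^{n-1}f\circ\sigma_X^i$ and $E_n(y)$ runs over the sets consisting of exactly one point from each cylinder $[x_1\dots x_n]$ of $X$ with $\pi(x_1\dots x_n)=y_1\dots y_n$; so $\phi_n(y)$ is the number of words $x_1\dots x_n$ in the language of $X$ that $\pi$ maps to $y_1\dots y_n$. The sequence $\Phi$ is *almost additive* if there is $C>0$ with $e^{-C}\phi_n(y)\phi_m(\sigma_Y^ny)\le\phi_{n+m}(y)\le e^{C}\phi_n(y)\phi_m(\sigma_Y^ny)$ for all $y\in Y$ and $n,m\ge1$, and *weakly almost additive* if there are $C_n>0$ with $\lim_{n\to\infty}C_n/n=0$ such that these inequalities hold with $C_n$ in place of $C$. A measure $\nu\in M(Y,\sigma_Y)$ is an *invariant weak Gibbs measure* for $g:Y\to\mathbb R$ if there are $P\in\mathbb R$ and $C_n>0$ with $\lim_{n\to\infty}\frac1n\log C_n=0$ such that $$\frac1{C_n}\le\frac{\nu[y_1\dots y_n]}{e^{-nP}e^{(S_ng)(y)}}\le C_n\qquad\text{for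 all }y\in Y,\ n\ge1,$$ where $S_ng=\sum_{i=0}^{n-1}g\circ\sigma_Y^i$; it is an *invariant Gibbs measure* for $g$ if $C_n$ can be taken independent of $n$. Then $\Phi$ is almost additive on $Y$ if and only if there exists $\hat g\in C(Y)$ for which $\pi\mu$ is the unique invariant Gibbs measure. Moreover, if $\Phi$ is weakly almost additive on $Y$, then there exists $\hat g\in C(Y)$ for which $\pi\mu$ is the unique invariant weak Gibbs measure. -/

import Mathlib

open MeasureTheory Filter Topology

/-- A one-sided subshift over `k` symbols: a closed set of sequences, mapped into itself by the
left shift. The symbols `1, …, k` are represented by `0, …, k - 1 : Fin k`, and the coordinates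
`1, 2, …` of a point by `0, 1, …`. -/
structure Subshift (k : ℕ) where
  carrier : Set (ℕ → Fin k)
  isClosed : IsClosed carrier
  shift_mem : ∀ x ∈ carrier, (fun n => x (n + 1)) ∈ carrier

namespace Subshift

instance (k : ℕ) : CoeSort (Subshift k) Type where
  coe X := X.carrier

/-- The shift map `σ_X : X → X`. -/
def shift {k : ℕ} (X : Subshift k) (x : X) : X :=
  ⟨fun n => x.1 (n + 1), X.shift_mem x.1 x.2⟩

/-- The cylinder `[x_1 … x_n]` in `X` determined by the first `n` coordinates of `x ∈ X`. -/
def cylinder {k : ℕ} (X : Subshift k) (x : X) (n : ℕ) : Set X :=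
  {z | ∀ i < n, z.1 i = x.1 i}

/-- The language `B(X)`: all finite words that appear in points of `X`. -/
def language {k : ℕ} (X : Subshift k) : Set (List (Fin k)) :=
  {w | ∃ x : X, ∃ i : ℕ, w = List.ofFn (fun j : Fin w.length => x.1 (i + j))}

/-- Irreducibility of a subshift. -/
def IsIrreducible {k : ℕ} (X : Subshift k) : Prop :=
  ∀ u ∈ X.language, ∀ v ∈ X.language, ∃ w ∈ X.language, u ++ w ++ v ∈ X.language

/-- The one-sided shift of finite type `X_A` with transition matrix `A`. -/
def ofMatrix {k : ℕ} (A : Matrix (Fin k) (Fin k) ℕ) : Subshift k where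
  carrier := {x | ∀ n, A (x n) (x (n + 1)) = 1}
  isClosed := by
    rw [Set.ofPred_forall]
    refine isClosed_iInter fun n => ?_
    have h : Continuous fun x : ℕ → Fin k => (x n, x (n + 1)) := by fun_prop
    exact (isClosed_discrete {p : Fin k × Fin k | A p.1 p.2 = 1}).preimage h
  shift_mem := fun _ hx n => hx (n + 1)

/-- Factor maps between subshifts. -/
def IsFactorMap {k l : ℕ} {X : Subshift k} {Y : Subshift l} (π : X → Y) : Prop :=
  Continuous π ∧ Function.Surjective π ∧ ∀ x, π (X.shift x) = Y.shift (π x)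

/-- `π` is the one-block code induced by the map of symbols `φ`. -/
def IsOneBlockCode {k l : ℕ} {X : Subshift k} {Y : Subshift l}
    (φ : Fin k → Fin l) (π : X → Y) : Prop :=
  ∀ (x : X) (i : ℕ), (π x).1 i = φ (x.1 i)

/-- `M(X, σ_X)`: the shift-invariant Borel probability measures on `X`. -/
def IsInvariant {k : ℕ} (X : Subshift k) (μ : Measure X) : Prop :=
  IsProbabilityMeasure μ ∧ MeasurePreserving X.shift μ μ

end Subshift

section Entropy

/-- The Shannon entropy `-∑ μ(P_i) log μ(P_i)` of the finite partition with atoms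
`P_i = α⁻¹{i}`. -/
noncomputable def partitionEntropy {Ω ι : Type} [MeasurableSpace Ω] [Fintype ι]
    (μ : Measure Ω) (α : Ω → ι) : ℝ :=
  ∑ i, Real.negMulLog (μ.real (α ⁻¹' {i}))

/-- The entropy of `T` relative to the finite partition `α`: the limit (which exists when `T`
preserves the probability measure `μ`) of `H_μ(α ∨ T⁻¹α ∨ … ∨ T^{-(n-1)}α) / n`. -/
noncomputable def entropyOfPartition {Ω : Type} [MeasurableSpace Ω] (μ : Measure Ω) (T : Ω → Ω)
    {k : ℕ} (α : Ω → Fin k) : EReal :=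
  limsup (fun n : ℕ =>
    ((partitionEntropy μ (fun x (i : Fin n) => α (T^[i] x)) / n : ℝ) : EReal)) atTop

/-- The Kolmogorov–Sinai entropy `h_μ(T)`: the supremum over all finite measurable
partitions. -/
noncomputable def measureEntropy {Ω : Type} [MeasurableSpace Ω] (μ : Measure Ω) (T : Ω → Ω) :
    EReal :=
  ⨆ (k : ℕ) (α : Ω → Fin k) (_ : Measurable α), entropyOfPartition μ T α

end Entropy

namespace Subshift

/-- `μ ∈ M(X, σ_X)` is a measure of maximal entropy:
`h_μ(σ_X) = sup {h_ν(σ_X) : ν ∈ M(X, σ_X)}`. -/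
def IsMaximalEntropy {k : ℕ} (X : Subshift k) (μ : Measure X) : Prop :=
  X.IsInvariant μ ∧
    measureEntropy μ X.shift =
      ⨆ (ν : Measure X) (_ : X.IsInvariant ν), measureEntropy ν X.shift

/-- `E` consists of exactly one point from each cylinder `[x_1 … x_n]` of `X` with
`π(x_1 … x_n) = y_1 … y_n`, where `π` is a one-block code. -/
def IsFiberSection {k l : ℕ} {X : Subshift k} {Y : Subshift l} (π : X → Y)
    (n : ℕ) (y : Y) (E : Finset X) : Prop :=
  (∀ x ∈ E, π x ∈ Y.cylinder y n) ∧
    ∀ x : X, π x ∈ Y.cylinder y n → ∃! e : X, e ∈ E ∧ e ∈ X.cylinder x n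

/-- The functions `g_n` for which `{log g_n}` is the sequence on `Y` associated to the relative
pressure function `P(σ_X, π, f)`:
`g_n(y) = sup ∑_{x ∈ E} exp ((S_n f)(x))`, the supremum being over the sets `E` as above. -/
noncomputable def relPressureSeq {k l : ℕ} {X : Subshift k} {Y : Subshift l} (π : X → Y)
    (f : X → ℝ) (n : ℕ) (y : Y) : ℝ :=
  sSup {s : ℝ | ∃ E : Finset X, IsFiberSection π n y E ∧
    s = ∑ x ∈ E, Real.exp (birkhoffSum X.shift f n x)}

/-- The sequence `{log f_n}_{n ≥ 1}` is almost additive. -/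
def AlmostAdditive {k : ℕ} (X : Subshift k) (f : ℕ → X → ℝ) : Prop :=
  ∃ C : ℝ, 0 < C ∧ ∀ (x : X) (n m : ℕ), 1 ≤ n → 1 ≤ m →
    f (n + m) x ≤ Real.exp C * f n x * f m (X.shift^[n] x) ∧
    Real.exp (-C) * f n x * f m (X.shift^[n] x) ≤ f (n + m) x

/-- The sequence `{log f_n}_{n ≥ 1}` is weakly almost additive. -/
def WeaklyAlmostAdditive {k : ℕ} (X : Subshift k) (f : ℕ → X → ℝ) : Prop :=
  ∃ C : ℕ → ℝ, (∀ n, 1 ≤ n → 0 < C n) ∧ Tendsto (fun n : ℕ => C n / n) atTop (𝓝 0) ∧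
    ∀ (x : X) (n m : ℕ), 1 ≤ n → 1 ≤ m →
      f (n + m) x ≤ Real.exp (C n) * f n x * f m (X.shift^[n] x) ∧
      Real.exp (-C n) * f n x * f m (X.shift^[n] x) ≤ f (n + m) x

/-- `1 / C_n ≤ μ[x_1 … x_n] / exp (-n P + (S_n g)(x)) ≤ C_n` for all `x ∈ X` and `n ≥ 1`. -/
def GibbsBounds {k : ℕ} (X : Subshift k) (μ : Measure X) (g : X → ℝ) (P : ℝ) (C : ℕ → ℝ) :
    Prop :=
  ∀ (x : X) (n : ℕ), 1 ≤ n →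
    1 / C n ≤ μ.real (X.cylinder x n) /
      (Real.exp (-(n * P)) * Real.exp (birkhoffSum X.shift g n x)) ∧
    μ.real (X.cylinder x n) /
      (Real.exp (-(n * P)) * Real.exp (birkhoffSum X.shift g n x)) ≤ C n

/-- `μ` is an invariant Gibbs measure for `g`. -/
def IsInvariantGibbs {k : ℕ} (X : Subshift k) (μ : Measure X) (g : X → ℝ) : Prop :=
  X.IsInvariant μ ∧ ∃ P C : ℝ, 0 < C ∧ X.GibbsBounds μ g P (fun _ => C)

/-- `μ` is an invariant weak Gibbs measure for `g`. -/
def IsInvariantWeakGibbs {k : ℕ} (X : Subshift k) (μ : Measure X) (g : X → ℝ) : Prop :=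
  X.IsInvariant μ ∧ ∃ (P : ℝ) (C : ℕ → ℝ), (∀ n, 1 ≤ n → 0 < C n) ∧
    Tendsto (fun n : ℕ => Real.log (C n) / n) atTop (𝓝 0) ∧ X.GibbsBounds μ g P C

end Subshift

/-!
The measure of maximal entropy `μ` of an irreducible shift of finite type is its Parry measure: the
Parry measure bounds the entropy of every invariant measure, with equality only for measures that
have its transition probabilities. Hence `μ[x₁ … xₙ]` is comparable to `λ⁻ⁿ`, where `λ` is the
Perron eigenvalue, and `πμ[y₁ … yₙ]` is comparable to `λ⁻ⁿ φₙ(y)`. Up to constants, (weak) almost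
additivity of `Φ` thus says that the cylinder masses of `πμ` are multiplicative, which for a Gibbs
measure is immediate.

Conversely, the symbol `1` of `Y` has a single preimage, so `πμ` renews at it, and the conditional
probability of the first symbol given the rest of the point depends only on the length of the run
of symbols `2` that follows. These conditional probabilities converge as the run grows, because the
masses of the runs are governed by the powers of the `2 × 2` matrix of transitions between the
preimages `2` and `3`. Their logarithm is therefore a continuous normalized potential `ĝ`, and
multiplicativity of the cylinder masses yields the Gibbs bounds for it. For uniqueness, a weak Gibbs
measure for `ĝ` has pressure zero and so attains the bound `h_ν + ∫ ĝ dν ≤ 0`; the equality case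
shows that it has the same transition probabilities as `πμ`, and these determine the measure.
In the code the symbols are numbered from `0`.
-/

namespace Subshift

variable {k : ℕ} (Z : Subshift k)

instance : CompactSpace Z := isCompact_iff_compactSpace.mp Z.isClosed.isCompact

instance : BorelSpace Z := inferInstanceAs (BorelSpace Z.carrier)

lemma continuous_coord (i : ℕ) : Continuous fun z : Z => z.1 i :=
  (continuous_apply i).comp continuous_subtype_val

lemma continuous_shift : Continuous Z.shift :=
  Continuous.subtype_mk (continuous_pi fun n => Z.continuous_coord (n + 1)) _

lemma measurable_shift : Measurable Z.shift := Z.continuous_shift.measurable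

@[simp] lemma shift_coord (z : Z) (i : ℕ) : (Z.shift z).1 i = z.1 (i + 1) := rfl

@[simp] lemma iterate_shift_coord (n : ℕ) (z : Z) (i : ℕ) :
    (Z.shift^[n] z).1 i = z.1 (n + i) := by
  induction n generalizing z with
  | zero => simp
  | succ n ih =>
    rw [Function.iterate_succ_apply, ih, shift_coord, show n + i + 1 = n + 1 + i by omega]

/-- The word `z_1 … z_n` of the first `n` symbols of a point, indexed by `Fin n`. -/
def word (n : ℕ) (z : Z) : Fin n → Fin k := fun i => z.1 i

lemma continuous_word (n : ℕ) : Continuous (Z.word n) :=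
  continuous_pi fun i => Z.continuous_coord i

lemma measurable_word (n : ℕ) : Measurable (Z.word n) := (Z.continuous_word n).measurable

lemma word_eq_iff {n : ℕ} {z z' : Z} : Z.word n z = Z.word n z' ↔ ∀ i < n, z.1 i = z'.1 i :=
  ⟨fun h i hi => congrFun h ⟨i, hi⟩, fun h => funext fun i => h i i.2⟩

lemma word_succ (n : ℕ) (z : Z) :
    Z.word (n + 1) z = Fin.cons (z.1 0) (Z.word n (Z.shift z)) :=
  funext fun i => Fin.cases rfl (fun _ => rfl) i

lemma cylinder_eq_preimage (z : Z) (n : ℕ) : Z.cylinder z n = Z.word n ⁻¹' {Z.word n z} :=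
  Set.ext fun _ => Z.word_eq_iff.symm

lemma isClopen_cylinder (z : Z) (n : ℕ) : IsClopen (Z.cylinder z n) := by
  rw [cylinder_eq_preimage]
  exact (isClopen_discrete _).preimage (Z.continuous_word n)

lemma measurableSet_cylinder (z : Z) (n : ℕ) : MeasurableSet (Z.cylinder z n) :=
  (Z.isClopen_cylinder z n).isOpen.measurableSet

lemma self_mem_cylinder (z : Z) (n : ℕ) : z ∈ Z.cylinder z n := fun _ _ => rfl

lemma cylinder_eq_of_mem {z x : Z} {n : ℕ} (h : x ∈ Z.cylinder z n) :
    Z.cylinder x n = Z.cylinder z n :=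
  Set.ext fun _ => ⟨fun hy i hi => (hy i hi).trans (h i hi),
    fun hy i hi => (hy i hi).trans (h i hi).symm⟩

lemma cylinder_anti (z : Z) : Antitone (Z.cylinder z) :=
  fun _ _ h _ hx i hi => hx i (hi.trans_le h)

@[simp] lemma cylinder_zero (z : Z) : Z.cylinder z 0 = Set.univ := by
  ext; simp [cylinder]

lemma cylinder_one (z : Z) : Z.cylinder z 1 = {x | x.1 0 = z.1 0} := by
  ext; simp [cylinder]

lemma isTopologicalBasis_cylinders :
    TopologicalSpace.IsTopologicalBasis {s | ∃ (z : Z) (n : ℕ), s = Z.cylinder z n} := by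
  refine TopologicalSpace.isTopologicalBasis_of_isOpen_of_nhds ?_ fun z u hz hu => ?_
  · rintro _ ⟨z, n, rfl⟩
    exact (Z.isClopen_cylinder z n).isOpen
  · obtain ⟨v, hv, rfl⟩ := isOpen_induced_iff.mp hu
    obtain ⟨_, ⟨x, n, rfl⟩, hzx, hxv⟩ :=
      (PiNat.isTopologicalBasis_cylinders fun _ => Fin k).exists_subset_of_mem_open hz hv
    rw [← PiNat.mem_cylinder_iff_eq.mp hzx] at hxv
    exact ⟨_, ⟨z, n, rfl⟩, Z.self_mem_cylinder z n, fun _ hy => hxv hy⟩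

lemma isPiSystem_cylinders : IsPiSystem {s | ∃ (z : Z) (n : ℕ), s = Z.cylinder z n} := by
  rintro _ ⟨x, n, rfl⟩ _ ⟨y, m, rfl⟩ ⟨z, hzx, hzy⟩
  rw [← Z.cylinder_eq_of_mem hzx, ← Z.cylinder_eq_of_mem hzy]
  rcases le_total n m with h | h
  · exact ⟨z, m, Set.inter_eq_right.mpr (Z.cylinder_anti z h)⟩
  · exact ⟨z, n, Set.inter_eq_left.mpr (Z.cylinder_anti z h)⟩

lemma measurableSpace_eq_generateFrom : (inferInstance : MeasurableSpace Z) =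
    MeasurableSpace.generateFrom {s | ∃ (z : Z) (n : ℕ), s = Z.cylinder z n} :=
  BorelSpace.measurable_eq.trans Z.isTopologicalBasis_cylinders.borel_eq_generateFrom

lemma measure_ext_of_cylinder {μ ν : Measure Z} [IsFiniteMeasure μ]
    (h : ∀ z n, μ (Z.cylinder z n) = ν (Z.cylinder z n)) : μ = ν := by
  refine ext_of_generate_finite _ Z.measurableSpace_eq_generateFrom Z.isPiSystem_cylinders ?_ ?_
  · rintro _ ⟨z, n, rfl⟩
    exact h z n
  · rcases isEmpty_or_nonempty Z with hZ | ⟨⟨z⟩⟩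
    · simp [Set.eq_empty_of_isEmpty]
    · simpa using h z 0

variable {Z} in
lemma integrable_of_continuous {ν : Measure Z} [IsFiniteMeasure ν] {f : Z → ℝ}
    (hf : Continuous f) : Integrable f ν :=
  hf.integrable_of_hasCompactSupport (HasCompactSupport.of_compactSpace f)

variable {Z} in
/-- Otherwise the compact sets of pairs that violate the conclusion for `n` would have a common
point, which lies on the diagonal. -/
lemma exists_dist_lt_of_word_eq {M : Type*} [PseudoMetricSpace M] {f : Z → M} (hf : Continuous f)
    {ε : ℝ} (hε : 0 < ε) :
    ∃ n, ∀ m ≥ n, ∀ z z' : Z, Z.word m z = Z.word m z' → dist (f z) (f z') < ε := by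
  let t (n : ℕ) : Set (Z × Z) :=
    {p | Z.word n p.1 = Z.word n p.2} ∩ {p | ε ≤ dist (f p.1) (f p.2)}
  have ht_anti : Antitone t := fun n m hnm p hp =>
    ⟨Z.word_eq_iff.mpr fun i hi => Z.word_eq_iff.mp hp.1 i (hi.trans_le hnm), hp.2⟩
  have ht_closed : ∀ n, IsClosed (t n) := fun n =>
    (isClosed_eq ((Z.continuous_word n).comp continuous_fst)
      ((Z.continuous_word n).comp continuous_snd)).inter
    (isClosed_le continuous_const
      ((hf.comp continuous_fst).dist (hf.comp continuous_snd)))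
  obtain ⟨n, hn⟩ : ∃ n, ¬ (t n).Nonempty := by
    by_contra! h
    obtain ⟨⟨z, z'⟩, hz⟩ := IsCompact.nonempty_iInter_of_sequence_nonempty_isCompact_isClosed t
      (fun n => ht_anti n.le_succ) h (ht_closed 0).isCompact ht_closed
    rw [Set.mem_iInter] at hz
    have heq : z = z' := Subtype.ext <| funext fun i =>
      Z.word_eq_iff.mp (hz (i + 1)).1 i i.lt_succ_self
    have hdist : ε ≤ dist (f z) (f z') := (hz 0).2
    rw [heq, dist_self] at hdist
    exact hε.not_ge hdist
  refine ⟨n, fun m hm z z' hzz' => ?_⟩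
  by_contra! h
  exact hn ⟨(z, z'), ht_anti hm ⟨hzz', h⟩⟩

/-- The set `i E` of the points that start with the symbol `i` and whose shift lies in `E`. -/
def prepend (i : Fin k) (E : Set Z) : Set Z := {z | z.1 0 = i ∧ Z.shift z ∈ E}

lemma isClopen_symbol (n : ℕ) (i : Fin k) : IsClopen {z : Z | z.1 n = i} :=
  (isClopen_discrete {i}).preimage (Z.continuous_coord n)

lemma isClopen_prepend (i : Fin k) {E : Set Z} (hE : IsClopen E) : IsClopen (Z.prepend i E) :=
  (Z.isClopen_symbol 0 i).inter (hE.preimage Z.continuous_shift)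

lemma prepend_mono (i : Fin k) {E F : Set Z} (h : E ⊆ F) : Z.prepend i E ⊆ Z.prepend i F :=
  fun _ hz => ⟨hz.1, h hz.2⟩

/-- The set `w E` of the points that start with the word `w` and from there on continue in `E`. -/
def prependWord (w : List (Fin k)) (E : Set Z) : Set Z := w.foldr Z.prepend E

@[simp] lemma prependWord_nil (E : Set Z) : Z.prependWord [] E = E := rfl

@[simp] lemma prependWord_cons (i : Fin k) (w : List (Fin k)) (E : Set Z) :
    Z.prependWord (i :: w) E = Z.prepend i (Z.prependWord w E) := rfl

lemma prependWord_append (u v : List (Fin k)) (E : Set Z) :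
    Z.prependWord (u ++ v) E = Z.prependWord u (Z.prependWord v E) := List.foldr_append

lemma isClopen_prependWord (w : List (Fin k)) {E : Set Z} (hE : IsClopen E) :
    IsClopen (Z.prependWord w E) := by
  induction w with
  | nil => exact hE
  | cons i w ih => exact Z.isClopen_prepend i ih

lemma cylinder_succ (z : Z) (n : ℕ) :
    Z.cylinder z (n + 1) = Z.prepend (z.1 0) (Z.cylinder (Z.shift z) n) := by
  ext x
  exact ⟨fun h => ⟨h 0 n.succ_pos, fun i hi => h (i + 1) (by omega)⟩,
    fun ⟨h0, h⟩ i hi => match i with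
      | 0 => h0
      | i + 1 => h i (by omega)⟩

lemma cylinder_eq_prependWord (z : Z) (n : ℕ) :
    Z.cylinder z n = Z.prependWord (List.ofFn (Z.word n z)) Set.univ := by
  induction n generalizing z with
  | zero => simp
  | succ n ih => rw [cylinder_succ, word_succ, List.ofFn_cons, prependWord_cons, ih]

lemma measure_ext_of_prependWord {μ ν : Measure Z} [IsFiniteMeasure μ]
    (h : ∀ w, μ (Z.prependWord w Set.univ) = ν (Z.prependWord w Set.univ)) : μ = ν :=
  Z.measure_ext_of_cylinder fun z n => by rw [cylinder_eq_prependWord]; exact h _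

end Subshift

section BirkhoffSum

variable {Ω : Type*} [MeasurableSpace Ω] {μ : Measure Ω} {T : Ω → Ω} {g : Ω → ℝ}

lemma integrable_birkhoffSum (hT : MeasurePreserving T μ μ) (hg : Integrable g μ) (n : ℕ) :
    Integrable (birkhoffSum T g n) μ :=
  integrable_finsetSum _ fun i _ => (hT.iterate i).integrable_comp_of_integrable hg

lemma integral_comp_of_measurePreserving (hT : MeasurePreserving T μ μ)
    (hg : AEStronglyMeasurable g μ) : ∫ ω, g (T ω) ∂μ = ∫ ω, g ω ∂μ := by
  rw [← integral_map hT.measurable.aemeasurable (by rwa [hT.map_eq]), hT.map_eq]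

lemma integral_birkhoffSum (hT : MeasurePreserving T μ μ) (hg : Integrable g μ) (n : ℕ) :
    ∫ ω, birkhoffSum T g n ω ∂μ = n * ∫ ω, g ω ∂μ := by
  have hint : ∀ i, Integrable (fun ω => g (T^[i] ω)) μ := fun i =>
    (hT.iterate i).integrable_comp_of_integrable hg
  simp only [birkhoffSum]
  rw [integral_finsetSum _ fun i _ => hint i]
  simp [integral_comp_of_measurePreserving (hT.iterate _) hg.aestronglyMeasurable]

end BirkhoffSum

lemma negMulLog_le_sub {t p : ℝ} (ht : 0 ≤ t) (hp : 0 ≤ p) (htp : 0 < t → 0 < p) :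
    Real.negMulLog t ≤ p - t - t * Real.log p := by
  rcases ht.eq_or_lt with rfl | ht
  · simpa using hp
  · have hlog := mul_le_mul_of_nonneg_left
      (Real.log_le_sub_one_of_pos (div_pos (htp ht) ht)) ht.le
    rw [Real.log_div (htp ht).ne' ht.ne', mul_sub_one, mul_div_cancel₀ _ ht.ne'] at hlog
    rw [Real.negMulLog]
    linarith

/-- The partition `α ∨ T⁻¹α ∨ … ∨ T^{-(n-1)}α`, as a map to the `n`-tuples of labels. -/
def itinerary {Ω ι : Type} (T : Ω → Ω) (α : Ω → ι) (n : ℕ) (ω : Ω) : Fin n → ι :=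
  fun i => α (T^[i] ω)

section Partition

variable {Ω ι κ : Type} [MeasurableSpace Ω] {μ : Measure Ω} {T : Ω → Ω} {α : Ω → ι} {β : Ω → κ}

lemma measureReal_fiber_pos_of_ae [IsFiniteMeasure μ] {p : ι → Prop} {i : ι}
    (hi : 0 < μ.real (α ⁻¹' {i})) (hp : ∀ᵐ ω ∂μ, p (α ω)) : p i := by
  by_contra hpi
  refine hi.ne' ((measureReal_eq_zero_iff).mpr (measure_eq_zero_iff_ae_notMem.mpr ?_))
  filter_upwards [hp] with ω hω hωi
  exact hpi (hωi ▸ hω)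

lemma ae_measureReal_fiber_pos [Countable ι] [IsFiniteMeasure μ] :
    ∀ᵐ ω ∂μ, 0 < μ.real (α ⁻¹' {α ω}) := by
  have h : ∀ i, ∀ᵐ ω ∂μ, α ω = i → 0 < μ.real (α ⁻¹' {i}) := fun i => by
    by_cases h0 : μ (α ⁻¹' {i}) = 0
    · filter_upwards [measure_eq_zero_iff_ae_notMem.mp h0] with ω hω hi
      exact absurd hi hω
    · exact Eventually.of_forall fun _ _ => ENNReal.toReal_pos h0 (measure_ne_top _ _)
  filter_upwards [ae_all_iff.mpr h] with ω hω
  exact hω _ rfl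

variable [MeasurableSpace ι]

lemma measurable_itinerary (hT : Measurable T) (hα : Measurable α) (n : ℕ) :
    Measurable (itinerary T α n) :=
  measurable_pi_iff.mpr fun i => hα.comp (hT.iterate i)

variable [MeasurableSingletonClass ι]

lemma integrable_comp_of_finite [Finite ι] [IsFiniteMeasure μ] (hα : Measurable α) (F : ι → ℝ) :
    Integrable (fun ω => F (α ω)) μ :=
  (Integrable.of_finite (μ := μ.map α)).comp_measurable hα

variable [Fintype ι]

lemma integral_comp_of_finite [IsFiniteMeasure μ] (hα : Measurable α) (F : ι → ℝ) :
    ∫ ω, F (α ω) ∂μ = ∑ i, μ.real (α ⁻¹' {i}) * F i := by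
  rw [← integral_map (φ := α) (f := F) hα.aemeasurable
    (Integrable.of_finite (f := F)).aestronglyMeasurable,
    integral_fintype Integrable.of_finite]
  simp [map_measureReal_apply hα (measurableSet_singleton _)]

lemma sum_measureReal_fiber [IsProbabilityMeasure μ] (hα : Measurable α) :
    ∑ i, μ.real (α ⁻¹' {i}) = 1 := by
  simpa using (integral_comp_of_finite (μ := μ) hα (fun _ => (1 : ℝ))).symm

lemma partitionEntropy_eq_neg_integral_log [IsFiniteMeasure μ] (hα : Measurable α) :
    partitionEntropy μ α = -∫ ω, Real.log (μ.real (α ⁻¹' {α ω})) ∂μ := by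
  rw [integral_comp_of_finite hα (fun i => Real.log (μ.real (α ⁻¹' {i})))]
  simp [partitionEntropy, Real.negMulLog, Finset.sum_neg_distrib]

lemma partitionEntropy_comp_of_measurePreserving (hT : MeasurePreserving T μ μ)
    (hα : Measurable α) : partitionEntropy μ (α ∘ T) = partitionEntropy μ α := by
  simp only [partitionEntropy, Set.preimage_comp]
  simp only [hT.measureReal_preimage (hα (measurableSet_singleton _)).nullMeasurableSet]

lemma partitionEntropy_le_neg_integral_log [IsProbabilityMeasure μ] (hα : Measurable α)
    {p : ι → ℝ} (hp : ∀ i, 0 ≤ p i) (hsum : ∑ i, p i ≤ 1) (hpos : ∀ᵐ ω ∂μ, 0 < p (α ω)) :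
    partitionEntropy μ α ≤ -∫ ω, Real.log (p (α ω)) ∂μ := by
  rw [integral_comp_of_finite hα fun i => Real.log (p i)]
  calc partitionEntropy μ α
      ≤ ∑ i, (p i - μ.real (α ⁻¹' {i}) - μ.real (α ⁻¹' {i}) * Real.log (p i)) :=
        Finset.sum_le_sum fun i _ => negMulLog_le_sub measureReal_nonneg (hp i)
          fun hi => measureReal_fiber_pos_of_ae (p := fun i => 0 < p i) hi hpos
    _ = (∑ i, p i - 1) - ∑ i, μ.real (α ⁻¹' {i}) * Real.log (p i) := by
        simp only [Finset.sum_sub_distrib, sum_measureReal_fiber hα]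
    _ ≤ _ := by linarith

variable [Fintype κ] [MeasurableSpace κ] [MeasurableSingletonClass κ]

/-- Gibbs' inequality for the distribution that `r` makes of the distribution of `β`. The integral
bounds the conditional entropy of `α` given `β`. -/
lemma partitionEntropy_le_sub_integral_log [IsProbabilityMeasure μ] (hα : Measurable α)
    (hβ : Measurable β) {r : κ → ι → ℝ} (hr : ∀ b a, 0 ≤ r b a) (hsum : ∀ b, ∑ a, r b a ≤ 1)
    (hpos : ∀ ω, 0 < r (β ω) (α ω)) :
    partitionEntropy μ α ≤ partitionEntropy μ β - ∫ ω, Real.log (r (β ω) (α ω)) ∂μ := by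
  let m (b : κ) : ℝ := μ.real (β ⁻¹' {b})
  let p (a : ι) : ℝ := ∑ b, m b * r b a
  have hp : ∀ a, 0 ≤ p a := fun a =>
    Finset.sum_nonneg fun b _ => mul_nonneg measureReal_nonneg (hr b a)
  have hpsum : ∑ a, p a ≤ 1 := by
    rw [Finset.sum_comm, ← sum_measureReal_fiber (μ := μ) hβ]
    simp only [← Finset.mul_sum]
    exact Finset.sum_le_sum fun b _ => mul_le_of_le_one_right measureReal_nonneg (hsum b)
  have hle : ∀ ω, m (β ω) * r (β ω) (α ω) ≤ p (α ω) := fun ω =>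
    Finset.single_le_sum (f := fun b => m b * r b (α ω))
      (fun b _ => mul_nonneg measureReal_nonneg (hr b _)) (Finset.mem_univ _)
  have hm : ∀ᵐ ω ∂μ, 0 < m (β ω) := ae_measureReal_fiber_pos
  have hlogm : Integrable (fun ω => Real.log (m (β ω))) μ :=
    integrable_comp_of_finite hβ fun b => Real.log (m b)
  have hlogr : Integrable (fun ω => Real.log (r (β ω) (α ω))) μ :=
    integrable_comp_of_finite (hβ.prodMk hα) fun c => Real.log (r c.1 c.2)
  have hgibbs := partitionEntropy_le_neg_integral_log hα hp hpsum <| by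
    filter_upwards [hm] with ω hω
    exact (mul_pos hω (hpos ω)).trans_le (hle ω)
  have hmono : ∫ ω, (Real.log (m (β ω)) + Real.log (r (β ω) (α ω))) ∂μ ≤
      ∫ ω, Real.log (p (α ω)) ∂μ := by
    refine integral_mono_ae (hlogm.add hlogr)
      (integrable_comp_of_finite hα fun a => Real.log (p a)) ?_
    filter_upwards [hm] with ω hω
    rw [← Real.log_mul hω.ne' (hpos ω).ne']
    exact Real.log_le_log (mul_pos hω (hpos ω)) (hle ω)
  rw [integral_add hlogm hlogr] at hmono
  rw [partitionEntropy_eq_neg_integral_log hβ]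
  linarith

lemma partitionEntropy_comp_le [IsProbabilityMeasure μ] (hβ : Measurable β) (f : κ → ι) :
    partitionEntropy μ (f ∘ β) ≤ partitionEntropy μ β := by
  classical
  have h := partitionEntropy_le_sub_integral_log (μ := μ) ((measurable_of_finite f).comp hβ) hβ
    (r := fun b a => if a = f b then 1 else 0) (fun b a => by split_ifs <;> simp)
    (fun b => by simp) (fun ω => by simp)
  simpa using h

lemma partitionEntropy_itinerary_le [IsProbabilityMeasure μ] (hT : MeasurePreserving T μ μ)
    (hα : Measurable α) (hβ : Measurable β) {r : κ → ι → ℝ} (hr : ∀ b a, 0 ≤ r b a)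
    (hsum : ∀ b, ∑ a, r b a ≤ 1) (hpos : ∀ ω, 0 < r (β ω) (α ω)) (n : ℕ) :
    partitionEntropy μ (itinerary T α n) ≤
      partitionEntropy μ (itinerary T β n) - n * ∫ ω, Real.log (r (β ω) (α ω)) ∂μ := by
  have hprod_sum : ∀ b : Fin n → κ, ∑ a : Fin n → ι, ∏ i, r (b i) (a i) ≤ 1 := fun b => by
    classical
    rw [← Fintype.prod_sum]
    exact Finset.prod_le_one (fun i _ => Finset.sum_nonneg fun a _ => hr _ _) fun i _ => hsum _
  have hlog : ∀ ω, Real.log (∏ i, r (itinerary T β n ω i) (itinerary T α n ω i)) =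
      birkhoffSum T (fun ω => Real.log (r (β ω) (α ω))) n ω := fun ω => by
    simp only [itinerary]
    rw [Real.log_prod fun (i : Fin n) _ => (hpos (T^[i] ω)).ne']
    exact Fin.sum_univ_eq_sum_range (fun i => Real.log (r (β (T^[i] ω)) (α (T^[i] ω)))) n
  have h := partitionEntropy_le_sub_integral_log (μ := μ) (measurable_itinerary hT.measurable hα n)
    (measurable_itinerary hT.measurable hβ n) (r := fun b a => ∏ i, r (b i) (a i))
    (fun _ _ => Finset.prod_nonneg fun _ _ => hr _ _) hprod_sum
    fun ω => Finset.prod_pos fun i _ => hpos (T^[i] ω)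
  simpa only [hlog, integral_birkhoffSum hT
    (integrable_comp_of_finite (hβ.prodMk hα) fun c => Real.log (r c.1 c.2))] using h

lemma sum_ite_one_sub_div_card_le {ι : Type*} [Fintype ι] [DecidableEq ι] {δ : ℝ} (hδ : 0 ≤ δ)
    (b : ι) : ∑ a, (if a = b then 1 - δ else δ / Fintype.card ι) ≤ 1 := by
  have hcard : (Fintype.card ι : ℝ) ≠ 0 := by
    exact_mod_cast (Fintype.card_pos_iff.mpr ⟨b⟩).ne'
  calc ∑ a, (if a = b then 1 - δ else δ / Fintype.card ι)
      ≤ ∑ a, ((if a = b then 1 - δ else 0) + δ / Fintype.card ι) :=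
        Finset.sum_le_sum fun a _ => by
          have := div_nonneg hδ (Fintype.card ι).cast_nonneg
          split_ifs <;> linarith
    _ = 1 := by
        simp only [Finset.sum_add_distrib, Finset.sum_ite_eq', Finset.mem_univ, if_true,
          Finset.sum_const, Finset.card_univ, nsmul_eq_mul]
        field_simp
        ring

/-- The kernel keeps a label with probability `e^{-ε/2}` and otherwise picks one at random. -/
lemma exists_kernel_integral_log_ge [IsProbabilityMeasure μ] {ε : ℝ} (hε : 0 < ε) :
    ∃ r : ι → ι → ℝ, (∀ b a, 0 < r b a) ∧ (∀ b, ∑ a, r b a ≤ 1) ∧ ∃ η > 0,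
      ∀ α β : Ω → ι, Measurable α → Measurable β → μ.real {ω | α ω ≠ β ω} < η →
        -ε ≤ ∫ ω, Real.log (r (β ω) (α ω)) ∂μ := by
  classical
  set δ : ℝ := 1 - Real.exp (-(ε / 2)) with hδ_def
  have hδ : 0 < δ := sub_pos.mpr (Real.exp_lt_one_iff.mpr (by linarith))
  set L : ℝ := |Real.log (δ / Fintype.card ι)|
  refine ⟨fun b a => if a = b then 1 - δ else δ / Fintype.card ι, fun b a => ?_,
    sum_ite_one_sub_div_card_le hδ.le, ε / (2 * (L + 1)), by positivity, fun α β hα hβ hαβ => ?_⟩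
  · dsimp only
    split_ifs
    · simp [hδ_def, Real.exp_pos]
    · exact div_pos hδ (by exact_mod_cast Fintype.card_pos_iff.mpr ⟨a⟩)
  · have hD : MeasurableSet {ω | α ω ≠ β ω} := (measurableSet_eq_fun hα hβ).compl
    have hle : ∀ ω, -(ε / 2) - {ω | α ω ≠ β ω}.indicator (fun _ => L) ω ≤
        Real.log (if α ω = β ω then 1 - δ else δ / Fintype.card ι) := fun ω => by
      by_cases h : α ω = β ω
      · simp [h, hδ_def]
      · rw [if_neg h, Set.indicator_of_mem h]
        linarith [neg_abs_le (Real.log (δ / Fintype.card ι))]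
    have hint := (integrable_const (μ := μ) L).indicator hD
    calc -ε ≤ -(ε / 2) - μ.real {ω | α ω ≠ β ω} * L := by
          have hL : 0 < L + 1 := by positivity
          have h : μ.real {ω | α ω ≠ β ω} * L ≤ ε / (2 * (L + 1)) * (L + 1) :=
            mul_le_mul hαβ.le (le_add_of_nonneg_right zero_le_one) (abs_nonneg _) (by positivity)
          have heq : ε / (2 * (L + 1)) * (L + 1) = ε / 2 := by field_simp
          linarith
      _ = ∫ ω, (-(ε / 2) - {ω | α ω ≠ β ω}.indicator (fun _ => L) ω) ∂μ := by
          rw [integral_sub (integrable_const _) hint, integral_indicator_const _ hD]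
          simp
      _ ≤ _ := integral_mono ((integrable_const _).sub hint) (integrable_comp_of_finite
          (hβ.prodMk hα) fun c => Real.log (if c.2 = c.1 then 1 - δ else δ / Fintype.card ι)) hle

end Partition

lemma exists_forall_le_mul_add {a : ℕ → ℝ} {c : ℝ} {n₀ : ℕ}
    (h : ∀ n ≥ n₀, a (n + 1) ≤ a n + c) : ∃ C, ∀ n : ℕ, a n ≤ n * c + C := by
  obtain ⟨C, hC⟩ := ((Finset.range (n₀ + 1)).image fun n : ℕ => a n - n * c).exists_le
  have hstart : ∀ n ≤ n₀, a n ≤ n * c + C := fun n hn => by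
    linarith [hC _ (Finset.mem_image_of_mem _ (Finset.mem_range.mpr (Nat.lt_succ_of_le hn)))]
  refine ⟨C, fun n => ?_⟩
  induction n with
  | zero => exact hstart 0 n₀.zero_le
  | succ n ih =>
    by_cases hn : n + 1 ≤ n₀
    · exact hstart _ hn
    · have := h n (by omega)
      push_cast
      linarith

lemma limsup_div_le {a : ℕ → ℝ} {c : ℝ} (h : ∀ ε > 0, ∃ C, ∀ n : ℕ, a n ≤ n * (c + ε) + C) :
    limsup (fun n : ℕ => ((a n / n : ℝ) : EReal)) atTop ≤ (c : EReal) := by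
  refine EReal.le_of_forall_lt_iff_le.mp fun z hz => ?_
  have hcz : 0 < (z - c) / 2 := half_pos (sub_pos.mpr (EReal.coe_lt_coe_iff.mp hz))
  obtain ⟨C, hC⟩ := h _ hcz
  refine limsup_le_of_le (by isBoundedDefault) ?_
  filter_upwards [(tendsto_const_div_atTop_nhds_zero_nat C).eventually_lt_const hcz,
    eventually_gt_atTop 0] with n hn hn0
  have hn0' : (0 : ℝ) < n := by exact_mod_cast hn0
  rw [EReal.coe_le_coe_iff, div_le_iff₀ hn0']
  rw [div_lt_iff₀ hn0'] at hn
  linarith [hC n]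

lemma le_limsup_div {a : ℕ → ℝ} {c C : ℝ} (h : ∀ᶠ n : ℕ in atTop, n * c - C ≤ a n) :
    (c : EReal) ≤ limsup (fun n : ℕ => ((a n / n : ℝ) : EReal)) atTop := by
  refine EReal.ge_of_forall_gt_iff_ge.mp fun z hz => ?_
  have hz' : 0 < c - z := sub_pos.mpr (EReal.coe_lt_coe_iff.mp hz)
  refine le_limsup_of_frequently_le (Eventually.frequently ?_) (by isBoundedDefault)
  filter_upwards [h, (tendsto_const_div_atTop_nhds_zero_nat C).eventually_lt_const hz',
    eventually_gt_atTop 0] with n hna hn hn0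
  have hn0' : (0 : ℝ) < n := by exact_mod_cast hn0
  rw [EReal.coe_le_coe_iff, le_div_iff₀ hn0']
  rw [div_lt_iff₀ hn0'] at hn
  linarith

namespace Subshift

variable {k : ℕ} {Z : Subshift k}

/-- Continuous families of transition probabilities: `q i z` is the probability of prepending the
symbol `i` to the point `z`. Along the points of the subshift these probabilities are positive. -/
structure IsTransition (Z : Subshift k) (q : Fin k → Z → ℝ) : Prop where
  cont : ∀ i, Continuous (q i)
  nonneg : ∀ i z, 0 ≤ q i z
  sum_eq_one : ∀ z, ∑ i, q i z = 1
  pos : ∀ x : Z, 0 < q (x.1 0) (Z.shift x)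

/-- The conditional probability, under `ν`, of the first symbol given the rest of the point is
`q`. It is enough to say so for clopen sets. -/
def HasTransitions (ν : Measure Z) (q : Fin k → Z → ℝ) : Prop :=
  ∀ i E, IsClopen E → ν.real (Z.prepend i E) = ∫ z in E, q i z ∂ν

lemma continuous_symbol_shift {F : Fin k → Z → ℝ} (hF : ∀ i, Continuous (F i)) :
    Continuous fun x : Z => F (x.1 0) (Z.shift x) :=
  (continuous_prod_of_discrete_left.mpr hF : Continuous fun p : Fin k × Z => F p.1 p.2).comp
    ((Z.continuous_coord 0).prodMk Z.continuous_shift)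

namespace IsTransition

variable {q : Fin k → Z → ℝ}

lemma le_one (hq : Z.IsTransition q) (i : Fin k) (z : Z) : q i z ≤ 1 :=
  (Finset.single_le_sum (fun j _ => hq.nonneg j z) (Finset.mem_univ i)).trans_eq (hq.sum_eq_one z)

lemma continuous_log (hq : Z.IsTransition q) :
    Continuous fun x : Z => Real.log (q (x.1 0) (Z.shift x)) :=
  (continuous_symbol_shift hq.cont).log fun x => (hq.pos x).ne'

lemma exists_word_majorant (hq : Z.IsTransition q) {ε : ℝ} (hε : 0 < ε) :
    ∃ n₀, ∀ n ≥ n₀, ∃ r : Fin k → (Fin n → Fin k) → ℝ,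
      (∀ i v, 0 ≤ r i v) ∧ (∀ v, ∑ i, r i v ≤ 1) ∧
        ∀ i z, Real.exp (-ε) * q i z ≤ r i (Z.word n z) := by
  classical
  have hδ : 0 < ε / (k + 1) := by positivity
  obtain ⟨n₀, hn₀⟩ := exists_dist_lt_of_word_eq (continuous_pi hq.cont) hδ
  refine ⟨n₀, fun n hn => ?_⟩
  let r (i : Fin k) (v : Fin n → Fin k) : ℝ :=
    if h : ∃ z, Z.word n z = v then Real.exp (-ε) * (q i h.choose + ε / (k + 1)) else 0
  refine ⟨r, fun i v => ?_, fun v => ?_, fun i z => ?_⟩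
  · dsimp only [r]
    split_ifs with h
    · exact mul_nonneg (Real.exp_pos _).le (add_nonneg (hq.nonneg i _) hδ.le)
    · exact le_rfl
  · dsimp only [r]
    split_ifs with h
    · rw [← Finset.mul_sum, Finset.sum_add_distrib, hq.sum_eq_one, Real.exp_neg,
        inv_mul_le_one₀ (Real.exp_pos ε)]
      have hkε : k * (ε / (k + 1)) ≤ ε := by
        rw [mul_div_assoc', div_le_iff₀ (by positivity)]
        linarith
      simp only [Finset.sum_const, Finset.card_univ, Fintype.card_fin, nsmul_eq_mul]
      linarith [Real.add_one_le_exp ε]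
    · simp
  · have h : ∃ z', Z.word n z' = Z.word n z := ⟨z, rfl⟩
    have hdist := (dist_le_pi_dist (fun i => q i z) (fun i => q i h.choose) i).trans_lt
      (hn₀ n hn z h.choose h.choose_spec.symm)
    rw [Real.dist_eq, abs_lt] at hdist
    simp only [r, dif_pos h]
    exact mul_le_mul_of_nonneg_left (by linarith) (Real.exp_pos _).le

end IsTransition

lemma partitionEntropy_word_succ_le {ν : Measure Z} (hν : Z.IsInvariant ν) {n : ℕ}
    {r : Fin k → (Fin n → Fin k) → ℝ} (hr : ∀ i v, 0 ≤ r i v) (hsum : ∀ v, ∑ i, r i v ≤ 1)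
    (hpos : ∀ x : Z, 0 < r (x.1 0) (Z.word n (Z.shift x))) :
    partitionEntropy ν (Z.word (n + 1)) ≤ partitionEntropy ν (Z.word n) -
      ∫ x : Z, Real.log (r (x.1 0) (Z.word n (Z.shift x))) ∂ν := by
  classical
  have := hν.1
  let p (v : Fin n → Fin k) (w : Fin (n + 1) → Fin k) : ℝ := if Fin.tail w = v then r (w 0) v else 0
  have hp_word : ∀ x : Z, p ((Z.word n ∘ Z.shift) x) (Z.word (n + 1) x) =
      r (x.1 0) (Z.word n (Z.shift x)) := fun x => by simp [p, word_succ]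
  have hp_sum : ∀ v, ∑ w, p v w ≤ 1 := fun v => by
    rw [← (Fin.consEquiv fun _ => Fin k).sum_comp, Fintype.sum_prod_type]
    simpa [p, Fin.consEquiv, Fin.tail_cons] using hsum v
  have h := partitionEntropy_le_sub_integral_log (μ := ν) (Z.measurable_word (n + 1))
    ((Z.measurable_word n).comp Z.measurable_shift) (r := p)
    (fun v w => by dsimp only [p]; split_ifs; exacts [hr _ _, le_rfl]) hp_sum
    fun x => by rw [hp_word]; exact hpos x
  simpa only [hp_word, partitionEntropy_comp_of_measurePreserving hν.2 (Z.measurable_word n)]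
    using h

lemma IsTransition.partitionEntropy_word_le {ν : Measure Z} (hν : Z.IsInvariant ν)
    {q : Fin k → Z → ℝ} (hq : Z.IsTransition q) {ε : ℝ} (hε : 0 < ε) :
    ∃ C, ∀ n : ℕ, partitionEntropy ν (Z.word n) ≤
      n * (-∫ x, Real.log (q (x.1 0) (Z.shift x)) ∂ν + ε) + C := by
  have := hν.1
  obtain ⟨n₀, hn₀⟩ := hq.exists_word_majorant hε
  refine exists_forall_le_mul_add (n₀ := n₀) fun n hn => ?_
  obtain ⟨r, hr, hsum, hqr⟩ := hn₀ n hn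
  have hexp_pos : ∀ x : Z, 0 < Real.exp (-ε) * q (x.1 0) (Z.shift x) := fun x =>
    mul_pos (Real.exp_pos _) (hq.pos x)
  have hint := integrable_of_continuous (ν := ν) hq.continuous_log
  have hmono : ∫ x : Z, (-ε + Real.log (q (x.1 0) (Z.shift x))) ∂ν ≤
      ∫ x : Z, Real.log (r (x.1 0) (Z.word n (Z.shift x))) ∂ν := by
    refine integral_mono ((integrable_const _).add hint) (integrable_comp_of_finite
      ((Z.measurable_word 1).prodMk ((Z.measurable_word n).comp Z.measurable_shift))
      fun c : (Fin 1 → Fin k) × (Fin n → Fin k) => Real.log (r (c.1 0) c.2)) fun x => ?_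
    have hlog := Real.log_le_log (hexp_pos x) (hqr _ _)
    rwa [Real.log_mul (Real.exp_pos _).ne' (hq.pos x).ne', Real.log_exp] at hlog
  rw [integral_add (integrable_const _) hint] at hmono
  simp only [integral_const, probReal_univ, smul_eq_mul, one_mul] at hmono
  linarith [partitionEntropy_word_succ_le hν hr hsum fun x => (hexp_pos x).trans_le (hqr _ _)]

lemma isSetAlgebra_word_preimage :
    IsSetAlgebra {s : Set Z | ∃ n, ∃ S : Set (Fin n → Fin k), s = Z.word n ⁻¹' S} where
  empty_mem := ⟨0, ∅, rfl⟩
  compl_mem := by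
    rintro _ ⟨n, S, rfl⟩
    exact ⟨n, Sᶜ, rfl⟩
  union_mem := by
    rintro _ _ ⟨n, S, rfl⟩ ⟨m, T, rfl⟩
    exact ⟨max n m, {v | (fun i : Fin n => v (i.castLE (le_max_left n m))) ∈ S ∨
      (fun i : Fin m => v (i.castLE (le_max_right n m))) ∈ T}, rfl⟩

lemma exists_measureReal_symmDiff_word_lt {ν : Measure Z} [IsFiniteMeasure ν] {s : Set Z}
    (hs : MeasurableSet s) {ε : ℝ} (hε : 0 < ε) :
    ∃ n, ∀ m ≥ n, ∃ S : Set (Fin m → Fin k), ν.real (symmDiff s (Z.word m ⁻¹' S)) < ε := by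
  have hgen : (inferInstance : MeasurableSpace Z) = MeasurableSpace.generateFrom
      {s : Set Z | ∃ n, ∃ S : Set (Fin n → Fin k), s = Z.word n ⁻¹' S} := by
    apply le_antisymm
    · rw [Z.measurableSpace_eq_generateFrom]
      refine MeasurableSpace.generateFrom_mono ?_
      rintro _ ⟨z, n, rfl⟩
      exact ⟨n, _, Z.cylinder_eq_preimage z n⟩
    · refine MeasurableSpace.generateFrom_le ?_
      rintro _ ⟨n, S, rfl⟩
      exact Z.measurable_word n S.toFinite.measurableSet
  obtain ⟨_, ⟨n, S, rfl⟩, hS⟩ := (Measure.MeasureDense.of_generateFrom_isSetAlgebra_finite (μ := ν)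
    isSetAlgebra_word_preimage hgen).approx s hs (measure_ne_top ν s) ε hε
  exact ⟨n, fun m hm => ⟨{v | (fun i : Fin n => v (i.castLE hm)) ∈ S},
    ENNReal.toReal_lt_of_lt_ofReal hS⟩⟩

lemma exists_measureReal_ne_word_lt {ν : Measure Z} [IsProbabilityMeasure ν] {ι : Type*}
    [Finite ι] [MeasurableSpace ι] [MeasurableSingletonClass ι] {α : Z → ι} (hα : Measurable α)
    {ε : ℝ} (hε : 0 < ε) :
    ∃ n, ∃ f : (Fin n → Fin k) → ι, ν.real {x | α x ≠ f (Z.word n x)} < ε := by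
  classical
  have := Fintype.ofFinite ι
  obtain ⟨z₀⟩ := ν.nonempty_of_neZero
  have hcard : (0 : ℝ) < Fintype.card ι := by exact_mod_cast Fintype.card_pos_iff.mpr ⟨α z₀⟩
  choose N hN using fun i => exists_measureReal_symmDiff_word_lt (ν := ν)
    (hα (measurableSet_singleton i)) (div_pos hε hcard)
  let n := Finset.univ.sup N
  choose S hS using fun i => hN i n (Finset.le_sup (Finset.mem_univ i))
  let f (v : Fin n → Fin k) : ι := if h : ∃ i, v ∈ S i then h.choose else α z₀
  refine ⟨n, f, ?_⟩
  have hsub : {x | α x ≠ f (Z.word n x)} ⊆ ⋃ i, symmDiff (α ⁻¹' {i}) (Z.word n ⁻¹' S i) := by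
    intro x hx
    by_contra hcon
    have hiff : ∀ i, α x = i ↔ Z.word n x ∈ S i := by
      simpa only [Set.mem_iUnion, not_exists, Set.mem_symmDiff, not_or, not_and, not_not, iff_def,
        Set.mem_preimage, Set.mem_singleton_iff] using hcon
    have h : ∃ i, Z.word n x ∈ S i := ⟨α x, (hiff _).mp rfl⟩
    refine hx ?_
    simp only [f, dif_pos h]
    exact (hiff _).mpr h.choose_spec
  calc ν.real {x | α x ≠ f (Z.word n x)}
      ≤ ∑ i, ν.real (symmDiff (α ⁻¹' {i}) (Z.word n ⁻¹' S i)) :=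
        (measureReal_mono hsub).trans (measureReal_iUnion_fintype_le _)
    _ < ∑ _ : ι, ε / Fintype.card ι :=
        Finset.sum_lt_sum_of_nonempty ⟨α z₀, Finset.mem_univ _⟩ fun i _ => hS i
    _ = ε := by
        rw [Finset.sum_const, Finset.card_univ, nsmul_eq_mul, mul_div_cancel₀ _ hcard.ne']

lemma partitionEntropy_itinerary_word_le {ν : Measure Z} [IsProbabilityMeasure ν] {ι : Type}
    [Fintype ι] [MeasurableSpace ι] [MeasurableSingletonClass ι] {n : ℕ}
    (f : (Fin n → Fin k) → ι) (N : ℕ) :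
    partitionEntropy ν (itinerary Z.shift (f ∘ Z.word n) N) ≤
      partitionEntropy ν (Z.word (N + n)) := by
  have hfactor : itinerary Z.shift (f ∘ Z.word n) N =
      (fun v (i : Fin N) => f fun j : Fin n => v ⟨i + j, by omega⟩) ∘ Z.word (N + n) := by
    ext x i
    simp only [itinerary, Function.comp_apply]
    congr 1
    ext j
    simp [word]
  rw [hfactor]
  exact partitionEntropy_comp_le (Z.measurable_word (N + n)) _

lemma partitionEntropy_itinerary_le_word {ν : Measure Z} (hν : Z.IsInvariant ν) {ι : Type}
    [Fintype ι] [MeasurableSpace ι] [MeasurableSingletonClass ι] {α : Z → ι} (hα : Measurable α)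
    {ε : ℝ} (hε : 0 < ε) :
    ∃ n : ℕ, ∀ N : ℕ, partitionEntropy ν (itinerary Z.shift α N) ≤
      partitionEntropy ν (Z.word (N + n)) + N * ε := by
  have := hν.1
  obtain ⟨r, hr, hsum, η, hη, hαβ⟩ := exists_kernel_integral_log_ge (μ := ν) (ι := ι) hε
  obtain ⟨n, f, hf⟩ := exists_measureReal_ne_word_lt (ν := ν) hα hη
  have hfm : Measurable (f ∘ Z.word n) := (measurable_of_finite f).comp (Z.measurable_word n)
  refine ⟨n, fun N => ?_⟩
  have hchain := partitionEntropy_itinerary_le hν.2 hα hfm (fun b a => (hr b a).le) hsum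
    (fun _ => hr _ _) N
  have hword := partitionEntropy_itinerary_word_le (ν := ν) f N
  have hint := mul_le_mul_of_nonneg_left (hαβ α _ hα hfm hf) (Nat.cast_nonneg (α := ℝ) N)
  linarith

namespace IsTransition

variable {q : Fin k → Z → ℝ}

/-- Both sides agree for the transition probabilities of `ν` itself. -/
lemma measureEntropy_le {ν : Measure Z} (hν : Z.IsInvariant ν) (hq : Z.IsTransition q) :
    measureEntropy ν Z.shift ≤ ((-∫ x, Real.log (q (x.1 0) (Z.shift x)) ∂ν : ℝ) : EReal) := by
  refine iSup_le fun l => iSup_le fun α => iSup_le fun hα => limsup_div_le fun ε hε => ?_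
  obtain ⟨n, hn⟩ := partitionEntropy_itinerary_le_word hν hα (half_pos hε)
  obtain ⟨C, hC⟩ := hq.partitionEntropy_word_le hν (half_pos hε)
  refine ⟨n * (-∫ x, Real.log (q (x.1 0) (Z.shift x)) ∂ν + ε / 2) + C, fun N => (hn N).trans ?_⟩
  have hNn := hC (N + n)
  push_cast at hNn
  linarith

lemma perturb (hq : Z.IsTransition q) {φ : Fin k → Z → ℝ} (hφ : ∀ i, Continuous (φ i))
    (hsum : ∀ z, ∑ i, q i z * φ i z = 0) (hpos : ∀ i z, 0 < 1 + φ i z) :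
    Z.IsTransition fun i z => q i z * (1 + φ i z) where
  cont i := (hq.cont i).mul (continuous_const.add (hφ i))
  nonneg i z := mul_nonneg (hq.nonneg i z) (hpos i z).le
  sum_eq_one z := by simp only [mul_add, mul_one, Finset.sum_add_distrib, hq.sum_eq_one, hsum,
    add_zero]
  pos x := mul_pos (hq.pos x) (hpos _ _)

end IsTransition

lemma sub_two_mul_sq_le_log {t : ℝ} (ht : |t| ≤ 1 / 2) : t - 2 * t ^ 2 ≤ Real.log (1 + t) := by
  have hpos : 0 < 1 + t := by linarith [(abs_le.mp ht).1]
  refine le_trans ?_ (Real.one_sub_inv_le_log_of_pos hpos)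
  rw [show 1 - (1 + t)⁻¹ = t / (1 + t) by field_simp; ring, le_div_iff₀ hpos]
  nlinarith [sq_nonneg t, (abs_le.mp ht).1]

/-- A continuous family of transition probabilities that maximizes the integral of `log q` against
`ν` among all of them. -/
structure IsMaximalTransition (ν : Measure Z) (q : Fin k → Z → ℝ) : Prop
    extends Z.IsTransition q where
  integral_log_le : ∀ q', Z.IsTransition q' → ∫ x, Real.log (q' (x.1 0) (Z.shift x)) ∂ν ≤
    ∫ x, Real.log (q (x.1 0) (Z.shift x)) ∂ν

namespace IsMaximalTransition

variable {ν : Measure Z} {q : Fin k → Z → ℝ} {φ : Fin k → Z → ℝ}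

lemma mul_integral_le [IsProbabilityMeasure ν] (hq : IsMaximalTransition ν q)
    (hφ : ∀ i, Continuous (φ i)) (hsum : ∀ z, ∑ i, q i z * φ i z = 0)
    (hφ_le : ∀ i z, |φ i z| ≤ 1) {s : ℝ} (hs : |s| ≤ 1 / 2) :
    s * ∫ x, φ (x.1 0) (Z.shift x) ∂ν ≤ 2 * s ^ 2 := by
  have hsφ : ∀ i z, |s * φ i z| ≤ 1 / 2 := fun i z => by
    rw [abs_mul]
    exact (mul_le_of_le_one_right (abs_nonneg s) (hφ_le i z)).trans hs
  have hpos : ∀ i z, 0 < 1 + s * φ i z := fun i z => by linarith [(abs_le.mp (hsφ i z)).1]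
  have hq' := hq.toIsTransition.perturb (φ := fun i z => s * φ i z)
    (fun i => continuous_const.mul (hφ i))
    (fun z => by simp only [mul_left_comm _ s, ← Finset.mul_sum, hsum, mul_zero]) hpos
  have hlog := integrable_of_continuous (ν := ν) hq.continuous_log
  have hφ_int := (integrable_of_continuous (ν := ν) (continuous_symbol_shift hφ)).const_mul s
  have hsub : Integrable (fun x => s * φ (x.1 0) (Z.shift x) - 2 * s ^ 2) ν :=
    hφ_int.sub (integrable_const _)
  have hmono : ∫ x, (Real.log (q (x.1 0) (Z.shift x)) +
      (s * φ (x.1 0) (Z.shift x) - 2 * s ^ 2)) ∂ν ≤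
      ∫ x, Real.log (q (x.1 0) (Z.shift x) * (1 + s * φ (x.1 0) (Z.shift x))) ∂ν := by
    refine integral_mono (hlog.add hsub) (integrable_of_continuous hq'.continuous_log) fun x => ?_
    have hsq : (s * φ (x.1 0) (Z.shift x)) ^ 2 ≤ s ^ 2 := by
      rw [mul_pow]
      exact mul_le_of_le_one_right (sq_nonneg s) ((sq_le_one_iff_abs_le_one _).mpr (hφ_le _ _))
    dsimp only
    rw [Real.log_mul (hq.pos x).ne' (hpos _ _).ne']
    linarith [sub_two_mul_sq_le_log (hsφ (x.1 0) (Z.shift x))]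
  rw [integral_add hlog hsub, integral_sub hφ_int (integrable_const _), integral_const_mul]
    at hmono
  simp only [integral_const, probReal_univ, smul_eq_mul, one_mul] at hmono
  linarith [hq.integral_log_le _ hq']

lemma integral_eq_zero [IsProbabilityMeasure ν] (hq : IsMaximalTransition ν q)
    (hφ : ∀ i, Continuous (φ i)) (hsum : ∀ z, ∑ i, q i z * φ i z = 0)
    (hφ_le : ∀ i z, |φ i z| ≤ 1) : ∫ x, φ (x.1 0) (Z.shift x) ∂ν = 0 := by
  set J := ∫ x, φ (x.1 0) (Z.shift x) ∂ν
  have hJ : |J| ≤ 1 := by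
    simpa using norm_integral_le_of_norm_le_const (μ := ν)
      (f := fun x => φ (x.1 0) (Z.shift x)) (C := 1) (Eventually.of_forall fun _ => hφ_le _ _)
  have hquad := hq.mul_integral_le hφ hsum hφ_le (s := J / 4) <| by
    rw [abs_div, abs_of_pos (by norm_num : (0 : ℝ) < 4)]
    linarith
  nlinarith [sq_nonneg J]

/-- The first variation in the direction of the deviation of `q` from the indicator of the symbol
`i`, localized to `C`. -/
lemma hasTransitions (hν : Z.IsInvariant ν) (hq : IsMaximalTransition ν q) :
    HasTransitions ν q := by
  classical
  intro i C hC
  have := hν.1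
  let φ (j : Fin k) : Z → ℝ := C.indicator fun z => (if j = i then 1 else 0) - q i z
  have hφ : ∀ j, Continuous (φ j) := fun j =>
    (continuous_const.sub (hq.cont i)).indicator (by simp [hC.frontier_eq])
  have hφ_le : ∀ j z, |φ j z| ≤ 1 := fun j z => by
    have hq_mem : q i z ∈ Set.Icc (0 : ℝ) 1 := ⟨hq.nonneg i z, hq.le_one i z⟩
    dsimp only [φ, Set.indicator]
    split_ifs <;> rw [abs_le] <;> constructor <;> linarith [hq_mem.1, hq_mem.2]
  have hsum : ∀ z, ∑ j, q j z * φ j z = 0 := fun z => by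
    by_cases hz : z ∈ C
    · simp [φ, Set.indicator_of_mem hz, mul_sub, Finset.sum_sub_distrib, ← Finset.sum_mul,
        hq.sum_eq_one]
    · simp [φ, Set.indicator_of_notMem hz]
  have hC_meas := hC.isOpen.measurableSet
  have hpre_meas := (Z.isClopen_prepend i hC).isOpen.measurableSet
  have hdecomp : ∀ x : Z, φ (x.1 0) (Z.shift x) =
      (Z.prepend i C).indicator (fun _ => (1 : ℝ)) x - C.indicator (q i) (Z.shift x) := fun x => by
    by_cases hx : Z.shift x ∈ C <;> simp [φ, Set.indicator, prepend, hx]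
  have hCq : Integrable (C.indicator (q i)) ν :=
    (integrable_of_continuous (hq.cont i)).indicator hC_meas
  have hCq_shift : Integrable (fun x => C.indicator (q i) (Z.shift x)) ν :=
    hν.2.integrable_comp_of_integrable hCq
  have hzero := hq.integral_eq_zero hφ hsum hφ_le
  simp only [hdecomp] at hzero
  rw [integral_sub ((integrable_const _).indicator hpre_meas) hCq_shift,
    integral_indicator_const _ hpre_meas,
    integral_comp_of_measurePreserving hν.2 hCq.aestronglyMeasurable, integral_indicator hC_meas,
    smul_eq_mul, mul_one] at hzero
  exact sub_eq_zero.mp hzero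

end IsMaximalTransition

end Subshift

section Perron

open Matrix

variable {ι : Type*} {A : Matrix ι ι ℝ} {v : ι → ℝ}

lemma exists_apply_pos (hv : 0 ≤ v) (hne : v ≠ 0) : ∃ j, 0 < v j :=
  (Pi.lt_def.mp (hv.lt_of_ne' hne)).2

variable [Fintype ι]

lemma pow_mulVec_of_mulVec_eq [DecidableEq ι] {l : ℝ} (hv : A *ᵥ v = l • v) (n : ℕ) :
    (A ^ n) *ᵥ v = l ^ n • v := by
  induction n with
  | zero => simp
  | succ n ih => rw [pow_succ, ← mulVec_mulVec, hv, mulVec_smul, ih, smul_smul, pow_succ']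

lemma mulVec_apply_pos {i j : ι} (hA : ∀ j, 0 ≤ A i j) (hv : 0 ≤ v) (hij : 0 < A i j)
    (hj : 0 < v j) : 0 < (A *ᵥ v) i :=
  Finset.sum_pos' (fun k _ => mul_nonneg (hA k) (hv k)) ⟨j, Finset.mem_univ j, mul_pos hij hj⟩

lemma pos_of_mulVec_eq_smul (hA : A.IsIrreducible) (hv : 0 ≤ v) (hne : v ≠ 0)
    {l : ℝ} (heq : A *ᵥ v = l • v) : 0 < l ∧ ∀ i, 0 < v i := by
  classical
  obtain ⟨j, hj⟩ := exists_apply_pos hv hne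
  have hpow : ∀ i, ∃ n > 0, 0 < l ^ n * v i := fun i => by
    obtain ⟨n, hn, hpos⟩ := (isIrreducible_iff_exists_pow_pos hA.nonneg).mp hA i j
    refine ⟨n, hn, ?_⟩
    simpa [pow_mulVec_of_mulVec_eq heq n] using
      mulVec_apply_pos (pow_apply_nonneg hA.nonneg n i) hv hpos hj
  have hv_pos : ∀ i, 0 < v i := fun i => by
    obtain ⟨n, -, h⟩ := hpow i
    exact (hv i).lt_of_ne' (right_ne_zero_of_mul h.ne')
  obtain ⟨n, hn, hln⟩ := hpow j
  have hl_nonneg : 0 ≤ l * v j := by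
    exact (dotProduct_nonneg_of_nonneg (hA.nonneg j) hv).trans_eq (congrFun heq j)
  refine ⟨(nonneg_of_mul_nonneg_left hl_nonneg hj).lt_of_ne' ?_, hv_pos⟩
  rintro rfl
  simp [hn.ne'] at hln

lemma exists_commute_forall_pos (hA : A.IsIrreducible) :
    ∃ Q : Matrix ι ι ℝ, Commute A Q ∧ ∀ i j, 0 < Q i j := by
  classical
  choose N _ hN using (isIrreducible_iff_exists_pow_pos hA.nonneg).mp hA
  obtain ⟨M, hM⟩ := Finite.exists_le fun p : ι × ι => N p.1 p.2
  refine ⟨∑ n ∈ Finset.range (M + 1), A ^ n,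
    Commute.sum_right _ _ _ fun n _ => (Commute.refl A).pow_right n, fun i j => ?_⟩
  rw [Matrix.sum_apply]
  exact Finset.sum_pos' (fun n _ => pow_apply_nonneg hA.nonneg n i j)
    ⟨N i j, Finset.mem_range_succ_iff.mpr (hM (i, j)), hN i j⟩

lemma le_sum_of_smul_le_mulVec (hA : ∀ i j, 0 ≤ A i j) (hv : v ∈ stdSimplex ℝ ι) {l : ℝ}
    (h : l • v ≤ A *ᵥ v) : l ≤ ∑ i, ∑ j, A i j :=
  calc l = ∑ i, (l • v) i := by simp [← Finset.mul_sum, hv.2]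
    _ ≤ ∑ i, ∑ j, A i j * v j := Finset.sum_le_sum fun i _ => h i
    _ ≤ ∑ i, ∑ j, A i j := by
      gcongr with i _ j
      exact mul_le_of_le_one_right (hA i j)
        (hv.2 ▸ Finset.single_le_sum (fun k _ => hv.1 k) (Finset.mem_univ j))

lemma exists_isMax_smul_le_mulVec [Nonempty ι] (hA : ∀ i j, 0 ≤ A i j) :
    ∃ l : ℝ, ∃ v ∈ stdSimplex ℝ ι, l • v ≤ A *ᵥ v ∧
      ∀ l' : ℝ, ∀ w ∈ stdSimplex ℝ ι, l' • w ≤ A *ᵥ w → l' ≤ l := by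
  classical
  let K := ∑ i, ∑ j, A i j
  let S : Set (ℝ × (ι → ℝ)) := (Set.Icc 0 K ×ˢ stdSimplex ℝ ι) ∩ {p | p.1 • p.2 ≤ A *ᵥ p.2}
  have hS : IsCompact S :=
    (isCompact_Icc.prod (isCompact_stdSimplex ℝ ι)).inter_right <| isClosed_le
      (continuous_fst.smul continuous_snd) (continuous_const.matrix_mulVec continuous_snd)
  have hS_nonempty : S.Nonempty := by
    obtain ⟨i⟩ := ‹Nonempty ι›
    refine ⟨(0, Pi.single i 1), ⟨⟨le_rfl, ?_⟩, single_mem_stdSimplex ℝ i⟩, fun j => ?_⟩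
    · exact Finset.sum_nonneg fun i _ => Finset.sum_nonneg fun j _ => hA i j
    · simpa using hA j i
  obtain ⟨⟨l, v⟩, ⟨⟨hl, hv⟩, hlv⟩, hmax⟩ := hS.exists_isMaxOn hS_nonempty continuousOn_fst
  refine ⟨l, v, hv, hlv, fun l' w hw hlw => ?_⟩
  rcases le_total 0 l' with h0 | h0
  · exact hmax (a := (l', w)) ⟨⟨⟨h0, le_sum_of_smul_le_mulVec hA hw hlw⟩, hw⟩, hlw⟩
  · exact h0.trans hl.1

/-- Collatz–Wielandt: a vector attaining the largest `l` with `l • v ≤ A *ᵥ v` is an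
eigenvector. -/
lemma exists_pos_mulVec_eq_smul [Nonempty ι] (hA : A.IsIrreducible) :
    ∃ l > (0 : ℝ), ∃ v : ι → ℝ, (∀ i, 0 < v i) ∧ A *ᵥ v = l • v := by
  obtain ⟨l, v, hv, hlv, hmax⟩ := exists_isMax_smul_le_mulVec hA.nonneg
  have hv_ne : v ≠ 0 := by
    rintro rfl
    simpa using hv.2
  have heq : A *ᵥ v = l • v := by
    by_contra hne
    obtain ⟨Q, hcomm, hQ⟩ := exists_commute_forall_pos hA
    have hQ_pos : ∀ u : ι → ℝ, 0 ≤ u → u ≠ 0 → ∀ i, 0 < (Q *ᵥ u) i := fun u hu hne i => by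
      obtain ⟨j, hj⟩ := exists_apply_pos hu hne
      exact mulVec_apply_pos (fun k => (hQ i k).le) hu (hQ i j) hj
    set w := Q *ᵥ v
    have hw : ∀ i, 0 < w i := hQ_pos v hv.1 hv_ne
    have hgap : ∀ i, l * w i < (A *ᵥ w) i := fun i => by
      have h := hQ_pos (A *ᵥ v - l • v) (sub_nonneg.mpr hlv) (sub_ne_zero.mpr hne) i
      rw [mulVec_sub, mulVec_smul, mulVec_mulVec, ← hcomm.eq, ← mulVec_mulVec] at h
      exact sub_pos.mp h
    obtain ⟨i₀, hi₀⟩ := Finite.exists_min fun i => (A *ᵥ w) i / w i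
    have hw_sum : 0 < ∑ i, w i := Finset.sum_pos (fun i _ => hw i) Finset.univ_nonempty
    have hle := hmax ((A *ᵥ w) i₀ / w i₀) ((∑ i, w i)⁻¹ • w)
      ⟨fun i => (mul_pos (inv_pos.mpr hw_sum) (hw i)).le, by
        simp [← Finset.mul_sum, hw_sum.ne']⟩ (by
        rw [smul_comm, mulVec_smul]
        exact smul_le_smul_of_nonneg_left (fun i => (le_div_iff₀ (hw i)).mp (hi₀ i))
          (inv_pos.mpr hw_sum).le)
    exact ((lt_div_iff₀ (hw i₀)).mpr (hgap i₀)).not_ge hle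
  obtain ⟨hl, hv_pos⟩ := pos_of_mulVec_eq_smul hA hv.1 hv_ne heq
  exact ⟨l, hl, v, hv_pos, heq⟩

/-- Perron–Frobenius data of a nonnegative matrix: a positive eigenvalue with positive left and
right eigenvectors, normalized so that `left ⬝ᵥ right = 1`. -/
structure PerronData (A : Matrix ι ι ℝ) where
  eigenvalue : ℝ
  left : ι → ℝ
  right : ι → ℝ
  eigenvalue_pos : 0 < eigenvalue
  left_pos : ∀ i, 0 < left i
  right_pos : ∀ i, 0 < right i
  vecMul_left : left ᵥ* A = eigenvalue • left
  mulVec_right : A *ᵥ right = eigenvalue • right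
  dotProduct_eq_one : left ⬝ᵥ right = 1

lemma nonempty_perronData [Nonempty ι] (hA : A.IsIrreducible) : Nonempty (PerronData A) := by
  obtain ⟨l, hl, v, hv, hAv⟩ := exists_pos_mulVec_eq_smul hA
  obtain ⟨l', -, u, hu, hAu⟩ := exists_pos_mulVec_eq_smul hA.transpose
  rw [mulVec_transpose] at hAu
  have huv : 0 < u ⬝ᵥ v :=
    Finset.sum_pos (fun i _ => mul_pos (hu i) (hv i)) Finset.univ_nonempty
  have hll : l' * (u ⬝ᵥ v) = l * (u ⬝ᵥ v) := by
    rw [← smul_eq_mul, ← smul_dotProduct, ← hAu, ← dotProduct_mulVec, hAv, dotProduct_smul,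
      smul_eq_mul]
  obtain rfl := mul_right_cancel₀ huv.ne' hll
  exact ⟨{
    eigenvalue := l'
    left := (u ⬝ᵥ v)⁻¹ • u
    right := v
    eigenvalue_pos := hl
    left_pos := fun i => mul_pos (inv_pos.mpr huv) (hu i)
    right_pos := hv
    vecMul_left := by rw [smul_vecMul, hAu, smul_comm]
    mulVec_right := hAv
    dotProduct_eq_one := by rw [smul_dotProduct, smul_eq_mul, inv_mul_cancel₀ huv.ne'] }⟩

end Perron

namespace Subshift

variable {k : ℕ}

lemma measureReal_shift_preimage {Z : Subshift k} (ν : Measure Z) [IsFiniteMeasure ν] {E : Set Z}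
    (hE : MeasurableSet E) : ν.real (Z.shift ⁻¹' E) = ∑ i, ν.real (Z.prepend i E) := by
  have h : Z.shift ⁻¹' E = ⋃ i, Z.prepend i E := by
    ext x
    simp [prepend]
  rw [h, measureReal_iUnion_fintype]
  · exact fun i j hij => Set.disjoint_left.mpr fun x hx hx' => hij (hx.1.symm.trans hx'.1)
  · exact fun i => (Z.isClopen_symbol 0 i).isOpen.measurableSet.inter (Z.measurable_shift hE)

lemma itinerary_shift_coord_zero {Z : Subshift k} (n : ℕ) :
    itinerary Z.shift (fun x : Z => x.1 0) n = Z.word n := by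
  ext x i
  simp [itinerary, word]

/-- The symbols that occur in the points of a subshift. -/
abbrev Symbols (Z : Subshift k) : Type := {i : Fin k // ∃ z : Z, z.1 0 = i}

noncomputable instance (Z : Subshift k) : Fintype Z.Symbols := Fintype.ofFinite _

/-- A coordinate of a point, as an occurring symbol. -/
def coord {Z : Subshift k} (z : Z) (n : ℕ) : Z.Symbols := ⟨z.1 n, Z.shift^[n] z, by simp⟩

@[simp] lemma val_coord {Z : Subshift k} (z : Z) (n : ℕ) : (coord z n).1 = z.1 n := rfl

lemma sum_symbols {Z : Subshift k} {F : Fin k → ℝ} (hF : ∀ i, F i ≠ 0 → ∃ z : Z, z.1 0 = i) :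
    ∑ i : Z.Symbols, F i = ∑ i, F i := by
  classical
  rw [← Finset.sum_filter_of_ne fun i _ => hF i]
  exact (Finset.sum_subtype _ (by simp) F).symm

lemma singleton_mem_language {Z : Subshift k} (i : Z.Symbols) : [i.1] ∈ Z.language := by
  obtain ⟨i, x, rfl⟩ := i
  exact ⟨x, 0, by simp⟩

variable {A : Matrix (Fin k) (Fin k) ℕ}

/-- The point of a subshift of finite type obtained by prepending an admissible symbol. -/
def consPoint (x : ofMatrix A) (i : Fin k) (h : A i (x.1 0) = 1) : ofMatrix A :=
  ⟨fun n => Nat.casesOn n i x.1, fun n => by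
    cases n with
    | zero => exact h
    | succ n => exact x.2 n⟩

@[simp] lemma shift_consPoint (x : ofMatrix A) (i : Fin k) (h : A i (x.1 0) = 1) :
    (ofMatrix A).shift (consPoint x i h) = x := rfl

lemma transition_eq_one (x : ofMatrix A) (n : ℕ) : A (x.1 n) (x.1 (n + 1)) = 1 := x.2 n

lemma prepend_cylinder_of_transition (x : ofMatrix A) (n : ℕ) (i : Fin k) (h : A i (x.1 0) = 1) :
    (ofMatrix A).prepend i ((ofMatrix A).cylinder x n) =
      (ofMatrix A).cylinder (consPoint x i h) (n + 1) := by
  rw [cylinder_succ]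
  rfl

lemma prepend_eq_empty_of_not_transition {i j : Fin k} (h : A i j ≠ 1) {E : Set (ofMatrix A)}
    (hE : ∀ x ∈ E, x.1 0 = j) : (ofMatrix A).prepend i E = ∅ :=
  Set.eq_empty_of_forall_notMem fun x hx => h <| by
    rw [← hx.1, ← hE _ hx.2]
    exact transition_eq_one x 0

variable (A) in
/-- The real transition matrix between the occurring symbols. -/
noncomputable def transitionMatrix : Matrix (ofMatrix A).Symbols (ofMatrix A).Symbols ℝ :=
  fun i j => if A i.1 j.1 = 1 then 1 else 0

lemma transitionMatrix_apply (i j : (ofMatrix A).Symbols) :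
    transitionMatrix A i j = if A i.1 j.1 = 1 then 1 else 0 := rfl

lemma transitionMatrix_nonneg (i j : (ofMatrix A).Symbols) : 0 ≤ transitionMatrix A i j := by
  rw [transitionMatrix_apply]
  split_ifs <;> norm_num

lemma transitionMatrix_pow_pos (x : ofMatrix A) (p n : ℕ) :
    0 < (transitionMatrix A ^ n) (coord x p) (coord x (p + n)) := by
  induction n with
  | zero => simp
  | succ n ih =>
    have hstep : 0 < transitionMatrix A (coord x (p + n)) (coord x (p + n + 1)) :=
      one_pos.trans_eq (if_pos (transition_eq_one x (p + n))).symm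
    rw [pow_succ, Matrix.mul_apply]
    exact Finset.sum_pos' (fun j _ => mul_nonneg
      (Matrix.pow_apply_nonneg transitionMatrix_nonneg n _ _) (transitionMatrix_nonneg _ _))
      ⟨_, Finset.mem_univ _, mul_pos ih hstep⟩

lemma isIrreducible_transitionMatrix (hX : (ofMatrix A).IsIrreducible) :
    (transitionMatrix A).IsIrreducible := by
  refine (Matrix.isIrreducible_iff_exists_pow_pos transitionMatrix_nonneg).mpr fun i j => ?_
  obtain ⟨w, -, x, p, hx⟩ := hX _ (singleton_mem_language i) _ (singleton_mem_language j)
  have hget (q : ℕ) (hq : q < ([i.1] ++ w ++ [j.1]).length) :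
      ([i.1] ++ w ++ [j.1])[q] = x.1 (p + q) :=
    (List.getElem_of_eq hx hq).trans (List.getElem_ofFn _)
  have hi : coord x p = i := Subtype.ext (by simpa using (hget 0 (by simp)).symm)
  have hj : coord x (p + (w.length + 1)) = j :=
    Subtype.ext (by simpa using (hget (w.length + 1) (by simp)).symm)
  refine ⟨w.length + 1, Nat.succ_pos _, ?_⟩
  simpa only [hi, hj] using transitionMatrix_pow_pos x p (w.length + 1)

section Parry

variable (A) in
/-- A choice, for every time and every symbol, of an admissible successor of that symbol. Choosing
at random and independently is a realization of every Markov chain on the symbols. -/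
abbrev Choices : Type :=
  (p : ℕ × (ofMatrix A).Symbols) → {b : (ofMatrix A).Symbols // A p.2.1 b.1 = 1}

/-- The path that starts in `a` and follows the choices `ω`. -/
def choicePath (a : (ofMatrix A).Symbols) (ω : Choices A) : ℕ → (ofMatrix A).Symbols
  | 0 => a
  | n + 1 => (ω (n, choicePath a ω n)).1

/-- The path `choicePath a ω`, as a point of the subshift. -/
def choicePoint (a : (ofMatrix A).Symbols) (ω : Choices A) : ofMatrix A :=
  ⟨fun n => (choicePath a ω n).1, fun n => (ω (n, choicePath a ω n)).2⟩

lemma measurable_choicePath (a : (ofMatrix A).Symbols) (n : ℕ) :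
    Measurable fun ω => choicePath a ω n := by
  induction n with
  | zero => exact measurable_const
  | succ n ih =>
    have hstep : Measurable fun p : (ofMatrix A).Symbols × Choices A => (p.2 (n, p.1)).1 :=
      measurable_from_prod_countable_right fun b => by
        exact measurable_subtype_coe.comp
          (measurable_pi_apply (n, b) : Measurable fun ω : Choices A => ω (n, b))
    exact hstep.comp (ih.prodMk measurable_id)

lemma measurable_choicePoint (a : (ofMatrix A).Symbols) : Measurable (choicePoint a) :=
  Measurable.subtype_mk (measurable_pi_iff.mpr fun n =>
    measurable_subtype_coe.comp (measurable_choicePath a n))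

lemma choicePoint_mem_cylinder_iff (x : ofMatrix A) (n : ℕ) (ω : Choices A) :
    choicePoint (coord x 0) ω ∈ (ofMatrix A).cylinder x (n + 1) ↔
      ∀ i < n, (ω (i, coord x i)).1 = coord x (i + 1) := by
  have hpath : choicePoint (coord x 0) ω ∈ (ofMatrix A).cylinder x (n + 1) ↔
      ∀ i < n + 1, choicePath (coord x 0) ω i = coord x i :=
    forall₂_congr fun i _ => (Subtype.coe_inj (a := choicePath (coord x 0) ω i) (b := coord x i))
  rw [hpath]
  refine ⟨fun h i hi => ?_, fun h i hi => ?_⟩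
  · rw [← h i (by omega), ← h (i + 1) (by omega), choicePath]
  · induction i with
    | zero => rfl
    | succ i ih => rw [choicePath, ih (by omega), h i (by omega)]

variable (D : PerronData (transitionMatrix A))

lemma sum_successors (a : (ofMatrix A).Symbols) :
    ∑ b : {b : (ofMatrix A).Symbols // A a.1 b.1 = 1},
      D.right b.1 / (D.eigenvalue * D.right a) = 1 := by
  have hne := (mul_pos D.eigenvalue_pos (D.right_pos a)).ne'
  have heigen : ∑ b, (if A a.1 b.1 = 1 then D.right b else 0) = D.eigenvalue * D.right a := by
    simpa [Matrix.mulVec, dotProduct, transitionMatrix_apply] using congrFun D.mulVec_right a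
  rw [← Finset.sum_div, div_eq_one_iff_eq hne, ← heigen, ← Finset.sum_filter]
  exact (Finset.sum_subtype _ (by simp) D.right).symm

/-- The transition probabilities of the Markov chain of maximal entropy. -/
noncomputable def successorPMF (a : (ofMatrix A).Symbols) :
    PMF {b : (ofMatrix A).Symbols // A a.1 b.1 = 1} :=
  PMF.ofFintype (fun b => ENNReal.ofReal (D.right b.1 / (D.eigenvalue * D.right a))) <| by
    rw [← ENNReal.ofReal_sum_of_nonneg fun b _ =>
      (div_pos (D.right_pos _) (mul_pos D.eigenvalue_pos (D.right_pos a))).le,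
      sum_successors D, ENNReal.ofReal_one]

/-- The law of independent choices of successors with the probabilities `successorPMF`. -/
noncomputable def choiceMeasure : Measure (Choices A) :=
  Measure.infinitePi fun p => (successorPMF D p.2).toMeasure

instance : IsProbabilityMeasure (choiceMeasure D) := by
  unfold choiceMeasure
  infer_instance

lemma prod_successor_probabilities (x : ofMatrix A) (n : ℕ) :
    ∏ i ∈ Finset.range n, D.right (coord x (i + 1)) / (D.eigenvalue * D.right (coord x i)) =
      D.right (coord x n) / (D.eigenvalue ^ n * D.right (coord x 0)) := by
  have hne i := (D.right_pos (coord x i)).ne'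
  have hl := D.eigenvalue_pos.ne'
  refine Finset.prod_range_induction _ (fun n => D.right (coord x n) /
    (D.eigenvalue ^ n * D.right (coord x 0))) ?_ n fun i _ => ?_
  · simp [hne 0]
  · have h0 := hne 0
    have hi := hne i
    field_simp
    ring

lemma choiceMeasure_real_preimage_cylinder (x : ofMatrix A) (n : ℕ) :
    (choiceMeasure D).real (choicePoint (coord x 0) ⁻¹' (ofMatrix A).cylinder x (n + 1)) =
      D.right (coord x n) / (D.eigenvalue ^ n * D.right (coord x 0)) := by
  classical
  let s : Finset (ℕ × (ofMatrix A).Symbols) := (Finset.range n).image fun i => (i, coord x i)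
  let t (p : ℕ × (ofMatrix A).Symbols) : Set {b : (ofMatrix A).Symbols // A p.2.1 b.1 = 1} :=
    {b | b.1 = coord x (p.1 + 1)}
  have hbox : choicePoint (coord x 0) ⁻¹' (ofMatrix A).cylinder x (n + 1) = Set.pi s t := by
    ext ω
    rw [Set.mem_preimage, choicePoint_mem_cylinder_iff]
    simp [s, t, Set.mem_pi]
  have hfactor (i : ℕ) : ((successorPMF D (coord x i)).toMeasure (t (i, coord x i))).toReal =
      D.right (coord x (i + 1)) / (D.eigenvalue * D.right (coord x i)) := by
    have ht : t (i, coord x i) = {⟨coord x (i + 1), transition_eq_one x i⟩} :=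
      Set.ext fun _ => ⟨fun h => Subtype.ext h, fun h => congrArg Subtype.val h⟩
    rw [ht, PMF.toMeasure_apply_singleton _ _ (measurableSet_singleton _)]
    exact ENNReal.toReal_ofReal
      (div_pos (D.right_pos _) (mul_pos D.eigenvalue_pos (D.right_pos _))).le
  rw [hbox, Measure.real, choiceMeasure,
    Measure.infinitePi_pi _ fun p _ => (Set.toFinite (t p)).measurableSet,
    Finset.prod_image fun i _ j _ hij => (Prod.ext_iff.mp hij).1, ENNReal.toReal_prod]
  simp only [hfactor, prod_successor_probabilities]

/-- The Parry measure of an irreducible subshift of finite type: the Markov measure that is built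
from the Perron eigenvectors of the transition matrix. -/
noncomputable def parryMeasure : Measure (ofMatrix A) :=
  ∑ a, ENNReal.ofReal (D.left a * D.right a) • (choiceMeasure D).map (choicePoint a)

lemma parryMeasure_real {E : Set (ofMatrix A)} (hE : MeasurableSet E) :
    (parryMeasure D).real E =
      ∑ a, D.left a * D.right a * (choiceMeasure D).real (choicePoint a ⁻¹' E) := by
  have hfinite (a : (ofMatrix A).Symbols) : IsFiniteMeasure
      (ENNReal.ofReal (D.left a * D.right a) • (choiceMeasure D).map (choicePoint a)) :=
    Measure.smul_finite _ ENNReal.ofReal_ne_top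
  rw [Measure.real, parryMeasure, Measure.finsetSum_apply, ENNReal.toReal_sum fun a _ =>
    measure_ne_top _ _]
  refine Finset.sum_congr rfl fun a _ => ?_
  rw [← Measure.real, measureReal_ennreal_smul_apply,
    ENNReal.toReal_ofReal (mul_pos (D.left_pos a) (D.right_pos a)).le,
    map_measureReal_apply (measurable_choicePoint a) hE]

instance isProbabilityMeasure_parryMeasure : IsProbabilityMeasure (parryMeasure D) := by
  rw [isProbabilityMeasure_iff_real, parryMeasure_real D MeasurableSet.univ]
  simpa [dotProduct] using D.dotProduct_eq_one

lemma parryMeasure_real_cylinder (x : ofMatrix A) (n : ℕ) :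
    (parryMeasure D).real ((ofMatrix A).cylinder x (n + 1)) =
      D.left (coord x 0) * D.right (coord x n) / D.eigenvalue ^ n := by
  have hother (a : (ofMatrix A).Symbols) (ha : a ≠ coord x 0) :
      choicePoint a ⁻¹' (ofMatrix A).cylinder x (n + 1) = ∅ :=
    Set.eq_empty_of_forall_notMem fun ω hω => ha (Subtype.ext (hω 0 n.succ_pos))
  rw [parryMeasure_real D ((ofMatrix A).measurableSet_cylinder x (n + 1)),
    Finset.sum_eq_single (coord x 0) (fun a _ ha => by simp [hother a ha]) (by simp),
    choiceMeasure_real_preimage_cylinder]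
  have := (D.right_pos (coord x 0)).ne'
  field_simp

lemma parryMeasure_real_prepend_cylinder (i : (ofMatrix A).Symbols) (x : ofMatrix A) (n : ℕ) :
    (parryMeasure D).real ((ofMatrix A).prepend i ((ofMatrix A).cylinder x (n + 1))) =
      D.left i * transitionMatrix A i (coord x 0) *
        (D.right (coord x n) / D.eigenvalue ^ (n + 1)) := by
  rw [transitionMatrix_apply]
  split_ifs with h
  · rw [prepend_cylinder_of_transition x _ i h, parryMeasure_real_cylinder, mul_one, mul_div_assoc]
    rfl
  · rw [prepend_eq_empty_of_not_transition h fun y hy =>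
      (hy : y ∈ (ofMatrix A).cylinder x (n + 1)) 0 n.succ_pos]
    simp

lemma isInvariant_parryMeasure : (ofMatrix A).IsInvariant (parryMeasure D) := by
  have hmap := Measure.isProbabilityMeasure_map (μ := parryMeasure D)
    (ofMatrix A).measurable_shift.aemeasurable
  refine ⟨inferInstance, (ofMatrix A).measurable_shift,
    (ofMatrix A).measure_ext_of_cylinder fun x n => ?_⟩
  rw [← measureReal_eq_measureReal_iff]
  cases n with
  | zero => simp
  | succ n =>
    have hcyl := (ofMatrix A).measurableSet_cylinder x (n + 1)
    have hleft : ∑ i, D.left i * transitionMatrix A i (coord x 0) =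
        D.eigenvalue * D.left (coord x 0) := congrFun D.vecMul_left (coord x 0)
    rw [map_measureReal_apply (ofMatrix A).measurable_shift hcyl,
      measureReal_shift_preimage _ hcyl, ← sum_symbols (Z := ofMatrix A) fun i hi => ?_]
    · simp only [parryMeasure_real_prepend_cylinder, parryMeasure_real_cylinder]
      rw [← Finset.sum_mul, hleft]
      have := D.eigenvalue_pos.ne'
      field_simp
      ring
    · obtain ⟨z, hz⟩ := nonempty_of_measureReal_ne_zero hi
      exact ⟨z, hz.1⟩

lemma log_eigenvalue_le_measureEntropy :
    ((Real.log D.eigenvalue : ℝ) : EReal) ≤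
      measureEntropy (parryMeasure D) (ofMatrix A).shift := by
  obtain ⟨C, hC⟩ := (Set.finite_range fun p : (ofMatrix A).Symbols × (ofMatrix A).Symbols =>
    Real.log (D.left p.1 * D.right p.2)).bddAbove
  have hentropy (n : ℕ) : n * Real.log D.eigenvalue - C ≤
      partitionEntropy (parryMeasure D) ((ofMatrix A).word (n + 1)) := by
    have hword := (ofMatrix A).measurable_word (n + 1)
    rw [partitionEntropy_eq_neg_integral_log hword, le_neg]
    have hmono := integral_mono (integrable_comp_of_finite (μ := parryMeasure D) hword
        fun w => Real.log ((parryMeasure D).real ((ofMatrix A).word (n + 1) ⁻¹' {w})))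
      (integrable_const (-(n * Real.log D.eigenvalue - C))) fun x => by
        have hx : Real.log (D.left (coord x 0) * D.right (coord x n)) ≤ C :=
          hC ⟨(coord x 0, coord x n), rfl⟩
        rw [← cylinder_eq_preimage, parryMeasure_real_cylinder, Real.log_div
          (mul_pos (D.left_pos _) (D.right_pos _)).ne' (pow_pos D.eigenvalue_pos n).ne',
          Real.log_pow]
        linarith
    simpa using hmono
  refine le_iSup_of_le k (le_iSup_of_le (fun x : ofMatrix A => x.1 0)
    (le_iSup_of_le ((ofMatrix A).continuous_coord 0).measurable ?_))
  refine le_limsup_div (C := Real.log D.eigenvalue + C) (a := fun n => partitionEntropy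
    (parryMeasure D) (itinerary (ofMatrix A).shift (fun x : ofMatrix A => x.1 0) n)) ?_
  filter_upwards [eventually_ge_atTop 1] with n hn
  obtain ⟨m, rfl⟩ := Nat.exists_eq_add_of_le' hn
  rw [itinerary_shift_coord_zero]
  push_cast
  linarith [hentropy m]

end Parry

end Subshift

lemma exists_pos_bounds {ι : Type*} [Finite ι] {f : ι → ℝ} (hf : ∀ i, 0 < f i) :
    ∃ c C : ℝ, 0 < c ∧ 0 < C ∧ ∀ i, c ≤ f i ∧ f i ≤ C := by
  obtain ⟨C, hC⟩ := (Set.finite_range f).bddAbove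
  obtain ⟨D, hD⟩ := (Set.finite_range fun i => (f i)⁻¹).bddAbove
  refine ⟨(max D 1)⁻¹, max C 1, by positivity, by positivity, fun i => ⟨?_, ?_⟩⟩
  · exact inv_le_of_inv_le₀ (hf i) ((hD ⟨i, rfl⟩).trans (le_max_left _ _))
  · exact (hC ⟨i, rfl⟩).trans (le_max_left _ _)

namespace Subshift

variable {k : ℕ} {A : Matrix (Fin k) (Fin k) ℕ} {μ : Measure (ofMatrix A)} {l : ℝ} {w : Fin k → ℝ}

/-- The probability of the symbol `i` before the symbol `j` under the Parry measure, in terms of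
the eigenvalue `l` and a left eigenvector `w` of the transition matrix. -/
noncomputable def backward (A : Matrix (Fin k) (Fin k) ℕ) (l : ℝ) (w : Fin k → ℝ)
    (i j : Fin k) : ℝ := if A i j = 1 then w i / (l * w j) else 0

lemma isTransition_backward (hl : 0 < l) (hw : ∀ i, 0 < w i)
    (hsum : ∀ x : ofMatrix A, ∑ i, (if A i (x.1 0) = 1 then w i else 0) = l * w (x.1 0)) :
    (ofMatrix A).IsTransition fun i z => backward A l w i (z.1 0) where
  cont i := (continuous_of_discreteTopology (f := backward A l w i)).comp
    ((ofMatrix A).continuous_coord 0)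
  nonneg i z := by
    have := div_pos (hw i) (mul_pos hl (hw (z.1 0)))
    rw [backward]
    split_ifs <;> positivity
  sum_eq_one z := by
    have hdiv i : backward A l w i (z.1 0) =
        (if A i (z.1 0) = 1 then w i else 0) / (l * w (z.1 0)) := by simp [backward, ite_div]
    simp only [hdiv, ← Finset.sum_div, hsum, div_self (mul_pos hl (hw _)).ne']
  pos x := (div_pos (hw _) (mul_pos hl (hw _))).trans_eq (if_pos (transition_eq_one x 0)).symm

lemma integral_log_backward (hμ : (ofMatrix A).IsInvariant μ) (hl : 0 < l) (hw : ∀ i, 0 < w i) :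
    ∫ x, Real.log (backward A l w (x.1 0) (((ofMatrix A).shift x).1 0)) ∂μ = -Real.log l := by
  have := hμ.1
  let logw (x : ofMatrix A) : ℝ := Real.log (w (x.1 0))
  have hlog (x : ofMatrix A) : Real.log (backward A l w (x.1 0) (((ofMatrix A).shift x).1 0)) =
      logw x - logw ((ofMatrix A).shift x) - Real.log l := by
    rw [backward, if_pos (show A (x.1 0) (((ofMatrix A).shift x).1 0) = 1 from
      transition_eq_one x 0), Real.log_div (hw _).ne' (mul_pos hl (hw _)).ne',
      Real.log_mul hl.ne' (hw _).ne']
    ring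
  have hlogw : Continuous logw :=
    (continuous_of_discreteTopology (f := fun i => Real.log (w i))).comp
      ((ofMatrix A).continuous_coord 0)
  have hint : Integrable logw μ := integrable_of_continuous hlogw
  have hint_shift : Integrable (fun x => logw ((ofMatrix A).shift x)) μ :=
    hμ.2.integrable_comp_of_integrable hint
  simp only [hlog]
  rw [integral_sub (f := fun x => logw x - logw ((ofMatrix A).shift x)) (hint.sub hint_shift)
    (integrable_const _), integral_sub hint hint_shift,
    integral_comp_of_measurePreserving hμ.2 hlogw.aestronglyMeasurable]
  simp

/-- `μ` has the transition probabilities of the Parry measure, with the eigenvalue `l` and the left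
eigenvector `w`. The weights of symbols that do not occur in the subshift are immaterial. -/
structure IsParryMeasure (μ : Measure (ofMatrix A)) (l : ℝ) (w : Fin k → ℝ) : Prop where
  pos : 0 < l
  weight_pos : ∀ i, 0 < w i
  sum_weight_eq : ∀ x : ofMatrix A, ∑ i, (if A i (x.1 0) = 1 then w i else 0) = l * w (x.1 0)
  measureReal_prepend : ∀ i (E : Set (ofMatrix A)), IsClopen E →
    μ.real ((ofMatrix A).prepend i E) = ∑ j, backward A l w i j * μ.real (E ∩ {x | x.1 0 = j})

lemma exists_weight_extending_left (D : PerronData (transitionMatrix A)) :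
    ∃ w : Fin k → ℝ, (∀ i, 0 < w i) ∧ ∀ x : ofMatrix A,
      ∑ i, (if A i (x.1 0) = 1 then w i else 0) = D.eigenvalue * w (x.1 0) := by
  classical
  let w (i : Fin k) : ℝ := if h : ∃ z : ofMatrix A, z.1 0 = i then D.left ⟨i, h⟩ else 1
  have hw (i : (ofMatrix A).Symbols) : w i = D.left i := dif_pos i.2
  refine ⟨w, fun i => ?_, fun x => ?_⟩
  · unfold w
    split_ifs with h
    exacts [D.left_pos _, one_pos]
  · rw [← sum_symbols (Z := ofMatrix A) fun i hi =>
      ⟨consPoint x i (of_not_not fun h => hi (if_neg h)), rfl⟩]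
    have heigen : ∑ i, D.left i * transitionMatrix A i (coord x 0) =
        D.eigenvalue * D.left (coord x 0) := congrFun D.vecMul_left (coord x 0)
    simp only [transitionMatrix_apply, ← hw, mul_ite, mul_one, mul_zero] at heigen
    exact heigen

lemma IsMaximalEntropy.isMaximalTransition (hμ : (ofMatrix A).IsMaximalEntropy μ)
    (D : PerronData (transitionMatrix A)) (hw : ∀ i, 0 < w i)
    (hsum : ∀ x : ofMatrix A,
      ∑ i, (if A i (x.1 0) = 1 then w i else 0) = D.eigenvalue * w (x.1 0)) :
    IsMaximalTransition μ fun i z => backward A D.eigenvalue w i (z.1 0) where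
  toIsTransition := isTransition_backward D.eigenvalue_pos hw hsum
  integral_log_le q hq := by
    have hentropy : ((Real.log D.eigenvalue : ℝ) : EReal) ≤
        ((-∫ x, Real.log (q (x.1 0) ((ofMatrix A).shift x)) ∂μ : ℝ) : EReal) := calc
      ((Real.log D.eigenvalue : ℝ) : EReal)
        ≤ measureEntropy (parryMeasure D) (ofMatrix A).shift := log_eigenvalue_le_measureEntropy D
      _ ≤ ⨆ (ν : Measure (ofMatrix A)) (_ : (ofMatrix A).IsInvariant ν),
            measureEntropy ν (ofMatrix A).shift :=
          le_iSup₂_of_le (parryMeasure D) (isInvariant_parryMeasure D) le_rfl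
      _ = measureEntropy μ (ofMatrix A).shift := hμ.2.symm
      _ ≤ _ := hq.measureEntropy_le hμ.1
    rw [EReal.coe_le_coe_iff] at hentropy
    rw [integral_log_backward hμ.1 D.eigenvalue_pos hw]
    linarith

theorem IsMaximalEntropy.exists_isParryMeasure (hμ : (ofMatrix A).IsMaximalEntropy μ)
    (hX : (ofMatrix A).IsIrreducible) : ∃ l w, IsParryMeasure μ l w := by
  have := hμ.1.1
  obtain ⟨x⟩ := nonempty_of_isProbabilityMeasure μ
  have : Nonempty (ofMatrix A).Symbols := ⟨coord x 0⟩
  obtain ⟨D⟩ := nonempty_perronData (isIrreducible_transitionMatrix hX)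
  obtain ⟨w, hw, hsum⟩ := exists_weight_extending_left D
  refine ⟨D.eigenvalue, w, D.eigenvalue_pos, hw, hsum, fun i E hE => ?_⟩
  have hcoord := ((ofMatrix A).continuous_coord 0).measurable
  rw [(hμ.isMaximalTransition D hw hsum).hasTransitions hμ.1 i E hE,
    integral_comp_of_finite hcoord (backward A D.eigenvalue w i)]
  refine Finset.sum_congr rfl fun j _ => ?_
  rw [mul_comm, measureReal_restrict_apply (hcoord (measurableSet_singleton j)), Set.inter_comm]
  rfl

namespace IsParryMeasure

lemma measureReal_prepend_of_subset (hμ : IsParryMeasure μ l w) (i : Fin k) {j : Fin k}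
    {E : Set (ofMatrix A)} (hE : IsClopen E) (hEj : ∀ x ∈ E, x.1 0 = j) :
    μ.real ((ofMatrix A).prepend i E) = backward A l w i j * μ.real E := by
  rw [hμ.measureReal_prepend i E hE, Finset.sum_eq_single j]
  · rw [Set.inter_eq_left.mpr (show E ⊆ {x : ofMatrix A | x.1 0 = j} from hEj)]
  · intro j' _ hj'
    have hempty : E ∩ {x | x.1 0 = j'} = ∅ :=
      Set.eq_empty_of_forall_notMem fun x hx => hj' (hx.2.symm.trans (hEj x hx.1))
    rw [hempty, measureReal_empty, mul_zero]
  · simp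

lemma measureReal_cylinder (hμ : IsParryMeasure μ l w) (x : ofMatrix A) (n : ℕ) :
    μ.real ((ofMatrix A).cylinder x (n + 1)) =
      w (x.1 0) / (l ^ n * w (x.1 n)) * μ.real {z : ofMatrix A | z.1 0 = x.1 n} := by
  have hl := hμ.pos.ne'
  have hw i := (hμ.weight_pos i).ne'
  induction n generalizing x with
  | zero => rw [cylinder_one, pow_zero, one_mul, div_self (hw _), one_mul]
  | succ n ih =>
    rw [cylinder_succ, hμ.measureReal_prepend_of_subset (x.1 0) (j := x.1 1)
      ((ofMatrix A).isClopen_cylinder _ _) fun z hz => hz 0 n.succ_pos, ih,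
      backward, if_pos (transition_eq_one x 0)]
    simp only [shift_coord, zero_add]
    have := hw (x.1 1)
    have := hw (x.1 (n + 1))
    field_simp
    ring

lemma transitionMatrix_mulVec (hμ : IsParryMeasure μ l w) :
    (transitionMatrix A).mulVec
        (fun i : (ofMatrix A).Symbols => μ.real {x : ofMatrix A | x.1 0 = i} / w i) =
      l • fun i : (ofMatrix A).Symbols => μ.real {x : ofMatrix A | x.1 0 = i} / w i := by
  let p (i : Fin k) : ℝ := μ.real {x : ofMatrix A | x.1 0 = i}
  have hp (i : Fin k) : ∑ j : (ofMatrix A).Symbols, backward A l w i j * p j = p i := by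
    rw [sum_symbols (F := fun j => backward A l w i j * p j) fun j hj =>
      nonempty_of_measureReal_ne_zero (right_ne_zero_of_mul hj)]
    simpa [prepend, p] using (hμ.measureReal_prepend i Set.univ isClopen_univ).symm
  funext i
  change ∑ j, transitionMatrix A i j * (p j / w j) = l * (p i / w i)
  rw [← hp i, Finset.sum_div, Finset.mul_sum]
  refine Finset.sum_congr rfl fun j _ => ?_
  rw [transitionMatrix_apply, backward]
  have := (hμ.weight_pos i).ne'
  have := (hμ.weight_pos j).ne'
  have := hμ.pos.ne'
  split_ifs
  · field_simp
  · simp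

lemma measureReal_symbol_pos [IsProbabilityMeasure μ] (hμ : IsParryMeasure μ l w)
    (hX : (ofMatrix A).IsIrreducible) (i : (ofMatrix A).Symbols) :
    0 < μ.real {x : ofMatrix A | x.1 0 = i} := by
  have hne : (fun i : (ofMatrix A).Symbols => μ.real {x : ofMatrix A | x.1 0 = i} / w i) ≠ 0 := by
    intro hzero
    have hsum := sum_measureReal_fiber (μ := μ) ((ofMatrix A).continuous_coord 0).measurable
    refine one_ne_zero (hsum.symm.trans (Finset.sum_eq_zero fun i _ => ?_))
    by_contra hi
    obtain ⟨x, hx⟩ := nonempty_of_measureReal_ne_zero hi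
    exact (div_ne_zero hi (hμ.weight_pos i).ne') (congrFun hzero ⟨i, x, hx⟩)
  have hpos := (pos_of_mulVec_eq_smul (isIrreducible_transitionMatrix hX)
    (fun i => div_nonneg measureReal_nonneg (hμ.weight_pos i).le) hne
    hμ.transitionMatrix_mulVec).2 i
  exact (div_pos_iff_of_pos_right (hμ.weight_pos i)).mp hpos

theorem measureReal_cylinder_bounds [IsProbabilityMeasure μ] (hμ : IsParryMeasure μ l w)
    (hX : (ofMatrix A).IsIrreducible) :
    ∃ c C : ℝ, 0 < c ∧ 0 < C ∧ ∀ (x : ofMatrix A) (n : ℕ), 1 ≤ n →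
      c ≤ l ^ n * μ.real ((ofMatrix A).cylinder x n) ∧
      l ^ n * μ.real ((ofMatrix A).cylinder x n) ≤ C := by
  obtain ⟨c, C, hc, hC, h⟩ := exists_pos_bounds
    (f := fun q : Fin k × (ofMatrix A).Symbols =>
      l * w q.1 * (μ.real {x : ofMatrix A | x.1 0 = q.2} / w q.2))
    fun q => mul_pos (mul_pos hμ.pos (hμ.weight_pos _))
      (div_pos (hμ.measureReal_symbol_pos hX q.2) (hμ.weight_pos _))
  refine ⟨c, C, hc, hC, fun x n hn => ?_⟩
  obtain ⟨n, rfl⟩ := Nat.exists_eq_add_of_le' hn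
  have hcyl : l ^ (n + 1) * μ.real ((ofMatrix A).cylinder x (n + 1)) =
      l * w (x.1 0) * (μ.real {z : ofMatrix A | z.1 0 = x.1 n} / w (x.1 n)) := by
    rw [hμ.measureReal_cylinder]
    have := hμ.pos.ne'
    have := (hμ.weight_pos (x.1 n)).ne'
    field_simp
    ring
  rw [hcyl]
  exact h (x.1 0, coord x n)

end IsParryMeasure

end Subshift

section QuasiMultiplicative

variable {α : Type*} {T : α → α} {f f' f'' : ℕ → α → ℝ} {D : ℕ → ℝ}

/-- Two sequences of functions agree up to a factor that depends neither on the point nor on the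
index `n ≥ 1`. -/
def UniformlyComparable (f f' : ℕ → α → ℝ) : Prop :=
  ∃ K : ℝ, 0 < K ∧ ∀ n, 1 ≤ n → ∀ y, f n y ≤ K * f' n y ∧ f' n y ≤ K * f n y

/-- A sequence of functions is multiplicative along the orbits of `T` up to the factors `D n`. -/
def QuasiMultiplicative (T : α → α) (f : ℕ → α → ℝ) (D : ℕ → ℝ) : Prop :=
  ∀ (y : α) (n p : ℕ), 1 ≤ n → 1 ≤ p →
    f (n + p) y ≤ D n * (f n y * f p (T^[n] y)) ∧ f n y * f p (T^[n] y) ≤ D n * f (n + p) y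

lemma UniformlyComparable.symm (h : UniformlyComparable f f') : UniformlyComparable f' f :=
  let ⟨K, hK, hff'⟩ := h
  ⟨K, hK, fun n hn y => (hff' n hn y).symm⟩

lemma UniformlyComparable.trans (h : UniformlyComparable f f') (h' : UniformlyComparable f' f'') :
    UniformlyComparable f f'' := by
  obtain ⟨K, hK, hff'⟩ := h
  obtain ⟨L, hL, hf'f''⟩ := h'
  refine ⟨K * L, mul_pos hK hL, fun n hn y => ⟨?_, ?_⟩⟩
  · rw [mul_assoc]
    exact (hff' n hn y).1.trans (by gcongr; exact (hf'f'' n hn y).1)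
  · rw [mul_comm K, mul_assoc]
    exact (hf'f'' n hn y).2.trans (by gcongr; exact (hff' n hn y).2)

lemma UniformlyComparable.const_pow_mul {l : ℝ} (hl : 0 < l) (h : UniformlyComparable f f') :
    UniformlyComparable (fun n y => l ^ n * f n y) fun n y => l ^ n * f' n y := by
  obtain ⟨K, hK, hff'⟩ := h
  refine ⟨K, hK, fun n hn y => ?_⟩
  rw [mul_left_comm, mul_left_comm K]
  exact (hff' n hn y).imp (mul_le_mul_of_nonneg_left · (by positivity))
    (mul_le_mul_of_nonneg_left · (by positivity))

lemma UniformlyComparable.exists_quasiMultiplicative (h : UniformlyComparable f f')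
    (hf : ∀ n y, 0 ≤ f n y) : ∃ K : ℝ, 0 < K ∧ ∀ D : ℕ → ℝ, (∀ n, 0 < D n) →
      QuasiMultiplicative T f D → QuasiMultiplicative T f' fun n => K * D n := by
  obtain ⟨K, hK, hff'⟩ := h
  refine ⟨K * K * K, by positivity, fun D hD hfD y n p hn hp => ?_⟩
  obtain ⟨hupper, hlower⟩ := hfD y n p hn hp
  obtain ⟨hn₁, hn₂⟩ := hff' n hn y
  obtain ⟨hp₁, hp₂⟩ := hff' p hp (T^[n] y)
  obtain ⟨hnp₁, hnp₂⟩ := hff' (n + p) (by omega) y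
  have := hf n y
  have := hf p (T^[n] y)
  have := hD n
  have : 0 ≤ f' n y := nonneg_of_mul_nonneg_right ((hf n y).trans hn₁) hK
  have : 0 ≤ f' p (T^[n] y) := nonneg_of_mul_nonneg_right ((hf p _).trans hp₁) hK
  constructor
  · calc f' (n + p) y ≤ K * (D n * (f n y * f p (T^[n] y))) := hnp₂.trans (by gcongr)
      _ ≤ K * (D n * ((K * f' n y) * (K * f' p (T^[n] y)))) := by gcongr
      _ = K * K * K * D n * (f' n y * f' p (T^[n] y)) := by ring
  · calc f' n y * f' p (T^[n] y) ≤ (K * f n y) * (K * f p (T^[n] y)) := by gcongr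
      _ = K * K * (f n y * f p (T^[n] y)) := by ring
      _ ≤ K * K * (D n * (K * f' (n + p) y)) := by grw [hlower, hnp₁]
      _ = K * K * K * D n * f' (n + p) y := by ring

lemma quasiMultiplicative_const_pow_mul_iff {l : ℝ} (hl : 0 < l) :
    QuasiMultiplicative T (fun n y => l ^ n * f n y) D ↔ QuasiMultiplicative T f D := by
  refine forall₃_congr fun y n p => forall₂_congr fun _ _ => ?_
  have hlnp : 0 < l ^ (n + p) := by positivity
  beta_reduce
  rw [mul_mul_mul_comm, ← pow_add, mul_left_comm (D n) (l ^ (n + p)),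
    mul_left_comm (D n) (l ^ (n + p)),
    mul_le_mul_iff_right₀ hlnp, mul_le_mul_iff_right₀ hlnp]

lemma quasiMultiplicative_exp_iff {B : ℕ → ℝ} :
    QuasiMultiplicative T f (fun n => Real.exp (B n)) ↔
      ∀ (y : α) (n p : ℕ), 1 ≤ n → 1 ≤ p →
        f (n + p) y ≤ Real.exp (B n) * f n y * f p (T^[n] y) ∧
        Real.exp (-B n) * f n y * f p (T^[n] y) ≤ f (n + p) y := by
  refine forall₃_congr fun y n p => forall₂_congr fun _ _ => ?_
  rw [mul_assoc, mul_assoc, Real.exp_neg, inv_mul_le_iff₀ (Real.exp_pos _)]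

lemma quasiMultiplicative_exp_birkhoffSum (g : α → ℝ) :
    QuasiMultiplicative T (fun n y => Real.exp (birkhoffSum T g n y)) 1 := fun y n p _ _ => by
  beta_reduce
  rw [birkhoffSum_add, Real.exp_add, Pi.one_apply, one_mul]
  exact ⟨le_rfl, le_rfl⟩

end QuasiMultiplicative

namespace Subshift

variable {k d : ℕ} {X : Subshift k} {Y : Subshift d} {π : X → Y} {φ : Fin k → Fin d}

lemma almostAdditive_of_quasiMultiplicative {f : ℕ → Y → ℝ} {K : ℝ} (hK : 0 < K)
    (hf : ∀ n y, 0 ≤ f n y) (h : QuasiMultiplicative Y.shift f fun _ => K) :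
    Y.AlmostAdditive f := by
  have hexp : K ≤ Real.exp (max (Real.log K) 1) :=
    (Real.log_le_iff_le_exp hK).mp (le_max_left _ _)
  refine ⟨max (Real.log K) 1, by positivity,
    quasiMultiplicative_exp_iff.mp fun y n p hn hp => ?_⟩
  have := hf n y
  have := hf p (Y.shift^[n] y)
  have := hf (n + p) y
  exact ⟨(h y n p hn hp).1.trans (by gcongr), (h y n p hn hp).2.trans (by gcongr)⟩

lemma IsOneBlockCode.image_mem_cylinder (hcode : IsOneBlockCode φ π) {x z : X} {n : ℕ}
    (h : z ∈ X.cylinder x n) : π z ∈ Y.cylinder (π x) n := fun i hi => by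
  rw [hcode, hcode, h i hi]

lemma exists_isFiberSection (π : X → Y) (n : ℕ) (y : Y) : ∃ E, IsFiberSection π n y E := by
  obtain ⟨E, hE, hbij⟩ := Set.exists_subset_bijOn {x | π x ∈ Y.cylinder y n} (X.word n)
  have hfin : E.Finite := Set.Finite.of_injOn (f := X.word n) (t := Set.univ)
    (fun _ _ => Set.mem_univ _) hbij.injOn Set.finite_univ
  refine ⟨hfin.toFinset, fun x hx => hE (hfin.mem_toFinset.mp hx), fun x hx => ?_⟩
  obtain ⟨e, he, hex⟩ := hbij.surjOn ⟨x, hx, rfl⟩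
  refine ⟨e, ⟨hfin.mem_toFinset.mpr he, X.word_eq_iff.mp hex⟩, ?_⟩
  rintro e' ⟨he', hex'⟩
  exact hbij.injOn (hfin.mem_toFinset.mp he') he ((X.word_eq_iff.mpr hex').trans hex.symm)

lemma IsFiberSection.preimage_cylinder (hcode : IsOneBlockCode φ π) {n : ℕ} {y : Y}
    {E : Finset X} (hE : IsFiberSection π n y E) :
    π ⁻¹' Y.cylinder y n = ⋃ e ∈ E, X.cylinder e n := by
  ext x
  simp only [Set.mem_preimage, Set.mem_iUnion, exists_prop]
  constructor
  · intro hx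
    obtain ⟨e, ⟨he, hex⟩, -⟩ := hE.2 x hx
    exact ⟨e, he, fun i hi => (hex i hi).symm⟩
  · rintro ⟨e, he, hxe⟩
    rw [← Y.cylinder_eq_of_mem (hE.1 e he)]
    exact hcode.image_mem_cylinder hxe

lemma IsFiberSection.pairwiseDisjoint_cylinder {n : ℕ} {y : Y} {E : Finset X}
    (hE : IsFiberSection π n y E) :
    (E : Set X).PairwiseDisjoint fun e => X.cylinder e n := by
  intro e he e' he' hne
  refine Set.disjoint_left.mpr fun z hz hz' => hne ?_
  obtain ⟨e₀, -, huniq⟩ := hE.2 e (hE.1 e he)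
  exact (huniq e ⟨he, X.self_mem_cylinder e n⟩).trans
    (huniq e' ⟨he', fun i hi => (hz' i hi).symm.trans (hz i hi)⟩).symm

lemma IsFiberSection.measureReal_map_cylinder (hcode : IsOneBlockCode φ π) (hπ : Measurable π)
    (μ : Measure X) [IsFiniteMeasure μ] {n : ℕ} {y : Y} {E : Finset X}
    (hE : IsFiberSection π n y E) :
    (μ.map π).real (Y.cylinder y n) = ∑ e ∈ E, μ.real (X.cylinder e n) := by
  rw [map_measureReal_apply hπ (Y.measurableSet_cylinder y n), hE.preimage_cylinder hcode,
    measureReal_biUnion_finset hE.pairwiseDisjoint_cylinder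
      fun e _ => X.measurableSet_cylinder e n]

lemma relPressureSeq_zero (π : X → Y) (n : ℕ) (y : Y) :
    relPressureSeq π (fun _ => 0) n y =
      sSup {s : ℝ | ∃ E : Finset X, IsFiberSection π n y E ∧ s = E.card} := by
  simp [relPressureSeq, birkhoffSum]

lemma relPressureSeq_nonneg (π : X → Y) (f : X → ℝ) (n : ℕ) (y : Y) :
    0 ≤ relPressureSeq π f n y := by
  refine Real.sSup_nonneg ?_
  rintro _ ⟨E, -, rfl⟩
  exact Finset.sum_nonneg fun x _ => (Real.exp_pos _).le

lemma uniformlyComparable_relPressureSeq (hcode : IsOneBlockCode φ π) (hπ : Measurable π)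
    {μ : Measure X} [IsFiniteMeasure μ] {l c C : ℝ} (hc : 0 < c)
    (hμ : ∀ (x : X) (n : ℕ), 1 ≤ n → c ≤ l ^ n * μ.real (X.cylinder x n) ∧
      l ^ n * μ.real (X.cylinder x n) ≤ C) :
    UniformlyComparable (relPressureSeq π fun _ => 0)
      fun n y => l ^ n * (μ.map π).real (Y.cylinder y n) := by
  refine ⟨max c⁻¹ C, by positivity, fun n hn y => ?_⟩
  have hcard {E : Finset X} (hE : IsFiberSection π n y E) :
      E.card ≤ c⁻¹ * (l ^ n * (μ.map π).real (Y.cylinder y n)) ∧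
      l ^ n * (μ.map π).real (Y.cylinder y n) ≤ C * E.card := by
    rw [hE.measureReal_map_cylinder hcode hπ μ, Finset.mul_sum, le_inv_mul_iff₀ hc, mul_comm c,
      mul_comm C, ← nsmul_eq_mul, ← nsmul_eq_mul]
    exact ⟨Finset.card_nsmul_le_sum _ _ _ fun e _ => (hμ e n hn).1,
      Finset.sum_le_card_nsmul _ _ _ fun e _ => (hμ e n hn).2⟩
  obtain ⟨E, hE⟩ := exists_isFiberSection π n y
  have hmem : (E.card : ℝ) ∈ {s : ℝ | ∃ E : Finset X, IsFiberSection π n y E ∧ s = E.card} :=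
    ⟨E, hE, rfl⟩
  have hbound : ∀ s ∈ {s : ℝ | ∃ E : Finset X, IsFiberSection π n y E ∧ s = E.card},
      s ≤ c⁻¹ * (l ^ n * (μ.map π).real (Y.cylinder y n)) := by
    rintro _ ⟨F, hF, rfl⟩
    exact (hcard hF).1
  have hmeasure : 0 ≤ l ^ n * (μ.map π).real (Y.cylinder y n) :=
    nonneg_of_mul_nonneg_right (E.card.cast_nonneg.trans (hcard hE).1) (inv_pos.mpr hc)
  rw [relPressureSeq_zero]
  constructor
  · exact (csSup_le ⟨_, hmem⟩ hbound).trans (by gcongr; exact le_max_left _ _)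
  · exact (hcard hE).2.trans (by gcongr; exacts [le_max_right _ _, le_csSup ⟨_, hbound⟩ hmem])

end Subshift

namespace Subshift

variable {k : ℕ} {Z : Subshift k} {ν : Measure Z} {g : Z → ℝ} {P : ℝ} {C : ℕ → ℝ}

lemma gibbsBounds_iff (hC : ∀ n, 1 ≤ n → 0 < C n) :
    Z.GibbsBounds ν g P C ↔ ∀ (x : Z) (n : ℕ), 1 ≤ n →
      Real.exp (birkhoffSum Z.shift g n x - n * P) ≤ C n * ν.real (Z.cylinder x n) ∧
      ν.real (Z.cylinder x n) ≤ C n * Real.exp (birkhoffSum Z.shift g n x - n * P) := by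
  refine forall₂_congr fun x n => forall_congr' fun hn => ?_
  have := hC n hn
  rw [← Real.exp_add, neg_add_eq_sub, div_le_div_iff₀ (hC n hn) (Real.exp_pos _), one_mul,
    mul_comm (ν.real _), div_le_iff₀ (Real.exp_pos _)]

namespace GibbsBounds

lemma uniformlyComparable {K : ℝ} (hK : 0 < K) (h : Z.GibbsBounds ν g P fun _ => K) :
    UniformlyComparable (fun n x => ν.real (Z.cylinder x n))
      fun n x => Real.exp (birkhoffSum Z.shift (fun x => g x - P) n x) := by
  refine ⟨K, hK, fun n hn x => ?_⟩
  have hsum : birkhoffSum Z.shift (fun x => g x - P) n x = birkhoffSum Z.shift g n x - n * P := by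
    simp [birkhoffSum]
  beta_reduce
  rw [hsum]
  exact ((gibbsBounds_iff fun _ _ => hK).mp h x n hn).symm

lemma measureReal_pos (hC : ∀ n, 1 ≤ n → 0 < C n) (h : Z.GibbsBounds ν g P C) (x : Z) {n : ℕ}
    (hn : 1 ≤ n) : 0 < ν.real (Z.cylinder x n) :=
  pos_of_mul_pos_right
    ((Real.exp_pos _).trans_le ((gibbsBounds_iff hC).mp h x n hn).1) (hC n hn).le

lemma one_le_mul_exp [IsProbabilityMeasure ν] {m : Measure Z} [IsProbabilityMeasure m] {P' : ℝ}
    {C' : ℕ → ℝ} (hC : ∀ n, 1 ≤ n → 0 < C n) (hC' : ∀ n, 1 ≤ n → 0 < C' n)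
    (h : Z.GibbsBounds m g P C) (h' : Z.GibbsBounds ν g P' C') {n : ℕ} (hn : 1 ≤ n) :
    1 ≤ C n * C' n * Real.exp (n * (P' - P)) := by
  have hle (v : Fin n → Fin k) :
      m.real (Z.word n ⁻¹' {v}) ≤
        C n * C' n * Real.exp (n * (P' - P)) * ν.real (Z.word n ⁻¹' {v}) := by
    rcases (Z.word n ⁻¹' {v}).eq_empty_or_nonempty with h_empty | ⟨x, rfl⟩
    · simp [h_empty]
    rw [← cylinder_eq_preimage]
    have := hC n hn
    calc m.real (Z.cylinder x n)
        ≤ C n * Real.exp (birkhoffSum Z.shift g n x - n * P) :=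
          ((gibbsBounds_iff hC).mp h x n hn).2
      _ = C n * Real.exp (n * (P' - P)) * Real.exp (birkhoffSum Z.shift g n x - n * P') := by
          rw [mul_assoc, ← Real.exp_add]
          ring_nf
      _ ≤ C n * Real.exp (n * (P' - P)) * (C' n * ν.real (Z.cylinder x n)) := by
          gcongr
          exact ((gibbsBounds_iff hC').mp h' x n hn).1
      _ = C n * C' n * Real.exp (n * (P' - P)) * ν.real (Z.cylinder x n) := by ring
  calc 1 = ∑ v, m.real (Z.word n ⁻¹' {v}) := (sum_measureReal_fiber (Z.measurable_word n)).symm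
    _ ≤ ∑ v, C n * C' n * Real.exp (n * (P' - P)) * ν.real (Z.word n ⁻¹' {v}) :=
        Finset.sum_le_sum fun v _ => hle v
    _ = C n * C' n * Real.exp (n * (P' - P)) := by
        rw [← Finset.mul_sum, sum_measureReal_fiber (Z.measurable_word n), mul_one]

lemma pressure_le [IsProbabilityMeasure ν] {m : Measure Z} [IsProbabilityMeasure m] {P' : ℝ}
    {C' : ℕ → ℝ} (hC : ∀ n, 1 ≤ n → 0 < C n) (hC' : ∀ n, 1 ≤ n → 0 < C' n)
    (hlim : Tendsto (fun n : ℕ => Real.log (C n) / n) atTop (𝓝 0))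
    (hlim' : Tendsto (fun n : ℕ => Real.log (C' n) / n) atTop (𝓝 0))
    (h : Z.GibbsBounds m g P C) (h' : Z.GibbsBounds ν g P' C') : P ≤ P' := by
  have hle : P - P' ≤ 0 + 0 := ge_of_tendsto (hlim.add hlim') <| by
    filter_upwards [eventually_ge_atTop 1] with n hn
    have hlog := Real.log_nonneg (h.one_le_mul_exp hC hC' h' hn)
    rw [Real.log_mul (mul_pos (hC n hn) (hC' n hn)).ne' (Real.exp_pos _).ne', Real.log_exp,
      Real.log_mul (hC n hn).ne' (hC' n hn).ne'] at hlog
    rw [← add_div, le_div_iff₀ (by exact_mod_cast hn)]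
    linarith
  linarith

lemma le_partitionEntropy (hν : Z.IsInvariant ν) (hg : Continuous g)
    (hC : ∀ n, 1 ≤ n → 0 < C n) (h : Z.GibbsBounds ν g P C) {n : ℕ} (hn : 1 ≤ n) :
    n * (P - ∫ x, g x ∂ν) - Real.log (C n) ≤ partitionEntropy ν (Z.word n) := by
  have := hν.1
  have hg_int : Integrable g ν := Z.integrable_of_continuous hg
  have hsum_int : Integrable (birkhoffSum Z.shift g n) ν := integrable_birkhoffSum hν.2 hg_int n
  have hlog (x : Z) : Real.log (ν.real (Z.word n ⁻¹' {Z.word n x})) ≤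
      birkhoffSum Z.shift g n x + (Real.log (C n) - n * P) := by
    rw [← cylinder_eq_preimage]
    refine (Real.log_le_log (h.measureReal_pos hC x hn)
      ((gibbsBounds_iff hC).mp h x n hn).2).trans_eq ?_
    rw [Real.log_mul (hC n hn).ne' (Real.exp_pos _).ne', Real.log_exp]
    ring
  have hint := integral_mono (integrable_comp_of_finite (μ := ν) (Z.measurable_word n)
    fun v => Real.log (ν.real (Z.word n ⁻¹' {v})))
    (hsum_int.add (integrable_const (Real.log (C n) - n * P))) hlog
  simp only [Pi.add_apply] at hint
  rw [integral_add hsum_int (integrable_const _), integral_birkhoffSum hν.2 hg_int] at hint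
  rw [partitionEntropy_eq_neg_integral_log (Z.measurable_word n)]
  simp only [integral_const, probReal_univ, smul_eq_mul, one_mul] at hint
  linarith

/-- The entropy of `ν` is at least `-∫ log q`, and for every other family of transition
probabilities `q'` it is at most `-∫ log q'`. -/
lemma isMaximalTransition (hν : Z.IsInvariant ν) {q : Fin k → Z → ℝ} (hq : Z.IsTransition q)
    (hP : 0 ≤ P) (hC : ∀ n, 1 ≤ n → 0 < C n)
    (hlim : Tendsto (fun n : ℕ => Real.log (C n) / n) atTop (𝓝 0))
    (h : Z.GibbsBounds ν (fun x => Real.log (q (x.1 0) (Z.shift x))) P C) :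
    IsMaximalTransition ν q where
  toIsTransition := hq
  integral_log_le q' hq' := by
    refine le_of_forall_pos_le_add fun ε hε => ?_
    obtain ⟨D, hD⟩ := hq'.partitionEntropy_word_le hν hε
    set I := ∫ x, Real.log (q (x.1 0) (Z.shift x)) ∂ν
    set I' := ∫ x, Real.log (q' (x.1 0) (Z.shift x)) ∂ν
    have hle : I' - I - ε ≤ 0 + 0 :=
      ge_of_tendsto (hlim.add (tendsto_const_div_atTop_nhds_zero_nat D)) <| by
        filter_upwards [eventually_ge_atTop 1] with n hn
        have hlower := h.le_partitionEntropy hν hq.continuous_log hC hn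
        have hnP : 0 ≤ n * P := by positivity
        rw [← add_div, le_div_iff₀ (by exact_mod_cast hn)]
        linarith [hD n]
    linarith

end GibbsBounds

end Subshift

namespace Subshift

section PrependWord

variable {k : ℕ} {Z : Subshift k}

lemma prependWord_iUnion {ι : Type*} (w : List (Fin k)) (E : ι → Set Z) :
    Z.prependWord w (⋃ i, E i) = ⋃ i, Z.prependWord w (E i) := by
  induction w with
  | nil => rfl
  | cons i w ih =>
    ext z
    simp [ih, prepend]

lemma disjoint_prependWord {E F : Set Z} (hEF : Disjoint E F) (w : List (Fin k)) :
    Disjoint (Z.prependWord w E) (Z.prependWord w F) := by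
  induction w with
  | nil => exact hEF
  | cons i w ih => exact Set.disjoint_left.mpr fun z hz hz' => Set.disjoint_left.mp ih hz.2 hz'.2

lemma prepend_univ (i : Fin k) : Z.prepend i Set.univ = {z | z.1 0 = i} := by
  ext z
  simp [prepend]

lemma measureReal_prependWord_univ (ν : Measure Z) [IsFiniteMeasure ν] (w : List (Fin k)) :
    ν.real (Z.prependWord w Set.univ) = ∑ i, ν.real (Z.prependWord (w ++ [i]) Set.univ) := by
  have huniv : (Set.univ : Set Z) = ⋃ i, Z.prepend i Set.univ := by
    ext z
    simp [prepend]
  conv_lhs => rw [huniv, prependWord_iUnion]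
  simp only [prependWord_append, prependWord_cons, prependWord_nil]
  refine measureReal_iUnion_fintype (fun i j hij => disjoint_prependWord ?_ w) fun i =>
    (Z.isClopen_prependWord w (Z.isClopen_prepend i isClopen_univ)).isOpen.measurableSet
  exact Set.disjoint_left.mpr fun z hz hz' => hij (hz.1.symm.trans hz'.1)

lemma measureReal_prependWord_le {ν : Measure Z} (hν : Z.IsInvariant ν) (w : List (Fin k))
    {E : Set Z} (hE : IsClopen E) : ν.real (Z.prependWord w E) ≤ ν.real E := by
  have := hν.1
  induction w with
  | nil => exact le_rfl
  | cons i w ih =>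
    refine le_trans ?_ ih
    rw [← hν.2.measureReal_preimage
      (Z.isClopen_prependWord w hE).isOpen.measurableSet.nullMeasurableSet]
    exact measureReal_mono fun x hx => hx.2

end PrependWord

section TwoSymbols

variable {Y : Subshift 2} {ν m : Measure Y} {q : Fin 2 → Y → ℝ}

/-- The cylinder of the symbol `0`. -/
def zeroSet (Y : Subshift 2) : Set Y := {y | y.1 0 = 0}

lemma isClopen_zeroSet : IsClopen Y.zeroSet := Y.isClopen_symbol 0 0

lemma prependWord_append_zero_univ (w : List (Fin 2)) :
    Y.prependWord (w ++ [0]) Set.univ = Y.prependWord w Y.zeroSet := by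
  rw [prependWord_append, prependWord_cons, prependWord_nil, prepend_univ, zeroSet]

/-- The points at which the symbol `0` occurs first at position `a`: the cylinder of `1 … 1 0`. -/
def firstZeroSet (Y : Subshift 2) (a : ℕ) : Set Y := {y | (∀ j < a, y.1 j = 1) ∧ y.1 a = 0}

lemma firstZeroSet_zero : Y.firstZeroSet 0 = Y.zeroSet := by
  ext y
  simp [firstZeroSet, zeroSet]

lemma prepend_one_firstZeroSet (a : ℕ) :
    Y.prepend 1 (Y.firstZeroSet a) = Y.firstZeroSet (a + 1) := by
  ext y
  simp only [prepend, firstZeroSet, Set.mem_ofPred_eq, shift_coord, Nat.forall_lt_succ_left,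
    and_assoc]

lemma isClopen_firstZeroSet (a : ℕ) : IsClopen (Y.firstZeroSet a) := by
  induction a with
  | zero => exact firstZeroSet_zero ▸ isClopen_zeroSet
  | succ a ih => exact prepend_one_firstZeroSet (Y := Y) a ▸ Y.isClopen_prepend 1 ih

lemma exists_prependWord_subset_firstZeroSet (w : List (Fin 2)) :
    ∃ a, Y.prependWord w Y.zeroSet ⊆ Y.firstZeroSet a := by
  induction w with
  | nil => exact ⟨0, firstZeroSet_zero.ge⟩
  | cons i w ih =>
    obtain ⟨a, ha⟩ := ih
    fin_cases i
    · exact ⟨0, fun z hz => firstZeroSet_zero.ge hz.1⟩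
    · exact ⟨a + 1, (Y.prepend_mono 1 ha).trans (prepend_one_firstZeroSet a).le⟩

namespace HasTransitions

lemma measureReal_prependWord_zeroSet_mul (hqν : HasTransitions ν q)
    (hqm : HasTransitions m q)
    (hconst : ∀ i a, ∃ c, ∀ z ∈ Y.firstZeroSet a, q i z = c) (w : List (Fin 2)) :
    ν.real (Y.prependWord w Y.zeroSet) * m.real Y.zeroSet =
      m.real (Y.prependWord w Y.zeroSet) * ν.real Y.zeroSet := by
  induction w with
  | nil => exact mul_comm _ _
  | cons i w ih =>
    obtain ⟨a, ha⟩ := exists_prependWord_subset_firstZeroSet (Y := Y) w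
    obtain ⟨c, hc⟩ := hconst i a
    have hE := Y.isClopen_prependWord w isClopen_zeroSet
    have hstep {η : Measure Y} (hη : HasTransitions η q) :
        η.real (Y.prependWord (i :: w) Y.zeroSet) = η.real (Y.prependWord w Y.zeroSet) * c := by
      rw [prependWord_cons, hη i _ hE,
        setIntegral_congr_fun hE.isOpen.measurableSet fun z hz => hc z (ha hz),
        setIntegral_const, smul_eq_mul]
    rw [hstep hqν, hstep hqm]
    linear_combination c * ih

lemma tendsto_measureReal_replicate (hν : Y.IsInvariant ν) (hqν : HasTransitions ν q)
    (hq : Continuous (q 0)) (hpos : ∀ z : Y, z.1 0 = 1 → 0 < q 0 z) :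
    Tendsto (fun n => ν.real (Y.prependWord (List.replicate n 1) Set.univ)) atTop (𝓝 0) := by
  have := hν.1
  obtain ⟨δ, hδ, hδq⟩ := (Y.isClopen_symbol 0 1).isClosed.isCompact.exists_forall_le'
    hq.continuousOn hpos
  set T : ℕ → ℝ := fun n => ν.real (Y.prependWord (List.replicate n 1) Set.univ)
  have hstep (n : ℕ) : T (n + 2) ≤ (1 - δ) * T (n + 1) := by
    have hclopen := Y.isClopen_prependWord (List.replicate (n + 1) 1) isClopen_univ
    have hsplit := measureReal_shift_preimage ν hclopen.isOpen.measurableSet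
    rw [hν.2.measureReal_preimage hclopen.isOpen.measurableSet.nullMeasurableSet,
      Fin.sum_univ_two, hqν 0 _ hclopen, ← prependWord_cons, ← List.replicate_succ] at hsplit
    have hle := setIntegral_ge_of_const_le_real hclopen.isOpen.measurableSet (measure_ne_top ν _)
      (fun z hz => hδq z hz.1) (Y.integrable_of_continuous hq).integrableOn
    linarith
  have hanti : Antitone fun n => T (n + 1) := antitone_nat_of_succ_le fun n => by
    nlinarith [hstep n, measureReal_nonneg (μ := ν)
      (s := Y.prependWord (List.replicate (n + 1) 1) Set.univ)]
  have hlim := tendsto_atTop_ciInf hanti ⟨0, by rintro _ ⟨n, rfl⟩; exact measureReal_nonneg⟩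
  set L := ⨅ n, T (n + 1)
  have hL : L ≤ (1 - δ) * L :=
    le_of_tendsto_of_tendsto' (hlim.comp (tendsto_add_atTop_nat 1)) (hlim.const_mul _) hstep
  have hL0 : 0 ≤ L := ge_of_tendsto' hlim fun n => measureReal_nonneg
  rwa [show L = 0 by nlinarith, tendsto_add_atTop_iff_nat 1] at hlim

lemma tendsto_measureReal_append_replicate (hν : Y.IsInvariant ν) (hqν : HasTransitions ν q)
    (hq : Continuous (q 0)) (hpos : ∀ z : Y, z.1 0 = 1 → 0 < q 0 z) (w : List (Fin 2)) :
    Tendsto (fun n => ν.real (Y.prependWord (w ++ List.replicate n 1) Set.univ)) atTop (𝓝 0) := by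
  refine squeeze_zero (fun _ => measureReal_nonneg) (fun n => ?_)
    (hqν.tendsto_measureReal_replicate hν hq hpos)
  rw [prependWord_append]
  exact measureReal_prependWord_le hν w (Y.isClopen_prependWord _ isClopen_univ)

/-- Transition probabilities that depend only on the first occurrence of `0` determine the masses of
the cylinders `w 0` up to a common factor. Writing a cylinder `w` as the union of `w 0`, `w 1 0`, …
and `w 1 1 … 1`, the mass of the last part vanishes in the limit. -/
lemma eq (hν : Y.IsInvariant ν) (hm : Y.IsInvariant m) (hqν : HasTransitions ν q)
    (hqm : HasTransitions m q) (hq : Continuous (q 0)) (hpos : ∀ z : Y, z.1 0 = 1 → 0 < q 0 z)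
    (hconst : ∀ i a, ∃ c, ∀ z ∈ Y.firstZeroSet a, q i z = c) (hm0 : 0 < m.real Y.zeroSet) :
    ν = m := by
  have := hν.1
  have := hm.1
  let d (w : List (Fin 2)) : ℝ := ν.real (Y.prependWord w Set.univ) * m.real Y.zeroSet -
    m.real (Y.prependWord w Set.univ) * ν.real Y.zeroSet
  have hd_snoc (w) : d w = d (w ++ [1]) := by
    simp only [d]
    rw [measureReal_prependWord_univ ν w, measureReal_prependWord_univ m w,
      Fin.sum_univ_two, Fin.sum_univ_two, prependWord_append_zero_univ]
    linear_combination hqν.measureReal_prependWord_zeroSet_mul hqm hconst w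
  have hd_append (w) (n : ℕ) : d w = d (w ++ List.replicate n 1) := by
    induction n with
    | zero => simp
    | succ n ih => rw [ih, hd_snoc, List.replicate_succ', List.append_assoc]
  have hd (w) : d w = 0 := by
    have hlim :=
      ((hqν.tendsto_measureReal_append_replicate hν hq hpos w).mul_const (m.real Y.zeroSet)).sub
      ((hqm.tendsto_measureReal_append_replicate hm hq hpos w).mul_const (ν.real Y.zeroSet))
    rw [zero_mul, zero_mul, sub_zero] at hlim
    exact tendsto_const_nhds_iff.mp (hlim.congr fun n => (hd_append w n).symm)
  have h_zero : m.real Y.zeroSet = ν.real Y.zeroSet := by simpa [d, sub_eq_zero] using hd []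
  refine Y.measure_ext_of_prependWord fun w => (measureReal_eq_measureReal_iff).mp ?_
  have hdw := hd w
  rw [sub_eq_zero, ← h_zero] at hdw
  exact mul_right_cancel₀ hm0.ne' hdw

end HasTransitions

end TwoSymbols

end Subshift

namespace Subshift

section FirstZero

variable {Y : Subshift 2} {r : ℕ → ℝ} {θ : ℝ} {y : Y}

lemma exists_mem_firstZeroSet {n : ℕ} (h : y.1 n = 0) : ∃ a ≤ n, y ∈ Y.firstZeroSet a := by
  classical
  have h' : ∃ n, y.1 n = 0 := ⟨n, h⟩
  exact ⟨Nat.find h', Nat.find_min' h' h, fun j hj => Fin.eq_one_of_ne_zero _ (Nat.find_min h' hj),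
    Nat.find_spec h'⟩

lemma cylinder_eq_firstZeroSet {a : ℕ} (h : y ∈ Y.firstZeroSet a) :
    Y.cylinder y (a + 1) = Y.firstZeroSet a := by
  ext z
  simp only [cylinder, firstZeroSet, Set.mem_ofPred_eq, Nat.forall_lt_succ_right, h.2]
  exact and_congr_left' (forall₂_congr fun j hj => by rw [h.1 j hj])

lemma mem_firstZeroSet_or_forall (y : Y) : (∃ a, y ∈ Y.firstZeroSet a) ∨ ∀ n, y.1 n = 1 := by
  by_cases h : ∃ n, y.1 n = 0
  · obtain ⟨n, hn⟩ := h
    obtain ⟨a, -, ha⟩ := exists_mem_firstZeroSet hn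
    exact Or.inl ⟨a, ha⟩
  · push Not at h
    exact Or.inr fun n => Fin.eq_one_of_ne_zero _ (h n)

open Classical in
/-- The function with value `r a` at the points where `0` occurs first at position `a`, and with
value `θ` at the fixed point `1 1 1 …`. -/
noncomputable def firstZeroFun (Y : Subshift 2) (r : ℕ → ℝ) (θ : ℝ) (y : Y) : ℝ :=
  if h : ∃ n, y.1 n = 0 then r (Nat.find h) else θ

lemma firstZeroFun_of_mem {a : ℕ} (hy : y ∈ Y.firstZeroSet a) : firstZeroFun Y r θ y = r a := by
  classical
  have h : ∃ n, y.1 n = 0 := ⟨a, hy.2⟩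
  rw [firstZeroFun, dif_pos h, (Nat.find_eq_iff h).mpr ⟨hy.2, fun n hn => ?_⟩]
  simp [hy.1 n hn]

lemma firstZeroFun_of_forall (hy : ∀ n, y.1 n = 1) : firstZeroFun Y r θ y = θ :=
  dif_neg (by simp [hy])

lemma continuous_firstZeroFun (hr : Tendsto r atTop (𝓝 θ)) : Continuous (firstZeroFun Y r θ) := by
  refine continuous_iff_continuousAt.mpr fun y => ?_
  rcases mem_firstZeroSet_or_forall y with ⟨a, ha⟩ | hy
  · refine ContinuousAt.congr (f := fun _ => r a) continuousAt_const ?_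
    filter_upwards [(isClopen_firstZeroSet a).isOpen.mem_nhds ha] with z hz
    rw [firstZeroFun_of_mem hz]
  · rw [ContinuousAt, firstZeroFun_of_forall hy, Metric.tendsto_nhds]
    intro ε hε
    obtain ⟨N, hN⟩ := Metric.tendsto_atTop.mp hr ε hε
    filter_upwards [(Y.isClopen_cylinder y N).isOpen.mem_nhds (Y.self_mem_cylinder y N)] with z hz
    rcases mem_firstZeroSet_or_forall z with ⟨a, ha⟩ | hz'
    · rw [firstZeroFun_of_mem ha]
      refine hN a (not_lt.mp fun hlt => ?_)
      have hz1 : z.1 a = 1 := (hz a hlt).trans (hy a)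
      exact absurd (ha.2.symm.trans hz1) zero_ne_one
    · rwa [firstZeroFun_of_forall hz', dist_self]

end FirstZero

section AllowsRuns

variable {B : Matrix (Fin 2) (Fin 2) ℕ}

/-- All transitions except possibly the one from `0` to itself are allowed: this covers the full
shift and the golden mean shift. -/
structure AllowsRuns (B : Matrix (Fin 2) (Fin 2) ℕ) : Prop where
  zero_one : B 0 1 = 1
  one_zero : B 1 0 = 1
  one_one : B 1 1 = 1

namespace AllowsRuns

lemma eq_one (h : AllowsRuns B) {i j : Fin 2} (hij : i = 1 ∨ j = 1) : B i j = 1 := by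
  rcases hij with rfl | rfl
  · fin_cases j
    exacts [h.one_zero, h.one_one]
  · fin_cases i
    exacts [h.zero_one, h.one_one]

/-- The point `1 … 1 0 1 1 …` with `a` symbols `1` before the symbol `0`. -/
def runPoint (h : AllowsRuns B) (a : ℕ) : ofMatrix B :=
  ⟨fun n => if n = a then 0 else 1, fun n => h.eq_one (by
    by_cases hn : n = a
    · exact Or.inr (if_neg (by omega))
    · exact Or.inl (if_neg hn))⟩

lemma runPoint_mem_firstZeroSet (h : AllowsRuns B) (a : ℕ) :
    h.runPoint a ∈ (ofMatrix B).firstZeroSet a :=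
  ⟨fun _ hj => if_neg hj.ne, if_pos rfl⟩

lemma mem_closure_exists_zero (h : AllowsRuns B) (y : ofMatrix B) (n : ℕ) :
    y ∈ closure {z | z ∈ (ofMatrix B).cylinder y n ∧ ∃ p, z.1 (n + p) = 0} := by
  by_cases hy : ∃ p, y.1 (n + p) = 0
  · exact subset_closure ⟨self_mem_cylinder _ y n, hy⟩
  push Not at hy
  have hy1 : ∀ i ≥ n, y.1 i = 1 := fun i hi => by
    obtain ⟨p, rfl⟩ := Nat.exists_eq_add_of_le hi
    exact Fin.eq_one_of_ne_zero _ (hy p)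
  have hupdate : ∀ M, Function.update y.1 (n + M + 1) 0 ∈ (ofMatrix B).carrier := fun M i => by
    simp only [Function.update_apply]
    by_cases hi : n ≤ i
    · refine h.eq_one ?_
      rw [hy1 i hi, hy1 (i + 1) (by omega)]
      by_cases hiM : i = n + M + 1
      · exact Or.inr (if_neg (by omega))
      · exact Or.inl (if_neg hiM)
    · rw [if_neg (by omega), if_neg (by omega)]
      exact y.2 i
  let z (M : ℕ) : ofMatrix B := ⟨_, hupdate M⟩
  have hz : ∀ M i, i < n + M + 1 → (z M).1 i = y.1 i := fun M i hi =>
    Function.update_of_ne hi.ne _ _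
  refine mem_closure_of_tendsto (f := z) (b := atTop) (tendsto_subtype_rng.mpr
    (tendsto_pi_nhds.mpr fun i => tendsto_const_nhds.congr' ?_)) (Eventually.of_forall fun M =>
      ⟨fun j hj => hz M j (by omega), M + 1, Function.update_self _ _ _⟩)
  filter_upwards [eventually_ge_atTop i] with M hM
  exact (hz M i (by omega)).symm

end AllowsRuns

end AllowsRuns

end Subshift

namespace Subshift

section RunMass

variable {Y : Subshift 2} {m : Measure Y} {D : ℕ → ℝ} {θ : Fin 2 → ℝ}

/-- The mass of the points at which `0` occurs first at position `a`. -/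
noncomputable def runMass (m : Measure Y) (a : ℕ) : ℝ := m.real (Y.firstZeroSet a)

/-- The conditional probability of the symbol `i` given that it is followed by a run of exactly `a`
symbols `1`. -/
noncomputable def runRatio (m : Measure Y) (i : Fin 2) (a : ℕ) : ℝ :=
  m.real (Y.prepend i (Y.firstZeroSet a)) / runMass m a

lemma sum_measureReal_prepend_firstZeroSet (hm : Y.IsInvariant m) (a : ℕ) :
    ∑ i, m.real (Y.prepend i (Y.firstZeroSet a)) = runMass m a := by
  have := hm.1
  have hmeas := (isClopen_firstZeroSet (Y := Y) a).isOpen.measurableSet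
  rw [← measureReal_shift_preimage m hmeas, hm.2.measureReal_preimage hmeas.nullMeasurableSet,
    runMass]

lemma sum_runRatio (hm : Y.IsInvariant m) {a : ℕ} (ha : 0 < runMass m a) :
    ∑ i, runRatio m i a = 1 := by
  simp only [runRatio]
  rw [← Finset.sum_div, sum_measureReal_prepend_firstZeroSet hm, div_self ha.ne']

lemma runRatio_one (a : ℕ) : runRatio m 1 a = runMass m (a + 1) / runMass m a := by
  rw [runRatio, prepend_one_firstZeroSet, runMass, runMass]

lemma exists_tendsto_runRatio (hm : Y.IsInvariant m) (hu : ∀ a, 0 < runMass m a) {t : ℝ}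
    (ht : Tendsto (fun a => runMass m (a + 1) / runMass m a) atTop (𝓝 t)) :
    ∃ θ : Fin 2 → ℝ, ∀ i, Tendsto (runRatio m i) atTop (𝓝 (θ i)) := by
  refine ⟨![1 - t, t], Fin.forall_fin_two.mpr ⟨?_, ?_⟩⟩
  · refine (ht.const_sub 1).congr fun a => ?_
    rw [← sum_runRatio hm (hu a), Fin.sum_univ_two, runRatio_one, add_sub_cancel_right]
  · exact ht.congr fun a => (runRatio_one a).symm

/-- The conditional probabilities of the first symbol given the length of the run of symbols `1`
that follows it; `θ` is the value at the infinite run. -/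
noncomputable def renewalTransition (m : Measure Y) (θ : Fin 2 → ℝ) (i : Fin 2) : Y → ℝ :=
  firstZeroFun Y (runRatio m i) (θ i)

lemma isTransition_renewalTransition (hm : Y.IsInvariant m)
    (hpos : ∀ (y : Y) (n : ℕ), 1 ≤ n → 0 < m.real (Y.cylinder y n)) (hu : ∀ a, 0 < runMass m a)
    (hlim : ∀ i, Tendsto (runRatio m i) atTop (𝓝 (θ i))) (hθ : ∀ i, 0 < θ i) :
    Y.IsTransition (renewalTransition m θ) where
  cont i := continuous_firstZeroFun (hlim i)
  nonneg i z := by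
    rcases mem_firstZeroSet_or_forall z with ⟨a, ha⟩ | hz
    · rw [renewalTransition, firstZeroFun_of_mem ha]
      exact div_nonneg measureReal_nonneg measureReal_nonneg
    · rw [renewalTransition, firstZeroFun_of_forall hz]
      exact (hθ i).le
  sum_eq_one z := by
    simp only [renewalTransition]
    rcases mem_firstZeroSet_or_forall z with ⟨a, ha⟩ | hz
    · simp only [firstZeroFun_of_mem ha]
      exact sum_runRatio hm (hu a)
    · simp only [firstZeroFun_of_forall hz]
      refine tendsto_nhds_unique (tendsto_finsetSum _ fun i _ => hlim i) ?_
      exact tendsto_const_nhds.congr fun a => (sum_runRatio hm (hu a)).symm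
  pos x := by
    have := hm.1
    rcases mem_firstZeroSet_or_forall (Y.shift x) with ⟨a, ha⟩ | hz
    · rw [renewalTransition, firstZeroFun_of_mem ha, runRatio, ← cylinder_eq_firstZeroSet ha,
        ← cylinder_succ]
      exact div_pos (hpos x _ (by omega)) (hu a)
    · rw [renewalTransition, firstZeroFun_of_forall hz]
      exact hθ _

lemma div_le_runRatio (hD : 0 < D 1)
    (hqm : QuasiMultiplicative Y.shift (fun n y => m.real (Y.cylinder y n)) D) (x : Y) {a : ℕ}
    (ha : Y.shift x ∈ Y.firstZeroSet a) (hu : 0 < runMass m a) :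
    m.real (Y.cylinder x 1) / D 1 ≤ runRatio m (x.1 0) a := by
  have h := (hqm x 1 (a + 1) le_rfl (by omega)).2
  beta_reduce at h
  rw [Function.iterate_one, add_comm 1 (a + 1), Y.cylinder_succ x (a + 1),
    cylinder_eq_firstZeroSet ha] at h
  rwa [runRatio, div_le_div_iff₀ hD hu, mul_comm (m.real (Y.prepend _ _))]

/-- The points before and after an occurrence of the symbol `0` are independent under `m`. -/
def RenewsAtZero (m : Measure Y) : Prop :=
  ∀ w E, IsClopen E → E ⊆ Y.zeroSet →
    m.real (Y.prependWord w E) * m.real Y.zeroSet = m.real (Y.prependWord w Y.zeroSet) * m.real E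

lemma cylinder_eq_prependWord_replicate {k : ℕ} {Z : Subshift k} {z : Z} {i : Fin k} {a : ℕ}
    (hz : ∀ j < a, z.1 j = i) (n : ℕ) :
    Z.cylinder z (a + n) =
      Z.prependWord (List.replicate a i) (Z.cylinder (Z.shift^[a] z) n) := by
  induction a generalizing z with
  | zero => simp
  | succ a ih =>
    rw [Nat.add_right_comm, cylinder_succ, List.replicate_succ, prependWord_cons,
      hz 0 a.succ_pos, ih fun j hj => hz (j + 1) (by omega), Function.iterate_succ_apply]

lemma prependWord_replicate_zeroSet (a : ℕ) :
    Y.prependWord (List.replicate a 1) Y.zeroSet = Y.firstZeroSet a := by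
  induction a with
  | zero => exact firstZeroSet_zero.symm
  | succ a ih => rw [List.replicate_succ, prependWord_cons, ih, prepend_one_firstZeroSet]

lemma RenewsAtZero.renewalTransition_mul_measureReal_cylinder (hren : RenewsAtZero m)
    (hu : ∀ a, 0 < runMass m a) (y : Y) {p : ℕ} (hy : y.1 (p + 1) = 0) :
    renewalTransition m θ (y.1 0) (Y.shift y) * m.real (Y.cylinder (Y.shift y) (p + 1)) =
      m.real (Y.cylinder y (p + 2)) := by
  obtain ⟨a, hap, ha⟩ := exists_mem_firstZeroSet (y := Y.shift y) hy
  obtain ⟨n, rfl⟩ := Nat.exists_eq_add_of_le hap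
  set E := Y.cylinder (Y.shift^[a] (Y.shift y)) (n + 1)
  have hE : IsClopen E := Y.isClopen_cylinder _ _
  have hE0 : E ⊆ Y.zeroSet := fun x hx =>
    (hx 0 n.succ_pos).trans ((iterate_shift_coord ..).trans ha.2)
  have hcyl : Y.cylinder (Y.shift y) (a + n + 1) = Y.prependWord (List.replicate a 1) E :=
    cylinder_eq_prependWord_replicate ha.1 (n + 1)
  have hrun := hren (List.replicate a 1) E hE hE0
  have hrun_succ := hren (y.1 0 :: List.replicate a 1) E hE hE0
  rw [prependWord_replicate_zeroSet, ← hcyl] at hrun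
  rw [prependWord_cons, prependWord_cons, prependWord_replicate_zeroSet, ← hcyl,
    ← cylinder_succ] at hrun_succ
  have hm0 : 0 < m.real Y.zeroSet := firstZeroSet_zero (Y := Y) ▸ hu 0
  have hratio : runRatio m (y.1 0) a * m.real (Y.firstZeroSet a) =
      m.real (Y.prepend (y.1 0) (Y.firstZeroSet a)) := div_mul_cancel₀ _ (hu a).ne'
  rw [renewalTransition, firstZeroFun_of_mem ha]
  refine mul_right_cancel₀ hm0.ne' ?_
  linear_combination runRatio m (y.1 0) a * hrun - hrun_succ + m.real E * hratio

lemma RenewsAtZero.exp_birkhoffSum_mul_measureReal_cylinder (hren : RenewsAtZero m)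
    (hu : ∀ a, 0 < runMass m a) (hq : Y.IsTransition (renewalTransition m θ)) (n p : ℕ) (y : Y)
    (hy : y.1 (n + p) = 0) :
    Real.exp (birkhoffSum Y.shift
        (fun x => Real.log (renewalTransition m θ (x.1 0) (Y.shift x))) n y) *
        m.real (Y.cylinder (Y.shift^[n] y) (p + 1)) =
      m.real (Y.cylinder y (n + p + 1)) := by
  induction n generalizing y with
  | zero => simp
  | succ n ih =>
    rw [Nat.add_right_comm] at hy
    rw [birkhoffSum_succ', Real.exp_add, Real.exp_log (hq.pos y), Function.iterate_succ_apply,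
      mul_assoc, ih _ hy, hren.renewalTransition_mul_measureReal_cylinder hu y hy,
      Nat.add_right_comm n 1 p]

end RunMass

section AllowsRuns

variable {B : Matrix (Fin 2) (Fin 2) ℕ} {m : Measure (ofMatrix B)} {D : ℕ → ℝ} {θ : Fin 2 → ℝ}

lemma AllowsRuns.runMass_pos (h : AllowsRuns B)
    (hpos : ∀ (y : ofMatrix B) (n : ℕ), 1 ≤ n → 0 < m.real ((ofMatrix B).cylinder y n)) (a : ℕ) :
    0 < runMass m a := by
  rw [runMass, ← cylinder_eq_firstZeroSet (h.runPoint_mem_firstZeroSet a)]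
  exact hpos _ _ (by omega)

lemma AllowsRuns.runRatio_limit_pos (h : AllowsRuns B)
    (hpos : ∀ (y : ofMatrix B) (n : ℕ), 1 ≤ n → 0 < m.real ((ofMatrix B).cylinder y n))
    (hD : 0 < D 1)
    (hqm : QuasiMultiplicative (ofMatrix B).shift (fun n y => m.real ((ofMatrix B).cylinder y n)) D)
    {i : Fin 2} {t : ℝ} (ht : Tendsto (runRatio m i) atTop (𝓝 t)) : 0 < t := by
  have hrun (a : ℕ) : B i ((h.runPoint (a + 1)).1 0) = 1 :=
    h.eq_one (Or.inr ((h.runPoint_mem_firstZeroSet (a + 1)).1 0 a.succ_pos))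
  let x (a : ℕ) : ofMatrix B := consPoint (h.runPoint (a + 1)) i (hrun a)
  have hx (a : ℕ) : (ofMatrix B).cylinder (x a) 1 = {z | z.1 0 = i} := cylinder_one _ _
  have hle (a : ℕ) : m.real {z : ofMatrix B | z.1 0 = i} / D 1 ≤ runRatio m i (a + 1) := by
    rw [← hx a]
    refine div_le_runRatio hD hqm (x a) ?_ (h.runMass_pos hpos _)
    rw [shift_consPoint]
    exact h.runPoint_mem_firstZeroSet (a + 1)
  refine (div_pos ?_ hD).trans_le (ge_of_tendsto' ((tendsto_add_atTop_iff_nat 1).mpr ht) hle)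
  rw [← hx 0]
  exact hpos _ _ le_rfl

lemma continuous_birkhoffSum {α : Type*} [TopologicalSpace α] {T : α → α} {g : α → ℝ}
    (hT : Continuous T) (hg : Continuous g) (n : ℕ) : Continuous (birkhoffSum T g n) :=
  continuous_finsetSum _ fun j _ => hg.comp (hT.iterate j)

lemma AllowsRuns.gibbsBounds_renewalTransition (h : AllowsRuns B) (hren : RenewsAtZero m)
    (hpos : ∀ (y : ofMatrix B) (n : ℕ), 1 ≤ n → 0 < m.real ((ofMatrix B).cylinder y n))
    (hD : ∀ n, 1 ≤ n → 0 < D n)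
    (hqm : QuasiMultiplicative (ofMatrix B).shift (fun n y => m.real ((ofMatrix B).cylinder y n)) D)
    (hq : (ofMatrix B).IsTransition (renewalTransition m θ)) :
    (ofMatrix B).GibbsBounds m
      (fun x => Real.log (renewalTransition m θ (x.1 0) ((ofMatrix B).shift x))) 0 D := by
  refine (gibbsBounds_iff hD).mpr fun y n hn => ?_
  rw [mul_zero, sub_zero]
  set g : ofMatrix B → ℝ :=
    fun x => Real.log (renewalTransition m θ (x.1 0) ((ofMatrix B).shift x))
  have hexp : Continuous fun z => Real.exp (birkhoffSum (ofMatrix B).shift g n z) :=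
    (continuous_birkhoffSum (ofMatrix B).continuous_shift hq.continuous_log n).rexp
  refine closure_minimal (t := {z | Real.exp (birkhoffSum (ofMatrix B).shift g n z) ≤
      D n * m.real ((ofMatrix B).cylinder y n) ∧ m.real ((ofMatrix B).cylinder y n) ≤
      D n * Real.exp (birkhoffSum (ofMatrix B).shift g n z)}) ?_
    ((isClosed_le hexp continuous_const).inter (isClosed_le continuous_const (hexp.const_mul _)))
    (h.mem_closure_exists_zero y n)
  rintro z ⟨hz, p, hp⟩
  rw [← cylinder_eq_of_mem _ hz]
  have hexp_mul := hren.exp_birkhoffSum_mul_measureReal_cylinder (h.runMass_pos hpos) hq n p z hp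
  have hqmz := hqm z n (p + 1) hn (by omega)
  beta_reduce at hqmz
  rw [← add_assoc, ← hexp_mul, ← mul_assoc, ← mul_assoc] at hqmz
  have hσz := hpos ((ofMatrix B).shift^[n] z) (p + 1) (by omega)
  exact ⟨le_of_mul_le_mul_right hqmz.1 hσz, le_of_mul_le_mul_right hqmz.2 hσz⟩

/-- The potential is the logarithm of the conditional probability of the first symbol given the
length of the run of symbols `1` that follows it. -/
theorem AllowsRuns.exists_gibbsBounds (h : AllowsRuns B) (hm : (ofMatrix B).IsInvariant m)
    (hpos : ∀ (y : ofMatrix B) (n : ℕ), 1 ≤ n → 0 < m.real ((ofMatrix B).cylinder y n))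
    (hren : RenewsAtZero m) {t : ℝ}
    (ht : Tendsto (fun a => runMass m (a + 1) / runMass m a) atTop (𝓝 t))
    (hD : ∀ n, 1 ≤ n → 0 < D n)
    (hqm : QuasiMultiplicative (ofMatrix B).shift
      (fun n y => m.real ((ofMatrix B).cylinder y n)) D) :
    ∃ g : C(ofMatrix B, ℝ), (ofMatrix B).GibbsBounds m g 0 D ∧
      (Tendsto (fun n : ℕ => Real.log (D n) / n) atTop (𝓝 0) →
        ∀ ν, (ofMatrix B).IsInvariantWeakGibbs ν g → ν = m) := by
  have := hm.1
  have hu := h.runMass_pos hpos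
  obtain ⟨θ, hθ⟩ := exists_tendsto_runRatio hm hu ht
  have hq := isTransition_renewalTransition hm hpos hu hθ fun i =>
    h.runRatio_limit_pos hpos (hD 1 le_rfl) hqm (hθ i)
  have hGibbs := h.gibbsBounds_renewalTransition hren hpos hD hqm hq
  refine ⟨⟨_, hq.continuous_log⟩, hGibbs, fun hDlim ν ⟨hν, P, C, hC, hClim, hνGibbs⟩ => ?_⟩
  have := hν.1
  have hP : 0 ≤ P := hGibbs.pressure_le hD hC hDlim hClim hνGibbs
  refine HasTransitions.eq hν hm
    ((hνGibbs.isMaximalTransition hν hq hP hC hClim).hasTransitions hν)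
    ((hGibbs.isMaximalTransition hm hq le_rfl hD hDlim).hasTransitions hm) (hq.cont 0)
    (fun z hz => hq.pos (consPoint z 0 (h.eq_one (Or.inr hz))))
    (fun i a => ⟨runRatio m i a, fun z hz => firstZeroFun_of_mem hz⟩) ?_
  exact firstZeroSet_zero (Y := ofMatrix B) ▸ hu 0

end AllowsRuns

end Subshift

lemma tendsto_ratio_of_geometric {s : ℕ → ℝ} (hs : ∀ n, 0 < s n) {t : ℝ}
    (h : ∀ n, s (n + 2) = t * s (n + 1)) : Tendsto (fun n => s (n + 1) / s n) atTop (𝓝 t) := by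
  rw [← tendsto_add_atTop_iff_nat 1]
  exact tendsto_const_nhds.congr fun n => by rw [h, mul_div_assoc, div_self (hs _).ne', mul_one]

lemma tendsto_ratio_of_arithmetic {s : ℕ → ℝ} (hs : ∀ n, 0 < s n)
    (h : ∀ n, s (n + 2) = 2 * s (n + 1) - s n) :
    Tendsto (fun n => s (n + 1) / s n) atTop (𝓝 1) := by
  let b := s 1 - s 0
  have hstep (n : ℕ) : s (n + 1) = s n + b := by
    induction n with
    | zero => simp only [b, zero_add, add_sub_cancel]
    | succ n ih => linarith [h n]
  have hform (n : ℕ) : s n = s 0 + n * b := by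
    induction n with
    | zero => rw [Nat.cast_zero, zero_mul, add_zero]
    | succ n ih => rw [hstep, ih]; push_cast; ring
  have hb : 0 ≤ b := by
    by_contra! hneg
    obtain ⟨n, hn⟩ := exists_nat_gt (s 0 / -b)
    rw [div_lt_iff₀ (by linarith)] at hn
    linarith [hs n, hform n]
  have hlim : Tendsto (fun n => b / s n) atTop (𝓝 0) := by
    refine squeeze_zero' (Eventually.of_forall fun n => div_nonneg hb (hs n).le) ?_
      tendsto_one_div_atTop_nhds_zero_nat
    filter_upwards [eventually_gt_atTop 0] with n hn
    rw [div_le_div_iff₀ (hs n) (Nat.cast_pos.mpr hn), one_mul]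
    linarith [hs 0, hform n]
  have hratio (n : ℕ) : 1 + b / s n = s (n + 1) / s n := by
    rw [hstep, add_div, div_self (hs n).ne']
  simpa only [hratio, add_zero] using hlim.const_add 1

lemma tendsto_ratio_of_fibonacci {s : ℕ → ℝ} (hs : ∀ n, 0 < s n)
    (h : ∀ n, s (n + 2) = s (n + 1) + s n) :
    Tendsto (fun n => s (n + 1) / s n) atTop (𝓝 Real.goldenRatio) := by
  have herror (n : ℕ) :
      s (n + 1) - Real.goldenRatio * s n =
        Real.goldenConj ^ n * (s 1 - Real.goldenRatio * s 0) := by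
    induction n with
    | zero => rw [zero_add, pow_zero, one_mul]
    | succ n ih =>
      rw [pow_succ', mul_assoc, ← ih, h]
      linear_combination (- s (n + 1)) * Real.goldenRatio_add_goldenConj +
        s n * Real.goldenRatio_mul_goldenConj
  have hmono (n : ℕ) : s 1 ≤ s (n + 1) := by
    induction n with
    | zero => exact le_rfl
    | succ n ih => linarith [h n, hs n]
  have hconj : |Real.goldenConj| < 1 :=
    abs_lt.mpr ⟨Real.neg_one_lt_goldenConj, Real.goldenConj_neg.trans one_pos⟩
  rw [← tendsto_add_atTop_iff_nat 1, tendsto_iff_norm_sub_tendsto_zero]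
  have hzero : Tendsto (fun n => |Real.goldenConj ^ (n + 1) * (s 1 - Real.goldenRatio * s 0)| / s 1)
      atTop (𝓝 0) := by
    have := ((tendsto_pow_atTop_nhds_zero_of_abs_lt_one hconj).comp (tendsto_add_atTop_nat 1)
      |>.mul_const (s 1 - Real.goldenRatio * s 0)).abs.div_const (s 1)
    simpa only [Function.comp_def, zero_mul, abs_zero, zero_div] using this
  refine squeeze_zero (fun n => norm_nonneg _) (fun n => ?_) hzero
  rw [← herror, Real.norm_eq_abs, div_sub' (hs (n + 1)).ne', abs_div, abs_of_pos (hs (n + 1)),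
    mul_comm (s (n + 1))]
  exact div_le_div_of_nonneg_left (abs_nonneg _) (hs 1) (hmono n)

/-- By Cayley-Hamilton, `s` satisfies a linear recurrence whose coefficients are the trace and the
determinant of the matrix; only the transposition has both determinant `-1` and trace `0`. -/
lemma exists_tendsto_ratio {a b c d : ℝ} (ha : a = 0 ∨ a = 1) (hb : b = 0 ∨ b = 1)
    (hc : c = 0 ∨ c = 1) (hd : d = 0 ∨ d = 1) {U V s : ℕ → ℝ} {u v : ℝ}
    (hU : ∀ n, U (n + 1) = a * U n + b * V n) (hV : ∀ n, V (n + 1) = c * U n + d * V n)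
    (hsUV : ∀ n, s n = u * U n + v * V n) (hs : ∀ n, 0 < s n)
    (hswap : a = 0 → d = 0 → b = 1 → c = 1 → ∀ n, s (n + 1) = s n) :
    ∃ t, Tendsto (fun n => s (n + 1) / s n) atTop (𝓝 t) := by
  have hrec (n : ℕ) : s (n + 2) = (a + d) * s (n + 1) - (a * d - b * c) * s n := by
    rw [hsUV, hsUV, hsUV, hU (n + 1), hV (n + 1), hU n, hV n]
    ring
  have hcases : a * d - b * c = 0 ∨ (a + d = 2 ∧ a * d - b * c = 1) ∨
      (a + d = 1 ∧ a * d - b * c = -1) ∨ (a = 0 ∧ d = 0 ∧ b = 1 ∧ c = 1) := by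
    rcases ha with rfl | rfl <;> rcases hb with rfl | rfl <;> rcases hc with rfl | rfl <;>
      rcases hd with rfl | rfl <;> norm_num
  rcases hcases with hdet | ⟨htr, hdet⟩ | ⟨htr, hdet⟩ | ⟨haz, hdz, hbo, hco⟩
  · exact ⟨a + d, tendsto_ratio_of_geometric hs fun n => by rw [hrec, hdet]; ring⟩
  · exact ⟨1, tendsto_ratio_of_arithmetic hs fun n => by rw [hrec, htr, hdet]; ring⟩
  · exact ⟨Real.goldenRatio,
      tendsto_ratio_of_fibonacci hs fun n => by rw [hrec, htr, hdet]; ring⟩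
  · refine ⟨1, tendsto_const_nhds.congr fun n => ?_⟩
    rw [hswap haz hdz hbo hco, div_self (hs n).ne']

namespace Subshift

section AllowedMatrix

variable {k : ℕ} {A : Matrix (Fin k) (Fin k) ℕ} {μ : Measure (ofMatrix A)} {l : ℝ} {w : Fin k → ℝ}
  {i j : Fin k}

/-- The zero-one matrix of the allowed transitions, on all symbols, including those that do not
occur in the subshift. -/
noncomputable def allowedMatrix (A : Matrix (Fin k) (Fin k) ℕ) : Matrix (Fin k) (Fin k) ℝ :=
  Matrix.of fun i j => if A i j = 1 then 1 else 0

lemma allowedMatrix_apply : allowedMatrix A i j = if A i j = 1 then 1 else 0 := rfl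

lemma allowedMatrix_eq_zero_or_one : allowedMatrix A i j = 0 ∨ allowedMatrix A i j = 1 := by
  rw [allowedMatrix_apply]
  split_ifs <;> simp

lemma allowedMatrix_eq_one_iff : allowedMatrix A i j = 1 ↔ A i j = 1 := by
  simp [allowedMatrix_apply]

lemma backward_eq_allowedMatrix_mul :
    backward A l w i j = allowedMatrix A i j * (w i / (l * w j)) := by
  rw [backward, allowedMatrix_apply, ite_mul, one_mul, zero_mul]

lemma IsParryMeasure.vecMul_allowedMatrix (hμ : IsParryMeasure μ l w)
    (hj : ∃ x : ofMatrix A, x.1 0 = j) : Matrix.vecMul w (allowedMatrix A) j = l * w j := by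
  obtain ⟨x, rfl⟩ := hj
  simp only [← hμ.sum_weight_eq x, Matrix.vecMul, dotProduct, allowedMatrix_apply, mul_ite, mul_one,
    mul_zero]

end AllowedMatrix

section Fiber

open Matrix

variable {k : ℕ} {A : Matrix (Fin k) (Fin k) ℕ} {Y : Subshift 2} {π : ofMatrix A → Y}
  {φ : Fin k → Fin 2} {μ : Measure (ofMatrix A)} {l : ℝ} {w : Fin k → ℝ} {E : Set Y} {s : Fin 2}
  {i : Fin k}

/-- The mass of the points over `E` that start with the symbol `i`. -/
noncomputable def fiberMass (μ : Measure (ofMatrix A)) (π : ofMatrix A → Y) (E : Set Y)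
    (i : Fin k) : ℝ := μ.real (π ⁻¹' E ∩ {x | x.1 0 = i})

lemma measureReal_map_eq_sum_fiberMass [IsFiniteMeasure μ] (hπ : Measurable π)
    (hE : MeasurableSet E) : (μ.map π).real E = ∑ i, fiberMass μ π E i := by
  have hunion : π ⁻¹' E = ⋃ i, (π ⁻¹' E ∩ {x | x.1 0 = i}) := by
    ext x
    simp
  rw [map_measureReal_apply hπ hE]
  conv_lhs => rw [hunion]
  refine measureReal_iUnion_fintype (fun i j hij => ?_) fun i =>
    (hπ hE).inter ((ofMatrix A).isClopen_symbol 0 i).isOpen.measurableSet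
  exact Set.disjoint_left.mpr fun x hx hx' => hij (hx.2.symm.trans hx'.2)

lemma fiberMass_eq_zero (hcode : IsOneBlockCode φ π) (hE : ∀ y ∈ E, y.1 0 = s) (hi : φ i ≠ s) :
    fiberMass μ π E i = 0 := by
  have hempty : π ⁻¹' E ∩ {x | x.1 0 = i} = ∅ :=
    Set.eq_empty_of_forall_notMem fun x hx =>
      hi (hx.2 ▸ (hcode x 0).symm.trans (hE _ hx.1))
  rw [fiberMass, hempty, measureReal_empty]

lemma fiberMass_prepend (hμ : IsParryMeasure μ l w) (hπ : IsFactorMap π)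
    (hcode : IsOneBlockCode φ π) (hE : IsClopen E) (hi : φ i = s) :
    fiberMass μ π (Y.prepend s E) i = ∑ j, backward A l w i j * fiberMass μ π E j := by
  have hset : π ⁻¹' Y.prepend s E ∩ {x | x.1 0 = i} = (ofMatrix A).prepend i (π ⁻¹' E) := by
    ext x
    simp only [prepend, Set.mem_inter_iff, Set.mem_preimage, Set.mem_ofPred_eq, hcode x 0, ← hπ.2.2]
    exact ⟨fun hx => ⟨hx.2, hx.1.2⟩, fun hx => ⟨⟨hx.1 ▸ hi, hx.2⟩, hx.1⟩⟩
  rw [fiberMass, hset]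
  exact hμ.measureReal_prepend i _ (hE.preimage hπ.1)

lemma fiberMass_prependWord_mul [IsFiniteMeasure μ] (hμ : IsParryMeasure μ l w)
    (hπ : IsFactorMap π) (hcode : IsOneBlockCode φ π) {i₀ : Fin k} (hφ : ∀ i, φ i = 0 → i = i₀)
    (u : List (Fin 2)) (hE : IsClopen E) (hE0 : E ⊆ Y.zeroSet) (i : Fin k) :
    fiberMass μ π (Y.prependWord u E) i * (μ.map π).real Y.zeroSet =
      fiberMass μ π (Y.prependWord u Y.zeroSet) i * (μ.map π).real E := by
  have hsingle (F : Set Y) (hF : IsClopen F) (hF0 : F ⊆ Y.zeroSet) :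
      (μ.map π).real F = fiberMass μ π F i₀ := by
    rw [measureReal_map_eq_sum_fiberMass hπ.1.measurable hF.isOpen.measurableSet]
    exact Fintype.sum_eq_single _ fun i hi => fiberMass_eq_zero hcode hF0 (mt (hφ i) hi)
  induction u generalizing i with
  | nil =>
    rw [prependWord_nil, prependWord_nil]
    by_cases hi : φ i = 0
    · rw [hφ i hi, hsingle E hE hE0, hsingle _ isClopen_zeroSet subset_rfl, mul_comm]
    · rw [fiberMass_eq_zero hcode hE0 hi,
        fiberMass_eq_zero (E := Y.zeroSet) hcode (fun _ hy => hy) hi, zero_mul, zero_mul]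
  | cons s u ih =>
    rw [prependWord_cons, prependWord_cons]
    by_cases hi : φ i = s
    · rw [fiberMass_prepend hμ hπ hcode (Y.isClopen_prependWord u hE) hi,
        fiberMass_prepend hμ hπ hcode (Y.isClopen_prependWord u isClopen_zeroSet) hi,
        Finset.sum_mul, Finset.sum_mul]
      exact Finset.sum_congr rfl fun j _ => by rw [mul_assoc, ih, mul_assoc]
    · rw [fiberMass_eq_zero hcode (fun _ hy => hy.1) hi,
        fiberMass_eq_zero hcode (fun _ hy => hy.1) hi, zero_mul, zero_mul]

theorem renewsAtZero_map [IsFiniteMeasure μ] (hμ : IsParryMeasure μ l w) (hπ : IsFactorMap π)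
    (hcode : IsOneBlockCode φ π) {i₀ : Fin k} (hφ : ∀ i, φ i = 0 → i = i₀) :
    RenewsAtZero (μ.map π) := by
  intro u E hE hE0
  rw [measureReal_map_eq_sum_fiberMass hπ.1.measurable
      (Y.isClopen_prependWord u hE).isOpen.measurableSet,
    measureReal_map_eq_sum_fiberMass hπ.1.measurable
      (Y.isClopen_prependWord u isClopen_zeroSet).isOpen.measurableSet,
    Finset.sum_mul, Finset.sum_mul]
  exact Finset.sum_congr rfl fun i _ => fiberMass_prependWord_mul hμ hπ hcode hφ u hE hE0 i

/-- The masses over `firstZeroSet a` of the symbols, normalized by the eigenvector `w` and the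
eigenvalue `l`, so that these vectors evolve by `allowedMatrix`. -/
noncomputable def runVector (μ : Measure (ofMatrix A)) (π : ofMatrix A → Y) (l : ℝ) (w : Fin k → ℝ)
    (a : ℕ) (i : Fin k) : ℝ := l ^ a * (fiberMass μ π (Y.firstZeroSet a) i / w i)

lemma pow_mul_fiberMass_prepend_firstZeroSet (hμ : IsParryMeasure μ l w) (hπ : IsFactorMap π)
    (hcode : IsOneBlockCode φ π) (a : ℕ) (hi : φ i = s) :
    l ^ (a + 1) * fiberMass μ π (Y.prepend s (Y.firstZeroSet a)) i =
      w i * (allowedMatrix A *ᵥ runVector μ π l w a) i := by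
  rw [fiberMass_prepend hμ hπ hcode (isClopen_firstZeroSet a) hi, mulVec, dotProduct,
    Finset.mul_sum, Finset.mul_sum]
  refine Finset.sum_congr rfl fun j _ => ?_
  have hl := hμ.pos.ne'
  have hw := (hμ.weight_pos j).ne'
  rw [backward_eq_allowedMatrix_mul, runVector]
  field_simp
  ring

lemma runVector_succ (hμ : IsParryMeasure μ l w) (hπ : IsFactorMap π) (hcode : IsOneBlockCode φ π)
    (a : ℕ) (hi : φ i = 1) :
    runVector μ π l w (a + 1) i = (allowedMatrix A *ᵥ runVector μ π l w a) i := by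
  rw [runVector, ← mul_div_assoc, ← prepend_one_firstZeroSet,
    pow_mul_fiberMass_prepend_firstZeroSet hμ hπ hcode a hi,
    mul_div_cancel_left₀ _ (hμ.weight_pos i).ne']

lemma runVector_zero_eq_zero (hcode : IsOneBlockCode φ π) (hi : φ i ≠ 0) :
    runVector μ π l w 0 i = 0 := by
  rw [runVector, fiberMass_eq_zero hcode (fun _ hy => hy.2) hi, zero_div, mul_zero]

lemma runVector_succ_eq_zero (hcode : IsOneBlockCode φ π) (a : ℕ) (hi : φ i ≠ 1) :
    runVector μ π l w (a + 1) i = 0 := by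
  rw [runVector, fiberMass_eq_zero hcode (fun _ hy => hy.1 0 a.succ_pos) hi, zero_div, mul_zero]

lemma pow_mul_runMass [IsFiniteMeasure μ] (hμ : IsParryMeasure μ l w) (hπ : Measurable π) (a : ℕ) :
    l ^ a * runMass (μ.map π) a = w ⬝ᵥ runVector μ π l w a := by
  rw [runMass, measureReal_map_eq_sum_fiberMass hπ (isClopen_firstZeroSet a).isOpen.measurableSet,
    Finset.mul_sum, dotProduct]
  refine Finset.sum_congr rfl fun i _ => ?_
  rw [runVector, mul_left_comm, mul_div_cancel₀ _ (hμ.weight_pos i).ne']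

end Fiber

section ThreeSymbols

open Matrix

variable {A : Matrix (Fin 3) (Fin 3) ℕ} {B : Matrix (Fin 2) (Fin 2) ℕ}
  {π : ofMatrix A → ofMatrix B} {μ : Measure (ofMatrix A)} {l : ℝ} {w : Fin 3 → ℝ}

lemma AllowsRuns.measureReal_prepend_firstZeroSet_pos {m : Measure (ofMatrix B)}
    (h : AllowsRuns B)
    (hpos : ∀ (y : ofMatrix B) (n : ℕ), 1 ≤ n → 0 < m.real ((ofMatrix B).cylinder y n))
    (i : Fin 2) (a : ℕ) :
    0 < m.real ((ofMatrix B).prepend i ((ofMatrix B).firstZeroSet (a + 1))) := by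
  have hmem := h.runPoint_mem_firstZeroSet (a + 1)
  rw [← cylinder_eq_firstZeroSet hmem, prepend_cylinder_of_transition _ _ _
    (h.eq_one (Or.inr (hmem.1 0 a.succ_pos)))]
  exact hpos _ _ (by omega)

lemma IsParryMeasure.weight_one_eq_weight_two (hμ : IsParryMeasure μ l w)
    (hocc : ∃ x : ofMatrix A, x.1 0 = 1 ∨ x.1 0 = 2)
    (h01 : allowedMatrix A 0 1 = 1) (h02 : allowedMatrix A 0 2 = 1)
    (h11 : allowedMatrix A 1 1 = 0) (h12 : allowedMatrix A 1 2 = 1)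
    (h21 : allowedMatrix A 2 1 = 1) (h22 : allowedMatrix A 2 2 = 0) : w 1 = w 2 := by
  obtain ⟨hocc1, hocc2⟩ :
      (∃ x : ofMatrix A, x.1 0 = 1) ∧ ∃ x : ofMatrix A, x.1 0 = 2 := by
    obtain ⟨x, hx | hx⟩ := hocc
    · exact ⟨⟨x, hx⟩, consPoint x 2 (hx ▸ allowedMatrix_eq_one_iff.mp h21), rfl⟩
    · exact ⟨⟨consPoint x 1 (hx ▸ allowedMatrix_eq_one_iff.mp h12), rfl⟩, x, hx⟩
  have heigen1 := hμ.vecMul_allowedMatrix hocc1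
  have heigen2 := hμ.vecMul_allowedMatrix hocc2
  simp only [vecMul, dotProduct, Fin.sum_univ_three, h01, h02, h11, h12, h21, h22]
    at heigen1 heigen2
  have hmul : (l + 1) * (w 1 - w 2) = 0 := by linear_combination heigen2 - heigen1
  linarith [(mul_eq_zero.mp hmul).resolve_left (by linarith [hμ.pos])]

variable (hcode : IsOneBlockCode ![0, 1, 1] π)
include hcode

lemma allowedMatrix_mulVec_runVector_succ (a : ℕ) (i : Fin 3) :
    (allowedMatrix A *ᵥ runVector μ π l w (a + 1)) i =
      allowedMatrix A i 1 * runVector μ π l w (a + 1) 1 +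
        allowedMatrix A i 2 * runVector μ π l w (a + 1) 2 := by
  rw [mulVec, dotProduct, Fin.sum_univ_three,
    runVector_succ_eq_zero (i := 0) hcode a (by decide), mul_zero, zero_add]

variable (hμ : IsParryMeasure μ l w) (hπ : IsFactorMap π)
include hμ hπ

lemma runVector_one (i : Fin 3) (hi : i ≠ 0) :
    runVector μ π l w 1 i = allowedMatrix A i 0 * runVector μ π l w 0 0 := by
  have hcode_i : (![0, 1, 1] : Fin 3 → Fin 2) i = 1 := by revert i; decide
  rw [runVector_succ hμ hπ hcode 0 hcode_i, mulVec, dotProduct, Fin.sum_univ_three,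
    runVector_zero_eq_zero (i := 1) hcode (by decide),
    runVector_zero_eq_zero (i := 2) hcode (by decide), mul_zero, mul_zero, add_zero, add_zero]

lemma runVector_succ_succ (a : ℕ) (i : Fin 3) (hi : i ≠ 0) :
    runVector μ π l w (a + 2) i = allowedMatrix A i 1 * runVector μ π l w (a + 1) 1 +
      allowedMatrix A i 2 * runVector μ π l w (a + 1) 2 := by
  have hcode_i : (![0, 1, 1] : Fin 3 → Fin 2) i = 1 := by revert i; decide
  rw [runVector_succ hμ hπ hcode (a + 1) hcode_i, allowedMatrix_mulVec_runVector_succ hcode]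

lemma pow_mul_runMass_succ [IsFiniteMeasure μ] (a : ℕ) :
    l ^ (a + 1) * runMass (μ.map π) (a + 1) =
      w 1 * runVector μ π l w (a + 1) 1 + w 2 * runVector μ π l w (a + 1) 2 := by
  rw [pow_mul_runMass hμ hπ.1.measurable, dotProduct, Fin.sum_univ_three,
    runVector_succ_eq_zero (i := 0) hcode a (by decide), mul_zero, zero_add]

lemma allowedMatrix_mulVec_runVector_pos [IsFiniteMeasure μ] (h : AllowsRuns B)
    (hpos : ∀ (y : ofMatrix B) (n : ℕ), 1 ≤ n → 0 < (μ.map π).real ((ofMatrix B).cylinder y n))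
    (a : ℕ) :
    0 < allowedMatrix A 0 1 * runVector μ π l w (a + 1) 1 +
      allowedMatrix A 0 2 * runVector μ π l w (a + 1) 2 := by
  have hprepend := h.measureReal_prepend_firstZeroSet_pos hpos 0 a
  rw [measureReal_map_eq_sum_fiberMass hπ.1.measurable
    ((ofMatrix B).isClopen_prepend 0 (isClopen_firstZeroSet _)).isOpen.measurableSet,
    Fin.sum_univ_three, fiberMass_eq_zero (i := 1) hcode (fun _ hy => hy.1) (by decide),
    fiberMass_eq_zero (i := 2) hcode (fun _ hy => hy.1) (by decide), add_zero, add_zero] at hprepend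
  have hmul := mul_pos (pow_pos hμ.pos (a + 2)) hprepend
  rw [pow_mul_fiberMass_prepend_firstZeroSet (i := 0) (s := 0) hμ hπ hcode (a + 1) rfl,
    allowedMatrix_mulVec_runVector_succ hcode] at hmul
  exact pos_of_mul_pos_right hmul (hμ.weight_pos 0).le

lemma runVector_one_eq_runVector_two [IsFiniteMeasure μ] (h : AllowsRuns B)
    (hpos : ∀ (y : ofMatrix B) (n : ℕ), 1 ≤ n → 0 < (μ.map π).real ((ofMatrix B).cylinder y n))
    (h0 : ¬(allowedMatrix A 0 1 = 1 ∧ allowedMatrix A 0 2 = 1))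
    (h11 : allowedMatrix A 1 1 = 0) (h12 : allowedMatrix A 1 2 = 1)
    (h21 : allowedMatrix A 2 1 = 1) (h22 : allowedMatrix A 2 2 = 0) (a : ℕ) :
    runVector μ π l w (a + 1) 1 = runVector μ π l w (a + 1) 2 := by
  have hone (i : Fin 3) (hi : i ≠ 0) := runVector_one hcode hμ hπ i hi
  have hswap1 (a : ℕ) : runVector μ π l w (a + 2) 1 = runVector μ π l w (a + 1) 2 := by
    rw [runVector_succ_succ hcode hμ hπ a 1 (by decide), h11, h12, zero_mul, one_mul, zero_add]
  have hswap2 (a : ℕ) : runVector μ π l w (a + 2) 2 = runVector μ π l w (a + 1) 1 := by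
    rw [runVector_succ_succ hcode hμ hπ a 2 (by decide), h21, h22, zero_mul, one_mul, add_zero]
  induction a with
  | zero =>
    have hgap0 := allowedMatrix_mulVec_runVector_pos hcode hμ hπ h hpos 0
    have hgap1 := allowedMatrix_mulVec_runVector_pos hcode hμ hπ h hpos 1
    rw [hswap1, hswap2] at hgap1
    rw [zero_add, hone 1 (by decide), hone 2 (by decide)] at hgap0 hgap1 ⊢
    have hend : allowedMatrix A 1 0 = 1 ∧ allowedMatrix A 2 0 = 1 := by
      rcases allowedMatrix_eq_zero_or_one (A := A) (i := 0) (j := 1) with h01 | h01 <;>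
        rcases allowedMatrix_eq_zero_or_one (A := A) (i := 0) (j := 2) with h02 | h02 <;>
        rcases allowedMatrix_eq_zero_or_one (A := A) (i := 1) (j := 0) with h10 | h10 <;>
        rcases allowedMatrix_eq_zero_or_one (A := A) (i := 2) (j := 0) with h20 | h20 <;>
        simp_all
    rw [hend.1, hend.2]
  | succ a ih => rw [hswap1, hswap2, ih]

/-- If the two symbols over `1` can only follow each other, then the masses of the runs are
`l ^ (-a)` up to a factor of period two in `a`. This factor is constant: either both symbols can
follow `0`, and then they have the same weight by the eigenvector equation, or only one can, and
then both must lead to `0`, since runs of both parities occur between two symbols `0`. -/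
lemma pow_mul_runMass_eq_of_swap [IsFiniteMeasure μ] (h : AllowsRuns B)
    (hpos : ∀ (y : ofMatrix B) (n : ℕ), 1 ≤ n → 0 < (μ.map π).real ((ofMatrix B).cylinder y n))
    (h11 : allowedMatrix A 1 1 = 0) (h12 : allowedMatrix A 1 2 = 1)
    (h21 : allowedMatrix A 2 1 = 1) (h22 : allowedMatrix A 2 2 = 0) (a : ℕ) :
    l ^ (a + 2) * runMass (μ.map π) (a + 2) = l ^ (a + 1) * runMass (μ.map π) (a + 1) := by
  rw [pow_mul_runMass_succ hcode hμ hπ, pow_mul_runMass_succ hcode hμ hπ,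
    runVector_succ_succ hcode hμ hπ a 1 (by decide),
    runVector_succ_succ hcode hμ hπ a 2 (by decide), h11, h12, h21, h22]
  by_cases h0 : allowedMatrix A 0 1 = 1 ∧ allowedMatrix A 0 2 = 1
  · have hocc : ∃ x : ofMatrix A, x.1 0 = 1 ∨ x.1 0 = 2 := by
      obtain ⟨x, hx⟩ := hπ.2.1 (h.runPoint 1)
      have hx1 : (![0, 1, 1] : Fin 3 → Fin 2) (x.1 0) = 1 := by
        rw [← hcode x 0, hx]
        exact (h.runPoint_mem_firstZeroSet 1).1 0 one_pos
      refine ⟨x, ?_⟩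
      generalize x.1 0 = i at hx1 ⊢
      revert i
      decide
    rw [hμ.weight_one_eq_weight_two hocc h0.1 h0.2 h11 h12 h21 h22]
    ring
  · rw [runVector_one_eq_runVector_two hcode hμ hπ h hpos h0 h11 h12 h21 h22]
    ring

theorem exists_tendsto_runMass_ratio [IsFiniteMeasure μ] (h : AllowsRuns B)
    (hpos : ∀ (y : ofMatrix B) (n : ℕ), 1 ≤ n → 0 < (μ.map π).real ((ofMatrix B).cylinder y n)) :
    ∃ t, Tendsto (fun a => runMass (μ.map π) (a + 1) / runMass (μ.map π) a) atTop (𝓝 t) := by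
  have hrun := h.runMass_pos hpos
  obtain ⟨t, ht⟩ := exists_tendsto_ratio
    (s := fun a => l ^ (a + 1) * runMass (μ.map π) (a + 1))
    allowedMatrix_eq_zero_or_one allowedMatrix_eq_zero_or_one
    allowedMatrix_eq_zero_or_one allowedMatrix_eq_zero_or_one
    (fun a => runVector_succ_succ hcode hμ hπ a 1 (by decide))
    (fun a => runVector_succ_succ hcode hμ hπ a 2 (by decide))
    (fun a => pow_mul_runMass_succ hcode hμ hπ a)
    (fun a => mul_pos (pow_pos hμ.pos _) (hrun _))
    (fun h11 h22 h12 h21 a => pow_mul_runMass_eq_of_swap hcode hμ hπ h hpos h11 h12 h21 h22 a)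
  refine ⟨t / l, (tendsto_add_atTop_iff_nat 1).mp ((ht.div_const l).congr fun a => ?_)⟩
  have hl := hμ.pos.ne'
  have hrun_ne := (hrun (a + 1)).ne'
  rw [pow_succ]
  field_simp

end ThreeSymbols

end Subshift

namespace Subshift

section Image

variable {k d : ℕ} {X : Subshift k} {Y : Subshift d}

lemma IsInvariant.map {π : X → Y} (hπ : IsFactorMap π) {μ : Measure X} (hμ : X.IsInvariant μ) :
    Y.IsInvariant (μ.map π) := by
  have := hμ.1
  have hmeas := hπ.1.measurable
  have hcomm : Y.shift ∘ π = π ∘ X.shift := funext fun x => (hπ.2.2 x).symm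
  refine ⟨Measure.isProbabilityMeasure_map hmeas.aemeasurable, Y.measurable_shift, ?_⟩
  rw [Measure.map_map Y.measurable_shift hmeas, hcomm, ← Measure.map_map hmeas X.measurable_shift,
    hμ.2.map_eq]

lemma IsInvariantGibbs.isInvariantWeakGibbs {ν : Measure Y} {g : Y → ℝ}
    (h : Y.IsInvariantGibbs ν g) : Y.IsInvariantWeakGibbs ν g :=
  let ⟨hν, P, C, hC, hg⟩ := h
  ⟨hν, P, fun _ => C, fun _ _ => hC, tendsto_const_div_atTop_nhds_zero_nat _, hg⟩

variable {A : Matrix (Fin k) (Fin k) ℕ} {π : ofMatrix A → Y} {μ : Measure (ofMatrix A)}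
  {φ : Fin k → Fin d}

lemma IsMaximalEntropy.measureReal_map_cylinder_pos (hμ : (ofMatrix A).IsMaximalEntropy μ)
    (hX : (ofMatrix A).IsIrreducible) (hπ : IsFactorMap π) (hcode : IsOneBlockCode φ π)
    (y : Y) (n : ℕ) (hn : 1 ≤ n) : 0 < (μ.map π).real (Y.cylinder y n) := by
  have := hμ.1.1
  obtain ⟨l, w, hparry⟩ := hμ.exists_isParryMeasure hX
  obtain ⟨c, C, hc, -, hcyl⟩ := hparry.measureReal_cylinder_bounds hX
  obtain ⟨x, rfl⟩ := hπ.2.1 y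
  rw [map_measureReal_apply hπ.1.measurable (Y.isClopen_cylinder _ n).isOpen.measurableSet]
  exact (pos_of_mul_pos_right (hc.trans_le (hcyl x n hn).1) (pow_pos hparry.pos n).le).trans_le
    (measureReal_mono fun z hz => hcode.image_mem_cylinder hz)

lemma IsMaximalEntropy.uniformlyComparable_relPressureSeq (hμ : (ofMatrix A).IsMaximalEntropy μ)
    (hX : (ofMatrix A).IsIrreducible) (hπ : IsFactorMap π) (hcode : IsOneBlockCode φ π) :
    ∃ l : ℝ, 0 < l ∧ UniformlyComparable (relPressureSeq π fun _ => 0)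
      fun n y => l ^ n * (μ.map π).real (Y.cylinder y n) := by
  have := hμ.1.1
  obtain ⟨l, w, hparry⟩ := hμ.exists_isParryMeasure hX
  obtain ⟨c, C, hc, -, hcyl⟩ := hparry.measureReal_cylinder_bounds hX
  exact ⟨l, hparry.pos, Subshift.uniformlyComparable_relPressureSeq hcode hπ.1.measurable hc hcyl⟩

theorem IsInvariantGibbs.almostAdditive_relPressureSeq {g : Y → ℝ}
    (hg : Y.IsInvariantGibbs (μ.map π) g) (hμ : (ofMatrix A).IsMaximalEntropy μ)
    (hX : (ofMatrix A).IsIrreducible) (hπ : IsFactorMap π) (hcode : IsOneBlockCode φ π) :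
    Y.AlmostAdditive (relPressureSeq π fun _ => 0) := by
  obtain ⟨l, hl, hcomp⟩ := hμ.uniformlyComparable_relPressureSeq hX hπ hcode
  obtain ⟨-, P, C, hC, hGibbs⟩ := hg
  obtain ⟨K, hK, hqm⟩ := (hcomp.trans ((hGibbs.uniformlyComparable hC).const_pow_mul hl)).symm
    |>.exists_quasiMultiplicative fun n y => by positivity
  exact almostAdditive_of_quasiMultiplicative (mul_pos hK one_pos) (relPressureSeq_nonneg π _)
    (hqm 1 (fun _ => one_pos) ((quasiMultiplicative_const_pow_mul_iff hl).mpr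
      (quasiMultiplicative_exp_birkhoffSum _)))

end Image

theorem IsMaximalEntropy.exists_gibbsBounds_map {A : Matrix (Fin 3) (Fin 3) ℕ}
    {B : Matrix (Fin 2) (Fin 2) ℕ} {π : ofMatrix A → ofMatrix B} {μ : Measure (ofMatrix A)}
    {b : ℕ → ℝ} (hμ : (ofMatrix A).IsMaximalEntropy μ) (hX : (ofMatrix A).IsIrreducible)
    (hB : AllowsRuns B) (hπ : IsFactorMap π) (hcode : IsOneBlockCode ![0, 1, 1] π)
    (hqm : QuasiMultiplicative (ofMatrix B).shift (relPressureSeq π fun _ => 0)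
      fun n => Real.exp (b n)) :
    ∃ (K : ℝ) (g : C(ofMatrix B, ℝ)), 0 < K ∧
      (ofMatrix B).GibbsBounds (μ.map π) g 0 (fun n => K * Real.exp (b n)) ∧
      (Tendsto (fun n : ℕ => Real.log (K * Real.exp (b n)) / n) atTop (𝓝 0) →
        ∀ ν, (ofMatrix B).IsInvariantWeakGibbs ν g → ν = μ.map π) := by
  have := hμ.1.1
  have hpos := hμ.measureReal_map_cylinder_pos hX hπ hcode
  obtain ⟨l, w, hparry⟩ := hμ.exists_isParryMeasure hX
  obtain ⟨t, ht⟩ := exists_tendsto_runMass_ratio hcode hparry hπ hB hpos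
  obtain ⟨r, hr, hcomp⟩ := hμ.uniformlyComparable_relPressureSeq hX hπ hcode
  obtain ⟨K, hK, hKqm⟩ := hcomp.exists_quasiMultiplicative (relPressureSeq_nonneg π _)
  obtain ⟨g, hg, hunique⟩ := hB.exists_gibbsBounds (hμ.1.map hπ) hpos
    (renewsAtZero_map (i₀ := 0) hparry hπ hcode (by decide)) ht
    (fun n _ => mul_pos hK (Real.exp_pos _))
    ((quasiMultiplicative_const_pow_mul_iff hr).mp (hKqm _ (fun n => Real.exp_pos _) hqm))
  exact ⟨K, g, hK, hg, hunique⟩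

lemma tendsto_log_mul_exp_div {K : ℝ} (hK : 0 < K) {b : ℕ → ℝ}
    (hb : Tendsto (fun n : ℕ => b n / n) atTop (𝓝 0)) :
    Tendsto (fun n : ℕ => Real.log (K * Real.exp (b n)) / n) atTop (𝓝 0) := by
  simp only [Real.log_mul hK.ne' (Real.exp_ne_zero _), Real.log_exp, add_div]
  simpa only [add_zero] using (tendsto_const_div_atTop_nhds_zero_nat (Real.log K)).add hb

end Subshift

theorem corollary4p10
    (A : Matrix (Fin 3) (Fin 3) ℕ) (hA : ∀ i j, A i j = 0 ∨ A i j = 1)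
    (B : Matrix (Fin 2) (Fin 2) ℕ) (hB : B = !![1, 1; 1, 1] ∨ B = !![0, 1; 1, 1])
    (X : Subshift 3) (hXA : X = Subshift.ofMatrix A) (hX : X.IsIrreducible)
    (Y : Subshift 2) (hYB : Y = Subshift.ofMatrix B)
    (π : X → Y) (hπ : Subshift.IsFactorMap π) (hcode : Subshift.IsOneBlockCode ![0, 1, 1] π)
    (μ : Measure X) (hμ : X.IsMaximalEntropy μ) :
    (Y.AlmostAdditive (Subshift.relPressureSeq π (fun _ => 0)) ↔
      ∃ g : C(Y, ℝ), Y.IsInvariantGibbs (μ.map π) g ∧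
        ∀ ν : Measure Y, Y.IsInvariantGibbs ν g → ν = μ.map π) ∧
    (Y.WeaklyAlmostAdditive (Subshift.relPressureSeq π (fun _ => 0)) →
      ∃ g : C(Y, ℝ), Y.IsInvariantWeakGibbs (μ.map π) g ∧
        ∀ ν : Measure Y, Y.IsInvariantWeakGibbs ν g → ν = μ.map π) := by
  subst hXA hYB
  have hruns : Subshift.AllowsRuns B := by
    rcases hB with rfl | rfl <;> exact ⟨rfl, rfl, rfl⟩
  have hinv := hμ.1.map hπ
  refine ⟨⟨?_, fun ⟨g, hg, _⟩ => hg.almostAdditive_relPressureSeq hμ hX hπ hcode⟩, ?_⟩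
  · rintro ⟨b, -, hb⟩
    obtain ⟨K, g, hK, hg, hunique⟩ := hμ.exists_gibbsBounds_map hX hruns hπ hcode
      (quasiMultiplicative_exp_iff (B := fun _ => b).mpr hb)
    exact ⟨g, ⟨hinv, 0, K * Real.exp b, mul_pos hK (Real.exp_pos _), hg⟩, fun ν hν =>
      hunique (tendsto_const_div_atTop_nhds_zero_nat _) ν hν.isInvariantWeakGibbs⟩
  · rintro ⟨b, -, hlim, hb⟩
    obtain ⟨K, g, hK, hg, hunique⟩ := hμ.exists_gibbsBounds_map hX hruns hπ hcode
      (quasiMultiplicative_exp_iff.mpr hb)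
    have hlog := Subshift.tendsto_log_mul_exp_div hK hlim
    exact ⟨g, ⟨hinv, 0, _, fun n _ => mul_pos hK (Real.exp_pos _), hlog, hg⟩, hunique hlog⟩
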